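/- Let $M$ be a smooth, Hausdorff, second countable $d$-dimensional manifold, $g$ a smooth Lorentzian metric on $M$ of signature $(-,+,\dots,+)$, time-oriented by a continuous timelike vector field (for instance, let $(M,g)$ be a globally hyperbolic space-time), and let $k\ge 1$. For $x\in M$ let $V_{+,g}(x)$ (resp. $V_{-,g}(x)$) $\subset T^*_xM$ be the open cone of future (resp. past) directed timelike covectors, and let $$\Upsilon_{k,g}=\Big\{(x_1,\dots,x_k;\xi_1,\dots,\xi_k)\in T^*M^k\setminus 0:\ (\xi_1,\dots,\xi_k)\notin \prod_{j=1}^k\overline V_{+,g}(x_j)\ \cup\ \prod_{j=1}^k\overline V_{-,g}(x_j)\Big\}.$$ Let $\mathscr E'(M^k)$ be the space of compactly supported complex distribution densities on $M^k$, i.e. the topological dual of $C^\infty(M^k)$, and for $S\subset T^*M^k\setminus 0$ let $\mathscr E'_S=\{u\in\mathscr E'(M^k):\mathrm{WF}(u)\subset S\}$. For a closed cone $\Gamma\subset T^*M^k\setminus 0$ (conic, and closed in $T^*M^k\setminus 0$) the Hörmander topology on $\mathscr E'_\Gamma$ is given by the seminorms $u\mapsto|u(f)|$, $f\in C^\infty(M^k)$,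 and $u\mapsto\sup_{\eta\in V}(1+|\eta|)^n|\widehat{\chi u}(\eta)|$, where $n\in\mathbb N$, the Fourier transform is taken in a chart of $M^k$, $\chi$ is a smooth function with compact support in the domain of that chart, and $V$ is a closed cone of covectors such that $\mathrm{supp}\,\chi\times (V\setminus\{0\})$, regarded as a subset of $T^*M^k$ through the chart, does not meet $\Gamma$. (1) There is a sequence $(\Gamma_{k,m})_{m\in\mathbb N}$ of closed cones in $T^*M^k\setminus 0$ with $\Gamma_{k,m}\subset\mathrm{int}\,\Gamma_{k,m+1}$ for all $m$ and $\bigcup_m\Gamma_{k,m}=\Upsilon_{k,g}$. (2) For every such sequence, the spaces $\mathscr E'_{\Gamma_{k,m}}$ with their Hörmander topologies are locally convex, they form an increasing sequence with continuous inclusions, their union is $\mathscr E'_{\Upsilon_{k,g}}$, and $\mathscr E'_{\Upsilon_{k,g}}$, endowed with the finest locally convex topology for which all the inclusions $\mathscr E'_{\Gamma_{k,m}}\hookrightarrow\mathscr E'_{\Upsilon_{k,g}}$ are continuous, is their (countable) locally convex inductive limit, $$\mathscr E'_{\Upsilon_{k,g}}=\varinjlim_{m\in\mathbb N}\mathscr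 E'_{\Gamma_{k,m}}.$$ (3) With this inductive limit topology, $\mathscr E'_{\Upsilon_{k,g}}$ is a Hausdorff nuclear locally convex space. -/

import Mathlib

open scoped Manifold ContDiff Topology
open Set Filter

noncomputable section

/-! ### Finite products of manifolds -/

/-- A finite product of `C^n` manifolds is a `C^n` manifold. -/
instance instIsManifoldPi {ι : Type*} [Fintype ι] {E : Type*} [NormedAddCommGroup E]
    [NormedSpace ℝ E] {H : Type*} [TopologicalSpace H] (I : ModelWithCorners ℝ E H)
    {n : WithTop ℕ∞} (M : ι → Type*) [∀ i, TopologicalSpace (M i)] [∀ i, ChartedSpace H (M i)]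
    [∀ i, IsManifold I n (M i)] :
    IsManifold (ModelWithCorners.pi fun _ : ι => I) n (∀ i, M i) := by
  apply isManifold_of_contDiffOn
  rintro _ _ ⟨f, hf, rfl⟩ ⟨f', hf', rfl⟩
  have hf : ∀ i, f i ∈ atlas H (M i) := by simpa [Set.mem_pi] using hf
  have hf' : ∀ i, f' i ∈ atlas H (M i) := by simpa [Set.mem_pi] using hf'
  rw [contDiffOn_pi]
  intro i
  have h : ContDiffOn ℝ n (I ∘ (f i).symm ≫ₕ f' i ∘ I.symm)
      (I.symm ⁻¹' ((f i).symm ≫ₕ f' i).source ∩ range I) :=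
    ((contDiffGroupoid n I).compatible (hf i) (hf' i)).1
  refine h.comp (g := I ∘ (f i).symm ≫ₕ f' i ∘ I.symm) (f := fun y : ι → E => y i)
    (contDiff_apply ℝ E i).contDiffOn ?_
  rintro y ⟨hy, z, rfl⟩
  refine ⟨?_, z i, rfl⟩
  obtain ⟨h1, h2⟩ := hy
  exact ⟨h1 i (Set.mem_univ i), h2 i (Set.mem_univ i)⟩

section Manifold

variable {E : Type*} [NormedAddCommGroup E] [NormedSpace ℝ E]
  {H : Type*} [TopologicalSpace H] (I : ModelWithCorners ℝ E H)
  (N : Type*) [TopologicalSpace N] [ChartedSpace H N] [IsManifold I ∞ N]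

/-! ### Compactly supported distribution densities -/

/-- The complex vector space `C^∞(N)` of smooth complex valued functions. -/
def smoothFunctions : Submodule ℂ (N → ℂ) where
  carrier := {f | ContMDiff I 𝓘(ℝ, ℂ) ∞ f}
  add_mem' := fun hf hg => ContMDiff.add hf hg
  zero_mem' := contMDiff_const
  smul_mem' := fun c _ hf =>
    ((contDiff_const (c := c)).mul contDiff_id).contMDiff.comp hf

/-- The compact-open `C^∞` topology: uniform convergence, on the compact subsets of the domain of
every chart, of the derivatives of all orders in that chart (`N` has no boundary). -/
@[reducible] def smoothTopology : TopologicalSpace (smoothFunctions I N) :=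
  ⨅ (e : IsManifold.maximalAtlas I ∞ N) (r : ℕ),
    TopologicalSpace.induced
      (fun f : smoothFunctions I N =>
        UniformOnFun.ofFun {K : Set E | IsCompact K ∧ K ⊆ (e.1.extend I).target}
          (iteratedFDeriv ℝ r (f.1 ∘ (e.1.extend I).symm)))
      inferInstance

/-- Compactly supported distribution densities are the elements of the topological dual
of `C^∞(N)`. -/
def IsCompactDistribution (u : Module.Dual ℂ (smoothFunctions I N)) : Prop :=
  @Continuous _ _ (smoothTopology I N) inferInstance u

/-! ### The cotangent bundle and its cones -/

/-- The cotangent bundle `T*N`, with Mathlib's vector bundle topology. -/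
abbrev CotangentBundle :=
  Bundle.TotalSpace (E →L[ℝ] ℝ) (fun x : N => TangentSpace I x →L[ℝ] ℝ)

/-- `T*N ∖ 0`. -/
def puncturedCotangent : Set (CotangentBundle I N) := {z | z.2 ≠ 0}

variable {I N}

/-- Stability under the dilations `(x, ξ) ↦ (x, t ξ)`, `t > 0`. -/
def IsConicSet (S : Set (CotangentBundle I N)) : Prop :=
  ∀ z ∈ S, ∀ t : ℝ, 0 < t → (⟨z.1, t • z.2⟩ : CotangentBundle I N) ∈ S

/-- Conic subsets of `T*N ∖ 0` that are closed in `T*N ∖ 0`. -/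
def IsClosedCone (S : Set (CotangentBundle I N)) : Prop :=
  IsConicSet S ∧ ∃ C : Set (CotangentBundle I N), IsClosed C ∧ S = C ∩ puncturedCotangent I N

/-- An exhaustion of the cone `Υ` by closed cones, each contained in the interior of the next. -/
structure IsConeExhaustion (Υ : Set (CotangentBundle I N))
    (Γ : ℕ → Set (CotangentBundle I N)) : Prop where
  isClosedCone : ∀ m, IsClosedCone (Γ m)
  subset_interior : ∀ m, Γ m ⊆ interior (Γ (m + 1))
  iUnion_eq : ⋃ m, Γ m = Υ

/-! ### Localized Fourier transforms, wave front sets -/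

variable (I N)

/-- The data of a localization in phase space: a chart, a smooth function `χ` with compact support
in the domain of the chart, and a closed cone `V` of frequencies. -/
structure PhaseLocalizer where
  /-- the chart -/
  chart : OpenPartialHomeomorph N H
  chart_mem : chart ∈ IsManifold.maximalAtlas I ∞ N
  /-- the function `χ` -/
  cutoff : N → ℂ
  smooth : ContMDiff I 𝓘(ℝ, ℂ) ∞ cutoff
  hasCompactSupport : HasCompactSupport cutoff
  tsupport_subset : tsupport cutoff ⊆ chart.source
  /-- the cone `V` -/
  cone : Set (E →L[ℝ] ℝ)
  isClosed_cone : IsClosed cone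
  smul_mem_cone : ∀ η ∈ cone, ∀ t : ℝ, 0 < t → t • η ∈ cone

variable {I N}

namespace PhaseLocalizer

variable (c : PhaseLocalizer I N)

/-- The subset `supp χ × (V ∖ 0)` of `T*N ∖ 0`, where covectors in the coordinates of the chart
are regarded as covectors on `N`. -/
def footprint : Set (CotangentBundle I N) :=
  {z | z.1 ∈ tsupport c.cutoff ∧ ∃ η ∈ c.cone, η ≠ 0 ∧
    ∀ v : TangentSpace I z.1, z.2 v = η (mfderiv I 𝓘(ℝ, E) (c.chart.extend I) z.1 v)}

/-- The test function `x ↦ χ(x) exp(-i η(y))`, where `y` is the coordinate vector of `x`. -/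
def wave (η : E →L[ℝ] ℝ) : smoothFunctions I N :=
  ⟨fun x => c.cutoff x * Complex.exp (-Complex.I * (η (c.chart.extend I x) : ℂ)), by
    refine contMDiff_of_tsupport fun x hx => ?_
    have hx' : x ∈ c.chart.source :=
      c.tsupport_subset (closure_mono (Function.support_mul_subset_left _ _) hx)
    have h1 : ContMDiffAt I 𝓘(ℝ, E) ∞ (c.chart.extend I) x :=
      c.chart.contMDiffAt_extend c.chart_mem hx'
    have h2 : ContDiff ℝ ∞ (fun y : E => Complex.exp (-Complex.I * (η y : ℂ))) :=
      (contDiff_const.mul (Complex.ofRealCLM.contDiff.comp η.contDiff)).cexp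
    have h3 : ContMDiffAt I 𝓘(ℝ, ℂ) ∞
        (fun x => Complex.exp (-Complex.I * (η (c.chart.extend I x) : ℂ))) x :=
      h2.contMDiff.contMDiffAt.comp x h1
    exact contDiff_mul.contMDiff.contMDiffAt.comp x ((c.smooth x).prodMk_space h3)⟩

/-- The Fourier transform of `χ u`, computed in the coordinates of the chart. -/
def fourier (u : Module.Dual ℂ (smoothFunctions I N)) (η : E →L[ℝ] ℝ) : ℂ := u (c.wave η)

/-- The Fourier transform of `χ u` is rapidly decreasing in `V`. -/
def RapidlyDecreasing (u : Module.Dual ℂ (smoothFunctions I N)) : Prop :=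
  ∀ n : ℕ, ∃ C : ℝ, ∀ η ∈ c.cone, (1 + ‖η‖) ^ n * ‖c.fourier u η‖ ≤ C

end PhaseLocalizer

/-- `u` is microlocally smooth at `z = (x, ξ)`: there is an open conic neighbourhood `W` of `z` such
that in any chart the Fourier transform of `χ u` is rapidly decreasing in `V` as soon as
`supp χ × (V ∖ 0) ⊆ W`. (By the independence of the notion from the cutoff and from the coordinates,
it is enough to know this for one chart around `x`, one `χ` with `χ(x) ≠ 0` and one conic
neighbourhood `V` of the coordinate expression of `ξ`.) -/
def MicrolocallySmoothAt (u : Module.Dual ℂ (smoothFunctions I N)) (z : CotangentBundle I N) :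
    Prop :=
  ∃ W : Set (CotangentBundle I N), IsOpen W ∧ IsConicSet W ∧ z ∈ W ∧
    ∀ c : PhaseLocalizer I N, c.footprint ⊆ W → c.RapidlyDecreasing u

/-- The wave front set `WF(u) ⊆ T*N ∖ 0`. -/
def waveFrontSet (u : Module.Dual ℂ (smoothFunctions I N)) : Set (CotangentBundle I N) :=
  {z | z ∈ puncturedCotangent I N ∧ ¬ MicrolocallySmoothAt u z}

theorem MicrolocallySmoothAt.zero (z : CotangentBundle I N) :
    MicrolocallySmoothAt (0 : Module.Dual ℂ (smoothFunctions I N)) z :=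
  ⟨univ, isOpen_univ, fun _ _ _ _ => mem_univ _, mem_univ _, fun c _ n =>
    ⟨0, fun η _ => by simp [PhaseLocalizer.fourier]⟩⟩

theorem MicrolocallySmoothAt.add {u v : Module.Dual ℂ (smoothFunctions I N)}
    {z : CotangentBundle I N} (hu : MicrolocallySmoothAt u z) (hv : MicrolocallySmoothAt v z) :
    MicrolocallySmoothAt (u + v) z := by
  obtain ⟨W, hW, hWc, hz, hWu⟩ := hu
  obtain ⟨W', hW', hWc', hz', hWv⟩ := hv
  refine ⟨W ∩ W', hW.inter hW', fun w hw t ht => ⟨hWc w hw.1 t ht, hWc' w hw.2 t ht⟩,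
    ⟨hz, hz'⟩, fun c hc n => ?_⟩
  obtain ⟨C, hC⟩ := hWu c (hc.trans inter_subset_left) n
  obtain ⟨C', hC'⟩ := hWv c (hc.trans inter_subset_right) n
  refine ⟨C + C', fun η hη => ?_⟩
  have h1 : ‖c.fourier (u + v) η‖ ≤ ‖c.fourier u η‖ + ‖c.fourier v η‖ := norm_add_le _ _
  have h2 : (0 : ℝ) ≤ (1 + ‖η‖) ^ n := by positivity
  calc (1 + ‖η‖) ^ n * ‖c.fourier (u + v) η‖
      ≤ (1 + ‖η‖) ^ n * (‖c.fourier u η‖ + ‖c.fourier v η‖) := mul_le_mul_of_nonneg_left h1 h2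
    _ ≤ C + C' := by rw [mul_add]; exact add_le_add (hC η hη) (hC' η hη)

theorem MicrolocallySmoothAt.smul {u : Module.Dual ℂ (smoothFunctions I N)}
    {z : CotangentBundle I N} (a : ℂ) (hu : MicrolocallySmoothAt u z) :
    MicrolocallySmoothAt (a • u) z := by
  obtain ⟨W, hW, hWc, hz, hWu⟩ := hu
  refine ⟨W, hW, hWc, hz, fun c hc n => ?_⟩
  obtain ⟨C, hC⟩ := hWu c hc n
  refine ⟨‖a‖ * C, fun η hη => ?_⟩
  have h1 : ‖c.fourier (a • u) η‖ = ‖a‖ * ‖c.fourier u η‖ := norm_mul _ _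
  rw [h1, mul_left_comm]
  exact mul_le_mul_of_nonneg_left (hC η hη) (norm_nonneg a)

/-! ### Distributions with prescribed wave front set and their topologies -/

/-- The space `E'_S` of compactly supported distribution densities `u` with `WF(u) ⊆ S`. -/
def distributionsWF (S : Set (CotangentBundle I N)) :
    Submodule ℂ (Module.Dual ℂ (smoothFunctions I N)) where
  carrier := {u | IsCompactDistribution I N u ∧ waveFrontSet u ⊆ S}
  zero_mem' := ⟨@continuous_const _ _ (smoothTopology I N) _ 0,
    fun z hz => absurd (MicrolocallySmoothAt.zero z) hz.2⟩
  add_mem' := by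
    rintro u v ⟨hu, hu'⟩ ⟨hv, hv'⟩
    refine ⟨@Continuous.add _ _ _ _ _ (smoothTopology I N) _ _ hu hv, fun z hz => ?_⟩
    by_cases h : MicrolocallySmoothAt u z
    · exact hv' ⟨hz.1, fun h' => hz.2 (h.add h')⟩
    · exact hu' ⟨hz.1, h⟩
  smul_mem' := by
    rintro a u ⟨hu, hu'⟩
    refine ⟨@Continuous.const_smul _ _ _ _ _ _ (smoothTopology I N) _ hu a, fun z hz => ?_⟩
    exact hu' ⟨hz.1, fun h => hz.2 (h.smul a)⟩

theorem distributionsWF_mono {S S' : Set (CotangentBundle I N)} (h : S ⊆ S') :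
    distributionsWF S ≤ distributionsWF S' := fun _ hu => ⟨hu.1, hu.2.trans h⟩

/-- The Hörmander topology of `E'_Γ`, `Γ` a closed cone: the topology of the seminorms `|u(f)|`,
`f ∈ C^∞(N)`, and `sup_{η ∈ V} (1 + |η|)^n |(χ u)^(η)|`, `n ∈ ℕ`, for all charts, all `χ` and all `V`
such that `supp χ × (V ∖ 0)` does not meet `Γ`. -/
@[reducible] def hormanderTopology (Γ : Set (CotangentBundle I N)) : TopologicalSpace (distributionsWF Γ) :=
  (⨅ f : smoothFunctions I N,
    TopologicalSpace.induced (fun u : distributionsWF Γ => u.1 f) inferInstance) ⊓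
  (⨅ (c : {c : PhaseLocalizer I N // Disjoint c.footprint Γ}) (n : ℕ),
    TopologicalSpace.induced
      (fun u : distributionsWF Γ => UniformFun.ofFun
        (fun η : c.1.cone => (((1 + ‖(η : E →L[ℝ] ℝ)‖) ^ n : ℝ) : ℂ) * c.1.fourier u.1 η))
      inferInstance)

end Manifold

/-! ### Locally convex inductive limits and nuclear spaces -/

/-- The topology `t` makes the complex vector space `F` a locally convex space. -/
def IsLocallyConvexTopology {F : Type*} [AddCommGroup F] [Module ℂ F] (t : TopologicalSpace F) :
    Prop :=
  @IsTopologicalAddGroup F t _ ∧ @ContinuousSMul ℂ F _ _ t ∧ @LocallyConvexSpace ℝ F _ _ _ _ t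

section InductiveLimit

variable {X : Type*} [AddCommGroup X] [Module ℂ X] {A : ℕ → Submodule ℂ X}
  (τ : ∀ m, TopologicalSpace (A m)) {B : Submodule ℂ X}

/-- The locally convex topologies on `B` for which all the inclusions `A m → B` are continuous. -/
def admissibleTopologies (h : ∀ m, A m ≤ B) : Set (TopologicalSpace B) :=
  {t | IsLocallyConvexTopology t ∧ ∀ m, @Continuous _ _ (τ m) t (Submodule.inclusion (h m))}

/-- The locally convex inductive limit topology on `B`: the finest locally convex topology for
which all the inclusions `A m → B` are continuous. -/
@[reducible] def inductiveLimitTopology (h : ∀ m, A m ≤ B) : TopologicalSpace B :=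
  sInf (admissibleTopologies τ h)

/-- `(B, t)` is the inductive limit, in the category of locally convex spaces, of the increasing
sequence of locally convex spaces `(A m, τ m)`, with continuous inclusions as connecting maps. -/
structure IsLocallyConvexInductiveLimit (h : ∀ m, A m ≤ B) (t : TopologicalSpace B) : Prop where
  locallyConvex : ∀ m, IsLocallyConvexTopology (τ m)
  continuous_inclusion : ∀ m, ∃ h' : A m ≤ A (m + 1),
    @Continuous _ _ (τ m) (τ (m + 1)) (Submodule.inclusion h')
  exists_mem : ∀ u ∈ B, ∃ m, u ∈ A m
  isLeast : IsLeast (admissibleTopologies τ h) t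

end InductiveLimit

/-- Nuclear (Hausdorff) locally convex spaces: every continuous seminorm `p` is dominated by a
continuous seminorm `q` such that the canonical map `F_q → F_p` of the associated normed spaces is
nuclear, i.e. is a sum `x ↦ ∑ n, f n x • y n` with `∑ n, ‖f n‖ ‖y n‖ < ∞`, where `‖f n‖` is the
norm of the functional `f n` with respect to `q` and `‖y n‖ = p (y n)`. -/
def IsNuclearTopology {F : Type*} [AddCommGroup F] [Module ℂ F] (t : TopologicalSpace F) : Prop :=
  IsLocallyConvexTopology t ∧ @T2Space F t ∧
  ∀ p : Seminorm ℂ F, @Continuous _ _ t _ p →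
    ∃ q : Seminorm ℂ F, @Continuous _ _ t _ q ∧ p ≤ q ∧
      ∃ (f : ℕ → F →ₗ[ℂ] ℂ) (b : ℕ → ℝ) (y : ℕ → F),
        (∀ n, 0 ≤ b n ∧ ∀ x, ‖f n x‖ ≤ b n * q x) ∧
        Summable (fun n => b n * p (y n)) ∧
        ∀ x, Tendsto (fun n => p (x - ∑ i ∈ Finset.range n, f i x • y i)) atTop (𝓝 0)

/-! ### Lorentzian geometry -/

section Lorentz

variable (d : ℕ) (M : Type*) [TopologicalSpace M] [ChartedSpace (EuclideanSpace ℝ (Fin d)) M]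
  [IsManifold (𝓡 d) ∞ M]

/-- Smooth Lorentzian metrics of signature `(-, +, …, +)` on a `d`-dimensional manifold. -/
structure LorentzMetric where
  /-- the bilinear form on the tangent space at `x` -/
  form : ∀ x : M, TangentSpace (𝓡 d) x →L[ℝ] TangentSpace (𝓡 d) x →L[ℝ] ℝ
  symm : ∀ x v w, form x v w = form x w v
  signature : ∀ x, ∃ v, form x v v < 0 ∧ ∀ w, form x v w = 0 → w ≠ 0 → 0 < form x w w
  contMDiff : ContMDiff (𝓡 d)
    ((𝓡 d).prod 𝓘(ℝ, EuclideanSpace ℝ (Fin d) →L[ℝ] EuclideanSpace ℝ (Fin d) →L[ℝ] ℝ)) ∞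
    (fun x => Bundle.TotalSpace.mk'
      (EuclideanSpace ℝ (Fin d) →L[ℝ] EuclideanSpace ℝ (Fin d) →L[ℝ] ℝ) x (form x))

variable {d M}

/-- A time orientation: a continuous timelike vector field, which is future directed by
convention. -/
structure TimeOrientation (g : LorentzMetric d M) where
  /-- the vector field -/
  field : ∀ x : M, TangentSpace (𝓡 d) x
  timelike : ∀ x, g.form x (field x) (field x) < 0
  continuous : Continuous (fun x => (⟨x, field x⟩ : TangentBundle (𝓡 d) M))

/-- `V_{+,g}(x)`: the open cone of future directed timelike covectors `ξ = g(v, ·)`. -/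
def futureCone (g : LorentzMetric d M) (T : TimeOrientation g) (x : M) :
    Set (TangentSpace (𝓡 d) x →L[ℝ] ℝ) :=
  {ξ | ∃ v, ξ = g.form x v ∧ g.form x v v < 0 ∧ g.form x v (T.field x) < 0}

/-- `V_{-,g}(x)`: the open cone of past directed timelike covectors `ξ = g(v, ·)`. -/
def pastCone (g : LorentzMetric d M) (T : TimeOrientation g) (x : M) :
    Set (TangentSpace (𝓡 d) x →L[ℝ] ℝ) :=
  {ξ | ∃ v, ξ = g.form x v ∧ g.form x v v < 0 ∧ 0 < g.form x v (T.field x)}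

variable (d) in
/-- The model with corners of the `k`-fold product `M^k = (Fin k → M)`. -/
abbrev powerModel (k : ℕ) :=
  ModelWithCorners.pi (fun _ : Fin k => 𝓡 d)

/-- For a family of sets `V x` of covectors on `M`, the set of the covectors
`(ξ_1, …, ξ_k) = ∑ j, ξ_j ∘ d pr_j` of `M^k` at `(x_1, …, x_k)` with `ξ_j ∈ V x_j` for all `j`. -/
def productCone (k : ℕ) (V : ∀ x : M, Set (TangentSpace (𝓡 d) x →L[ℝ] ℝ)) :
    Set (CotangentBundle (powerModel d k) (Fin k → M)) :=
  {z | ∃ ξ : ∀ j, TangentSpace (𝓡 d) (z.1 j) →L[ℝ] ℝ, (∀ j, ξ j ∈ V (z.1 j)) ∧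
    z.2 = ∑ j, (ξ j).comp (mfderiv (powerModel d k) (𝓡 d) (fun x : Fin k → M => x j) z.1)}

/-- The set `Υ_{k,g} ⊆ T*M^k ∖ 0` of the nonzero covectors which belong neither to the product of
the closed future cones nor to the product of the closed past cones. -/
def microcausalCone (g : LorentzMetric d M) (T : TimeOrientation g) (k : ℕ) :
    Set (CotangentBundle (powerModel d k) (Fin k → M)) :=
  {z | z ∈ puncturedCotangent (powerModel d k) (Fin k → M) ∧
    z ∉ productCone k (fun x => closure (futureCone g T x)) ∪
      productCone k (fun x => closure (pastCone g T x))}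

end Lorentz

/-- The members of an exhaustion are contained in the exhausted cone, hence so are the spaces of
distributions. -/
theorem IsConeExhaustion.distributionsWF_le {E : Type*} [NormedAddCommGroup E] [NormedSpace ℝ E]
    {H : Type*} [TopologicalSpace H] {I : ModelWithCorners ℝ E H}
    {N : Type*} [TopologicalSpace N] [ChartedSpace H N] [IsManifold I ∞ N]
    {Υ : Set (CotangentBundle I N)} {Γ : ℕ → Set (CotangentBundle I N)}
    (hΓ : IsConeExhaustion Υ Γ) (m : ℕ) : distributionsWF (Γ m) ≤ distributionsWF Υ :=
  distributionsWF_mono (hΓ.iUnion_eq ▸ subset_iUnion Γ m)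

end

/-! Nuclearity is proved through Pietsch's 2-summing maps. Call a continuous seminorm summable
(`IsHilbertSummable`) if it lies below a continuous Hilbertian seminorm that is 2-summing relative
to some continuous seminorm. If all continuous seminorms are summable, three successive applications
produce a Hilbert–Schmidt map followed by a 2-summing map on a Hilbert space, and expansion in an
orthonormal sequence shows that the composite is nuclear (`isNuclearTopology_of_isHilbertSummable`).
The gain is stability: summability passes to finite sums, to dominated seminorms and, by suitable
weights on a Hilbert direct sum, to countable inductive limits (`IsHilbertSummable.inductiveLimit`).
So it is enough to treat one closed cone `Γ`.

There the seminorms `|u(f)|` have rank one. For a Fourier seminorm, the directions in `V` are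
covered by finitely many cones over small simplices which still avoid `Γ` over `supp χ`. Such a cone
is the image of an orthant under a linear map that is bounded below there, and with each point `t`
an orthant contains the whole cube `t + [0,1]^n`. A Sobolev inequality on this cube bounds the
Fourier transform at `t` by integrals of its mixed derivatives (`enorm_le_sum_lintegral_cube`).
These derivatives are Fourier transforms too, with the cutoff multiplied by coordinates, so they
obey the same estimates. Weighted `L²` norms are Hilbertian, and they are 2-summing relative to the
supremum seminorm with `n + 1` more powers of the weight, because `(1 + |y|)^(-(n+1))` is square
integrable (`exists_isHilbertSummable_orthant`).

The union of the steps is everything: a distribution in the dual of `C^∞` has compact support and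
its wave front set is a closed cone, hence compact modulo dilations, so the interior of a single `Γ
m` contains it (`IsConeExhaustion.exists_mem_distributionsWF`). The limit is Hausdorff because
evaluations at test functions separate points. Exhaustions exist for every open cone of nonzero
covectors. The microcausal cone is open because the closed light cone of covectors is a polar
(`IsLorentzForm.mem_closure_timelikeCone`): a covector outside it is positive on some timelike
vector of the given half, and this persists nearby. -/

/-! ### Partially orthonormal sequences -/

section PartialOrthonormal

variable {H : Type*} [NormedAddCommGroup H] [InnerProductSpace ℂ H]

/-- Families of pairwise orthogonal vectors that are unit vectors or zero. -/
structure PartialOrthonormal {ι : Type*} (w : ι → H) : Prop where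
  orthogonal : ∀ i j, i ≠ j → inner ℂ (w i) (w j) = 0
  norm_or : ∀ i, ‖w i‖ = 1 ∨ w i = 0

namespace PartialOrthonormal

variable {ι : Type*} {w : ι → H} (hw : PartialOrthonormal w)
include hw

theorem inner_sum_smul (s : Finset ι) (a : ι → ℂ) {i : ι} (hi : i ∈ s) :
    inner ℂ (w i) (∑ j ∈ s, a j • w j) = a i * inner ℂ (w i) (w i) := by
  classical
  rw [inner_sum, Finset.sum_eq_single i]
  · rw [inner_smul_right]
  · intro j _ hj
    rw [inner_smul_right, hw.orthogonal i j hj.symm, mul_zero]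
  · exact fun h => absurd hi h

theorem inner_self (i : ι) : inner ℂ (w i) (w i) = 1 ∨ w i = 0 := by
  rcases hw.norm_or i with h | h
  · left
    rw [inner_self_eq_norm_sq_to_K, h]; simp
  · exact Or.inr h

theorem inner_projection (s : Finset ι) (y : H) {i : ι} (hi : i ∈ s) :
    inner ℂ (w i) (∑ j ∈ s, inner ℂ (w j) y • w j) = inner ℂ (w i) y := by
  rw [hw.inner_sum_smul s _ hi]
  rcases hw.inner_self i with h | h
  · rw [h, mul_one]
  · simp [h]

/-- Only an inequality, as some of the `w j` may vanish. It makes partially orthonormal families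
admissible test families for 2-summing pairs. -/
theorem norm_sum_smul_sq_le (s : Finset ι) (a : ι → ℂ) :
    ‖∑ j ∈ s, a j • w j‖ ^ 2 ≤ ∑ j ∈ s, ‖a j‖ ^ 2 := by
  rw [← inner_self_eq_norm_sq (𝕜 := ℂ), sum_inner, map_sum]
  refine Finset.sum_le_sum fun i hi => ?_
  rw [inner_smul_left, hw.inner_sum_smul s a hi]
  rcases hw.inner_self i with h | h
  · rw [h, mul_one, ← Complex.normSq_eq_conj_mul_self, Complex.normSq_eq_norm_sq]
    exact (Complex.ofReal_re _).le
  · simp [h]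

theorem pythagoras (s : Finset ι) (y : H) :
    ‖y - ∑ j ∈ s, inner ℂ (w j) y • w j‖ ^ 2 + ∑ j ∈ s, ‖inner ℂ (w j) y‖ ^ 2 = ‖y‖ ^ 2 := by
  set P := ∑ j ∈ s, inner ℂ (w j) y • w j with hP
  have h1 : inner ℂ P (y - P) = 0 := by
    conv_lhs => rw [hP, sum_inner]
    refine Finset.sum_eq_zero fun i hi => ?_
    rw [inner_smul_left, inner_sub_right, hw.inner_projection s y hi, sub_self, mul_zero]
  have h2 : ‖P‖ ^ 2 = ∑ j ∈ s, ‖inner ℂ (w j) y‖ ^ 2 := by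
    rw [← inner_self_eq_norm_sq (𝕜 := ℂ), hP, sum_inner, map_sum]
    refine Finset.sum_congr rfl fun i hi => ?_
    rw [inner_smul_left, hw.inner_projection s y hi, ← Complex.normSq_eq_conj_mul_self]
    rw [Complex.normSq_eq_norm_sq]
    exact Complex.ofReal_re _
  have h3 := norm_add_sq_eq_norm_sq_add_norm_sq_of_inner_eq_zero P (y - P) h1
  rw [← h2]
  rw [add_sub_cancel] at h3
  nlinarith

theorem sum_inner_sq_le (s : Finset ι) (y : H) :
    ∑ j ∈ s, ‖inner ℂ (w j) y‖ ^ 2 ≤ ‖y‖ ^ 2 := by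
  have := hw.pythagoras s y
  nlinarith [sq_nonneg ‖y - ∑ j ∈ s, inner ℂ (w j) y • w j‖]

/-- The projection fixes `v`, so `y` and `y - v` have the same remainder, and Pythagoras bounds the
latter. -/
theorem norm_sub_projection_le (s : Finset ι) (y : H) {v : H}
    (hv : v ∈ Submodule.span ℂ (w '' s)) :
    ‖y - ∑ j ∈ s, inner ℂ (w j) y • w j‖ ≤ ‖y - v‖ := by
  have hPv : ∑ j ∈ s, inner ℂ (w j) v • w j = v := by
    refine Submodule.span_induction (p := fun v _ => ∑ j ∈ s, inner ℂ (w j) v • w j = v)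
      ?_ ?_ ?_ ?_ hv
    · rintro _ ⟨i, hi, rfl⟩
      rw [Finset.sum_eq_single i]
      · rcases hw.inner_self i with h | h
        · rw [h, one_smul]
        · simp [h]
      · intro j _ hj
        rw [hw.orthogonal j i hj, zero_smul]
      · exact fun h => absurd hi h
    · simp
    · intro x y _ _ hx hy
      simp only [inner_add_right, add_smul, Finset.sum_add_distrib, hx, hy]
    · intro a x _ hx
      simp only [inner_smul_right, mul_smul, ← Finset.smul_sum, hx]
  have h := hw.pythagoras s (y - v)
  have e : (y - v) - ∑ j ∈ s, inner ℂ (w j) (y - v) • w j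
      = y - ∑ j ∈ s, inner ℂ (w j) y • w j := by
    simp only [inner_sub_right, sub_smul, Finset.sum_sub_distrib, hPv]
    abel
  rw [e] at h
  refine le_of_sq_le_sq ?_ (norm_nonneg _)
  have : 0 ≤ ∑ j ∈ s, ‖inner ℂ (w j) (y - v)‖ ^ 2 := Finset.sum_nonneg fun _ _ => sq_nonneg _
  linarith

end PartialOrthonormal

/-- Gram–Schmidt orthonormalization in the range of a linear map into a separable space. -/
theorem LinearMap.exists_partialOrthonormal {F : Type*} [AddCommGroup F] [Module ℂ F]
    [TopologicalSpace.SeparableSpace H] (L : F →ₗ[ℂ] H) :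
    ∃ e : ℕ → F, PartialOrthonormal (fun i => L (e i)) ∧
      ∀ x, Tendsto (fun n => ∑ i ∈ Finset.range n, inner ℂ (L (e i)) (L x) • L (e i)) atTop
        (𝓝 (L x)) := by
  let R := LinearMap.range L
  have hsep : TopologicalSpace.IsSeparable (R : Set H) := TopologicalSpace.IsSeparable.of_separableSpace _
  have : TopologicalSpace.SeparableSpace R := hsep.separableSpace
  let v : ℕ → H := fun n => (TopologicalSpace.denseSeq R n : H)
  let w := InnerProductSpace.gramSchmidtNormed ℂ v
  have hwR : ∀ n, w n ∈ R := by
    intro n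
    have h1 : w n ∈ Submodule.span ℂ (Set.range v) := by
      rw [← InnerProductSpace.span_gramSchmidt ℂ v,
        ← InnerProductSpace.span_gramSchmidtNormed_range v]
      exact Submodule.subset_span ⟨n, rfl⟩
    refine (Submodule.span_le.2 ?_) h1
    rintro _ ⟨k, rfl⟩
    exact (TopologicalSpace.denseSeq R k).2
  choose e he using hwR
  have hw : PartialOrthonormal w := by
    refine ⟨fun i j hij => ?_, fun i => ?_⟩
    · simp only [w, InnerProductSpace.gramSchmidtNormed, inner_smul_left, inner_smul_right,
        InnerProductSpace.gramSchmidt_orthogonal ℂ v hij, mul_zero]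
    · by_cases h : w i = 0
      · exact Or.inr h
      · exact Or.inl (InnerProductSpace.gramSchmidtNormed_unit_length' h)
  have hew : (fun i => L (e i)) = w := funext he
  refine ⟨e, hew ▸ hw, fun x => ?_⟩
  simp only [he]
  rw [Metric.tendsto_atTop]
  intro ε hε
  obtain ⟨k, hk⟩ := (TopologicalSpace.denseRange_denseSeq R).exists_dist_lt
    (⟨L x, x, rfl⟩ : R) hε
  refine ⟨k + 1, fun n hn => ?_⟩
  -- Projections are best approximations from increasing spans, so one dense vector `v k` near `L x`
  -- serves all `n > k`.
  have hmem : v k ∈ Submodule.span ℂ (w '' (Finset.range n : Finset ℕ)) := by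
    rw [InnerProductSpace.span_gramSchmidtNormed]
    exact Submodule.span_mono (Set.image_mono (by intro i hi; simp at hi ⊢; omega))
      (InnerProductSpace.mem_span_gramSchmidt ℂ v (le_refl k))
  have := hw.norm_sub_projection_le (Finset.range n) (L x) hmem
  rw [dist_comm, dist_eq_norm]
  refine this.trans_lt ?_
  rw [Subtype.dist_eq, dist_eq_norm] at hk
  exact hk

end PartialOrthonormal

/-! ### Hilbertian seminorms and 2-summing pairs of seminorms -/

section TwoSumming

variable {F : Type*} [AddCommGroup F] [Module ℂ F]

/-- Seminorms that are induced by a linear map into a separable Hilbert space. -/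
def IsHilbertian (s : Seminorm ℂ F) : Prop :=
  ∃ L : F →ₗ[ℂ] lp (fun _ : ℕ => ℂ) 2, ∀ x, s x = ‖L x‖

/-- The canonical map `F_q → F_p` is 2-summing. -/
def IsTwoSumming (p q : Seminorm ℂ F) : Prop :=
  ∃ C : ℝ, ∀ (n : ℕ) (x : Fin n → F),
    (∀ a : Fin n → ℂ, q (∑ i, a i • x i) ^ 2 ≤ ∑ i, ‖a i‖ ^ 2) → ∑ i, p (x i) ^ 2 ≤ C

/-- `p` is dominated by a continuous Hilbertian seminorm that is 2-summing with respect to another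
continuous seminorm. -/
def IsHilbertSummable (t : TopologicalSpace F) (p : Seminorm ℂ F) : Prop :=
  ∃ s q : Seminorm ℂ F, IsHilbertian s ∧ (@Continuous _ _ t _ s) ∧ p ≤ s ∧
    (@Continuous _ _ t _ q) ∧ IsTwoSumming s q

/-- Coordinates along a partially orthonormal sequence replace any separable, possibly incomplete,
target by the fixed model `ℓ²`; Parseval is Pythagoras in the limit. -/
theorem isHilbertian_of_linearMap {H : Type*} [NormedAddCommGroup H] [InnerProductSpace ℂ H]
    [TopologicalSpace.SeparableSpace H] {s : Seminorm ℂ F} (L : F →ₗ[ℂ] H)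
    (hL : ∀ x, s x = ‖L x‖) : IsHilbertian s := by
  obtain ⟨e, he, hlim⟩ := L.exists_partialOrthonormal
  have hsum : ∀ x, HasSum (fun i => ‖inner ℂ (L (e i)) (L x)‖ ^ 2) (‖L x‖ ^ 2) := by
    intro x
    rw [hasSum_iff_tendsto_nat_of_nonneg (fun _ => sq_nonneg _)]
    have h1 : ∀ n, ∑ i ∈ Finset.range n, ‖inner ℂ (L (e i)) (L x)‖ ^ 2 = ‖L x‖ ^ 2 -
        ‖L x - ∑ i ∈ Finset.range n, inner ℂ (L (e i)) (L x) • L (e i)‖ ^ 2 := fun n => by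
      rw [← he.pythagoras (Finset.range n) (L x)]; ring
    simp only [h1]
    have h2 : Tendsto (fun n => ‖L x‖ ^ 2 -
        ‖L x - ∑ i ∈ Finset.range n, inner ℂ (L (e i)) (L x) • L (e i)‖ ^ 2) atTop
        (𝓝 (‖L x‖ ^ 2 - ‖L x - L x‖ ^ 2)) :=
      ((hlim x).const_sub (L x)).norm.pow 2 |>.const_sub _
    simpa using h2
  have hmem : ∀ x, Memℓp (fun i => inner ℂ (L (e i)) (L x)) 2 := fun x => by
    rw [memℓp_gen_iff (by norm_num)]
    simpa using (hsum x).summable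
  let L' : F →ₗ[ℂ] lp (fun _ : ℕ => ℂ) 2 :=
    { toFun := fun x => ⟨fun i => inner ℂ (L (e i)) (L x), hmem x⟩
      map_add' := fun x y => by
        ext i; exact (congrArg _ (map_add L x y)).trans (inner_add_right _ _ _)
      map_smul' := fun a x => by
        ext i; exact (congrArg _ (map_smul L a x)).trans (inner_smul_right _ _ _) }
  refine ⟨L', fun x => ?_⟩
  rw [hL]
  have h1 := lp.norm_rpow_eq_tsum (p := 2) (by norm_num) (L' x)
  have h2 : ‖L' x‖ ^ 2 = ∑' i, ‖inner ℂ (L (e i)) (L x)‖ ^ 2 := by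
    simp only [ENNReal.toReal_ofNat, Real.rpow_ofNat] at h1
    exact h1
  rw [(hsum x).tsum_eq] at h2
  exact ((sq_eq_sq₀ (norm_nonneg _) (norm_nonneg _)).1 h2).symm

theorem IsTwoSumming.mono {p p' q q' : Seminorm ℂ F} (h : IsTwoSumming p q) (hp : p' ≤ p)
    (hq : q ≤ q') : IsTwoSumming p' q' := by
  obtain ⟨C, hC⟩ := h
  refine ⟨C, fun n x hx => ?_⟩
  refine (Finset.sum_le_sum fun i _ => ?_).trans (hC n x fun a => ?_)
  · exact pow_le_pow_left₀ (apply_nonneg _ _) (hp _) 2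
  · exact (pow_le_pow_left₀ (apply_nonneg _ _) (hq _) 2).trans (hx a)

/-- A single vector with `q x ≤ 1` is an admissible family, so `p² ≤ C` on the unit ball of `q`; the
rest is homogeneity. -/
theorem IsTwoSumming.bound {p q : Seminorm ℂ F} (h : IsTwoSumming p q) :
    ∃ C : ℝ, 0 ≤ C ∧ ∀ x, p x ≤ C * q x := by
  obtain ⟨C, hC⟩ := h
  have key : ∀ x, q x ≤ 1 → p x ^ 2 ≤ C := fun x hx => by
    have := hC 1 (fun _ => x) (fun a => by
      simp only [Fin.sum_univ_one, map_smul_eq_mul, mul_pow]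
      have : q x ^ 2 ≤ 1 := pow_le_one₀ (apply_nonneg _ _) hx
      exact mul_le_of_le_one_right (by positivity) this)
    simpa using this
  have hC0 : 0 ≤ C := (sq_nonneg _).trans (key 0 (by simp))
  refine ⟨Real.sqrt C, Real.sqrt_nonneg _, fun x => ?_⟩
  refine le_of_forall_pos_le_add fun ε hε => ?_
  -- Since `q x` may vanish, the normalization uses a slightly larger `r`; the increment costs at
  -- most `ε` after multiplication by `√C`.
  set r : ℝ := q x + ε / (Real.sqrt C + 1) with hr
  have hr0 : 0 < r := add_pos_of_nonneg_of_pos (apply_nonneg _ _) (by positivity)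
  have h1 := key (((r⁻¹ : ℝ) : ℂ) • x) (by
    rw [map_smul_eq_mul, Complex.norm_real, Real.norm_of_nonneg (inv_nonneg.2 hr0.le),
      inv_mul_le_iff₀ hr0, mul_one, hr]
    have : 0 < ε / (Real.sqrt C + 1) := by positivity
    linarith)
  have h2 := Real.le_sqrt_of_sq_le h1
  rw [map_smul_eq_mul, Complex.norm_real, Real.norm_of_nonneg (inv_nonneg.2 hr0.le),
      inv_mul_le_iff₀ hr0] at h2
  refine h2.trans ?_
  rw [hr, add_mul, mul_comm (q x)]
  have : ε / (Real.sqrt C + 1) * Real.sqrt C ≤ ε := by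
    rw [div_mul_eq_mul_div, div_le_iff₀ (by positivity)]
    nlinarith [Real.sqrt_nonneg C]
  linarith


theorem lp.separableSpace {ι : Type*} [Countable ι] (E : ι → Type*)
    [∀ i, NormedAddCommGroup (E i)] [∀ i, NormedSpace ℂ (E i)]
    [∀ i, TopologicalSpace.SeparableSpace (E i)] :
    TopologicalSpace.SeparableSpace (lp E 2) := by
  classical
  have h1 : TopologicalSpace.IsSeparable
      (closure (Submodule.span ℂ (⋃ i, Set.range (lp.single (E := E) 2 i)) : Set (lp E 2))) := by
    refine TopologicalSpace.IsSeparable.closure (TopologicalSpace.IsSeparable.span ?_)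
    refine TopologicalSpace.IsSeparable.iUnion fun i => ?_
    exact TopologicalSpace.isSeparable_range (lp.isometry_single (E := E) (p := 2) i).continuous
  rw [← TopologicalSpace.isSeparable_univ_iff]
  refine h1.mono fun x _ => ?_
  refine mem_closure_of_tendsto (lp.hasSum_single (E := E) (p := 2) (by norm_num) x)
    (Eventually.of_forall fun s => ?_)
  exact Submodule.sum_mem _ fun i _ => Submodule.subset_span (mem_iUnion.2 ⟨i, mem_range_self _⟩)

/-- The map `√c • (L, L')` into the Hilbert sum. It replaces the sum of two Hilbertian seminorms,
which need not be Hilbertian. -/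
theorem IsHilbertian.exists_sq_eq_add {s s' : Seminorm ℂ F} (h : IsHilbertian s)
    (h' : IsHilbertian s') (c : ℝ) (hc : 0 ≤ c) :
    ∃ r : Seminorm ℂ F, IsHilbertian r ∧ ∀ x, r x ^ 2 = c * (s x ^ 2 + s' x ^ 2) := by
  obtain ⟨L, hL⟩ := h
  obtain ⟨L', hL'⟩ := h'
  let T : F →ₗ[ℂ] WithLp 2 (lp (fun _ : ℕ => ℂ) 2 × lp (fun _ : ℕ => ℂ) 2) :=
    (WithLp.linearEquiv 2 ℂ _).symm.toLinearMap ∘ₗ ((Real.sqrt c : ℂ) • (L.prod L'))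
  have : TopologicalSpace.SeparableSpace (lp (fun _ : ℕ => ℂ) 2) := lp.separableSpace _
  have : TopologicalSpace.SeparableSpace
      (WithLp 2 (lp (fun _ : ℕ => ℂ) 2 × lp (fun _ : ℕ => ℂ) 2)) :=
    (WithLp.homeomorphProd 2 _ _).symm.surjective.denseRange.separableSpace
      (WithLp.homeomorphProd 2 _ _).symm.continuous
  refine ⟨(normSeminorm ℂ _).comp T, isHilbertian_of_linearMap T fun x => rfl, fun x => ?_⟩
  have h1 : ((normSeminorm ℂ _).comp T) x = ‖T x‖ := rfl
  rw [h1, WithLp.prod_norm_sq_eq_of_L2, hL, hL']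
  have h2 : (T x).fst = (Real.sqrt c : ℂ) • L x := rfl
  have h3 : (T x).snd = (Real.sqrt c : ℂ) • L' x := rfl
  rw [h2, h3, norm_smul, norm_smul, Complex.norm_real, Real.norm_of_nonneg (Real.sqrt_nonneg _),
    mul_pow, mul_pow, Real.sq_sqrt hc]
  ring

theorem isHilbertian_zero : IsHilbertian (0 : Seminorm ℂ F) := ⟨0, fun x => by simp⟩

theorem continuous_of_sq_eq [TopologicalSpace F] {r s s' : Seminorm ℂ F} {c : ℝ}
    (hr : ∀ x, r x ^ 2 = c * (s x ^ 2 + s' x ^ 2)) (hs : Continuous s) (hs' : Continuous s') :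
    Continuous r := by
  have h : (r : F → ℝ) = fun x => Real.sqrt (c * (s x ^ 2 + s' x ^ 2)) := by
    ext x
    rw [← hr, Real.sqrt_sq (apply_nonneg _ _)]
  rw [h]
  exact (continuous_const.mul ((hs.pow 2).add (hs'.pow 2))).sqrt

namespace IsHilbertSummable

theorem mono {t : TopologicalSpace F} {p p' : Seminorm ℂ F} (h : IsHilbertSummable t p)
    (hp : ∀ x, p' x ≤ p x) : IsHilbertSummable t p' := by
  obtain ⟨s, q, h1, h2, h3, h4⟩ := h
  exact ⟨s, q, h1, h2, le_trans (show p' ≤ p from hp) h3, h4⟩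

theorem add {t : TopologicalSpace F} {p p' : Seminorm ℂ F} (h : IsHilbertSummable t p)
    (h' : IsHilbertSummable t p') : IsHilbertSummable t (p + p') := by
  obtain ⟨s, q, h1, h2, h3, h4, C, hC⟩ := h
  obtain ⟨s', q', h1', h2', h3', h4', C', hC'⟩ := h'
  -- The factor 2 comes from `(a + b)² ≤ 2 (a² + b²)`.
  obtain ⟨r, hr, hrs⟩ := h1.exists_sq_eq_add h1' 2 (by norm_num)
  refine ⟨r, q + q', hr, continuous_of_sq_eq hrs h2 h2', fun x => ?_, h4.add h4', 2 * (C + C'), ?_⟩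
  · refine le_of_sq_le_sq ?_ (apply_nonneg r x)
    rw [hrs]
    have a1 : p x ≤ s x := h3 x
    have a2 : p' x ≤ s' x := h3' x
    have a3 := apply_nonneg p x
    have a4 := apply_nonneg p' x
    have : (p + p') x = p x + p' x := rfl
    rw [this]
    nlinarith [sq_nonneg (p x - p' x)]
  · intro n x hx
    have hle : ∀ y, q y ≤ (q + q') y := fun y => le_add_of_nonneg_right (apply_nonneg q' y)
    have hle' : ∀ y, q' y ≤ (q + q') y := fun y => le_add_of_nonneg_left (apply_nonneg q y)
    have e1 := hC n x fun a => (pow_le_pow_left₀ (apply_nonneg _ _) (hle _) 2).trans (hx a)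
    have e2 := hC' n x fun a => (pow_le_pow_left₀ (apply_nonneg _ _) (hle' _) 2).trans (hx a)
    simp only [hrs, ← Finset.mul_sum, Finset.sum_add_distrib]
    linarith

theorem zero {t : TopologicalSpace F} : IsHilbertSummable t (0 : Seminorm ℂ F) :=
  ⟨0, 0, isHilbertian_zero, continuous_const, le_rfl, continuous_const, 0, fun n x _ => by simp⟩

theorem finset_sum {t : TopologicalSpace F} {ι : Type*} {p : ι → Seminorm ℂ F} (S : Finset ι)
    (h : ∀ i ∈ S, IsHilbertSummable t (p i)) : IsHilbertSummable t (∑ i ∈ S, p i) := by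
  classical
  induction S using Finset.induction_on with
  | empty => simpa using zero
  | insert i S hi ih =>
    rw [Finset.sum_insert hi]
    exact (h i (Finset.mem_insert_self _ _)).add (ih fun j hj => h j (Finset.mem_insert_of_mem hj))

theorem nsmul {t : TopologicalSpace F} {p : Seminorm ℂ F} (h : IsHilbertSummable t p) (n : ℕ) :
    IsHilbertSummable t (n • p) := by
  induction n with
  | zero => simpa using zero
  | succ n ih => rw [succ_nsmul]; exact ih.add h

theorem of_le_mul {t : TopologicalSpace F} {p p' : Seminorm ℂ F} (h : IsHilbertSummable t p)
    (C : ℝ) (hp : ∀ x, p' x ≤ C * p x) : IsHilbertSummable t p' := by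
  obtain ⟨n, hn⟩ := exists_nat_ge C
  refine (h.nsmul n).mono fun x => (hp x).trans ?_
  have : (n • p) x = n * p x := by
    rw [← nsmul_eq_mul]; rfl
  rw [this]
  exact mul_le_mul_of_nonneg_right hn (apply_nonneg _ _)

/-- Rank one seminorms. -/
theorem of_linear {t : TopologicalSpace F} (f : F →ₗ[ℂ] ℂ) (hf : @Continuous _ _ t _ f)
    {p : Seminorm ℂ F} (hp : ∀ x, p x = ‖f x‖) : IsHilbertSummable t p := by
  have hc : Continuous p := by
    have : (p : F → ℝ) = fun x => ‖f x‖ := funext hp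
    rw [this]; exact continuous_norm.comp hf
  refine ⟨p, p, isHilbertian_of_linearMap f hp, hc, le_rfl, hc, 1, fun n x hx => ?_⟩
  -- With the conjugate values as coefficients the test inequality reads `S² ≤ S` for `S = ∑ ‖f (x
  -- i)‖²`, whence `S ≤ 1`.
  have h1 := hx fun i => (starRingEnd ℂ) (f (x i))
  have h2 : f (∑ i, (starRingEnd ℂ) (f (x i)) • x i) = ((∑ i, ‖f (x i)‖ ^ 2 : ℝ) : ℂ) := by
    simp only [map_sum, map_smul, smul_eq_mul, ← Complex.normSq_eq_conj_mul_self,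
      Complex.normSq_eq_norm_sq]
    push_cast; rfl
  simp only [hp] at h1 ⊢
  rw [h2, Complex.norm_real] at h1
  simp only [RCLike.norm_conj, Real.norm_eq_abs, sq_abs] at h1
  have h0 : 0 ≤ ∑ i, ‖f (x i)‖ ^ 2 := Finset.sum_nonneg fun _ _ => sq_nonneg _
  by_contra! hlt
  nlinarith

open MeasureTheory in
/-- The `L²` norm of a family of functionals with an `L²` bound. -/
theorem exists_eLpNorm_eq [t : TopologicalSpace F] [IsTopologicalAddGroup F] [ContinuousSMul ℂ F]
    {Ω : Type*} [MeasurableSpace Ω] [MeasurableSpace.CountablyGenerated Ω]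
    {μ : Measure Ω} [SFinite μ]
    (f : F →ₗ[ℂ] (Ω → ℂ)) (g : Ω → ℝ) (hg : MemLp g 2 μ)
    (hf : ∀ x, AEStronglyMeasurable (f x) μ) {q : Seminorm ℂ F} (hq : Continuous q)
    (hfg : ∀ᵐ z ∂μ, ∀ x, ‖f x z‖ ≤ g z * q x) :
    ∃ s : Seminorm ℂ F, IsHilbertSummable t s ∧
      ∀ x, ENNReal.ofReal (s x) = eLpNorm (f x) 2 μ := by
  have hmem : ∀ x, MemLp (f x) 2 μ := fun x =>
    (hg.mul_const (q x)).mono (hf x) (hfg.mono fun z h => (h x).trans (le_abs_self _))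
  let L : F →ₗ[ℂ] Lp ℂ 2 μ :=
    { toFun := fun x => (hmem x).toLp (f x)
      map_add' := fun x y => by
        rw [← MemLp.toLp_add]
        exact MemLp.toLp_congr _ _ (by rw [map_add])
      map_smul' := fun a x => by
        rw [RingHom.id_apply, ← MemLp.toLp_const_smul]
        exact MemLp.toLp_congr _ _ (by rw [map_smul]) }
  let s : Seminorm ℂ F := (normSeminorm ℂ _).comp L
  have hs : ∀ x, s x = ‖L x‖ := fun x => rfl
  have hs2 : ∀ x, s x ^ 2 = ∫ z, ‖f x z‖ ^ 2 ∂μ := fun x => by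
    rw [hs, ← inner_self_eq_norm_sq (𝕜 := ℂ), L2.inner_def]
    have h1 : (fun z => inner ℂ (L x z) (L x z)) =ᵐ[μ] fun z => ((‖f x z‖ ^ 2 : ℝ) : ℂ) := by
      filter_upwards [(hmem x).coeFn_toLp] with z hz
      have : L x z = f x z := hz
      rw [this, inner_self_eq_norm_sq_to_K]
      norm_cast
    rw [integral_congr_ae h1, integral_complex_ofReal]
    simp
  have hint : ∀ x, Integrable (fun z => ‖f x z‖ ^ 2) μ := fun x => by
    simpa using (hmem x).integrable_norm_pow (by norm_num)
  have hgint : Integrable (fun z => g z ^ 2) μ := hg.integrable_sq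
  have hTS : IsTwoSumming s q := by
    refine ⟨∫ z, g z ^ 2 ∂μ, fun n x hx => ?_⟩
    simp only [hs2]
    rw [← integral_finsetSum _ fun i _ => hint (x i)]
    refine integral_mono_ae (integrable_finsetSum _ fun i _ => hint (x i)) hgint ?_
    filter_upwards [hfg] with z hz
    set S : ℝ := ∑ i, ‖f (x i) z‖ ^ 2 with hS
    have h0 : 0 ≤ S := Finset.sum_nonneg fun _ _ => sq_nonneg _
    -- The coefficients depend on the point `z`, so the null set in `hfg` must not depend on the
    -- vector. This choice gives `S² ≤ g(z)² S`, and integration over `z` yields the constant `∫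
    -- g²`.
    have h1 := hx fun i => (starRingEnd ℂ) (f (x i) z)
    have h2 : f (∑ i, (starRingEnd ℂ) (f (x i) z) • x i) z = (S : ℂ) := by
      simp only [map_sum, map_smul, Finset.sum_apply, Pi.smul_apply, smul_eq_mul,
        ← Complex.normSq_eq_conj_mul_self, Complex.normSq_eq_norm_sq, hS]
      push_cast; rfl
    have h3 := hz (∑ i, (starRingEnd ℂ) (f (x i) z) • x i)
    rw [h2, Complex.norm_real, Real.norm_of_nonneg h0] at h3
    simp only [RCLike.norm_conj] at h1
    rw [← hS] at h1
    have h4 : S ^ 2 ≤ g z ^ 2 * S := by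
      calc S ^ 2 ≤ (g z * q (∑ i, (starRingEnd ℂ) (f (x i) z) • x i)) ^ 2 :=
            pow_le_pow_left₀ h0 h3 2
        _ ≤ _ := by rw [mul_pow]; exact mul_le_mul_of_nonneg_left h1 (sq_nonneg _)
    by_contra! hlt
    have : 0 < S := lt_of_le_of_lt (sq_nonneg _) hlt
    nlinarith
  obtain ⟨C, hC, hsq⟩ := hTS.bound
  have : Fact ((2 : ENNReal) ≠ ⊤) := ⟨by norm_num⟩
  have : TopologicalSpace.SeparableSpace (Lp ℂ 2 μ) := inferInstance
  refine ⟨s, ⟨s, q, isHilbertian_of_linearMap L hs, ?_, le_rfl, hq, hTS⟩, fun x => ?_⟩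
  · refine Seminorm.continuous_of_le (q := C.toNNReal • q) (hq.const_smul C.toNNReal) fun x => ?_
    refine (hsq x).trans (le_of_eq ?_)
    rw [smul_apply, NNReal.smul_def, Real.coe_toNNReal C hC, smul_eq_mul]
  · have h1 : s x = (eLpNorm (f x) 2 μ).toReal := Lp.norm_toLp _ (hmem x)
    rw [h1, ENNReal.ofReal_toReal (hmem x).eLpNorm_ne_top]

end IsHilbertSummable

/-- Pietsch: a Hausdorff locally convex space is nuclear as soon as every continuous seminorm is
dominated by a Hilbertian one that is 2-summing with respect to a continuous seminorm. -/
theorem isNuclearTopology_of_isHilbertSummable {t : TopologicalSpace F}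
    (ht : IsLocallyConvexTopology t) (hT2 : @T2Space F t)
    (h : ∀ p : Seminorm ℂ F, @Continuous _ _ t _ p → IsHilbertSummable t p) :
    IsNuclearTopology t := by
  refine ⟨ht, hT2, fun p hp => ?_⟩
  -- The chain `p ≤ s₀`, `q₀ ≤ s₁`, `q₁ ≤ s₂` makes `p` 2-summing relative to the Hilbertian `s₁`,
  -- and `s₁` 2-summing relative to the Hilbertian `s₂`; the second map is then Hilbert–Schmidt.
  obtain ⟨s₀, q₀, -, -, hps, hq₀, hTS₀⟩ := h p hp
  obtain ⟨s₁, q₁, hH₁, -, hqs₁, hq₁, hTS₁⟩ := h q₀ hq₀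
  obtain ⟨s₂, q₂, hH₂, hs₂, hqs₂, -, -⟩ := h q₁ hq₁
  replace hTS₀ := hTS₀.mono hps hqs₁
  replace hTS₁ := hTS₁.mono le_rfl hqs₂
  obtain ⟨K₀, hK₀, hb₀⟩ := hTS₀.bound
  obtain ⟨K₁, hK₁, hb₁⟩ := hTS₁.bound
  obtain ⟨C₀, hC₀⟩ := hTS₀
  obtain ⟨C₁, hC₁⟩ := hTS₁
  obtain ⟨L₁, hL₁⟩ := hH₁
  obtain ⟨L₂, hL₂⟩ := hH₂
  have : TopologicalSpace.SeparableSpace (lp (fun _ : ℕ => ℂ) 2) := lp.separableSpace _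
  obtain ⟨e, he, hlim⟩ := L₁.exists_partialOrthonormal
  obtain ⟨e', he', hlim'⟩ := L₂.exists_partialOrthonormal
  let f : ℕ → F →ₗ[ℂ] ℂ := fun i => (innerSL ℂ (L₁ (e i))).toLinearMap ∘ₗ L₁
  have hf : ∀ i x, f i x = inner ℂ (L₁ (e i)) (L₁ x) := fun i x => rfl
  have hpe : ∀ n, ∑ i ∈ Finset.range n, p (e i) ^ 2 ≤ C₀ := fun n => by
    rw [Finset.sum_range]
    refine hC₀ n (fun i => e i) fun a => ?_
    rw [hL₁, map_sum]
    simp only [map_smul]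
    have hw : PartialOrthonormal fun i : Fin n => L₁ (e i) :=
      ⟨fun i j hij => he.orthogonal i j (fun h => hij (Fin.ext h)), fun i => he.norm_or i⟩
    exact hw.norm_sum_smul_sq_le Finset.univ a
  have hs₁e : ∀ n, ∑ i ∈ Finset.range n, s₁ (e' i) ^ 2 ≤ C₁ := fun n => by
    rw [Finset.sum_range]
    refine hC₁ n (fun i => e' i) fun a => ?_
    rw [hL₂, map_sum]
    simp only [map_smul]
    have hw : PartialOrthonormal fun i : Fin n => L₂ (e' i) :=
      ⟨fun i j hij => he'.orthogonal i j (fun h => hij (Fin.ext h)), fun i => he'.norm_or i⟩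
    exact hw.norm_sum_smul_sq_le Finset.univ a
  -- The Hilbert–Schmidt norm in the two orthonormal sequences: Bessel's inequality in `s₁` for each
  -- `e' j`, then summation over `j`.
  have hdouble : ∀ n m, ∑ i ∈ Finset.range n, ∑ j ∈ Finset.range m, ‖f i (e' j)‖ ^ 2 ≤ C₁ := by
    intro n m
    rw [Finset.sum_comm]
    refine (Finset.sum_le_sum fun j _ => ?_).trans (hs₁e m)
    rw [hL₁]
    exact he.sum_inner_sq_le (Finset.range n) (L₁ (e' j))
  have hsumj : ∀ i, Summable fun j => ‖f i (e' j)‖ ^ 2 := fun i => by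
    refine summable_of_sum_range_le (c := C₁) (fun _ => sq_nonneg _) fun m => ?_
    refine le_trans ?_ (hdouble (i + 1) m)
    rw [Finset.sum_range_succ]
    exact le_add_of_nonneg_left
      (Finset.sum_nonneg fun _ _ => Finset.sum_nonneg fun _ _ => sq_nonneg _)
  let b : ℕ → ℝ := fun i => Real.sqrt (∑' j, ‖f i (e' j)‖ ^ 2)
  have hb2 : ∀ i, b i ^ 2 = ∑' j, ‖f i (e' j)‖ ^ 2 := fun i =>
    Real.sq_sqrt (tsum_nonneg fun _ => sq_nonneg _)
  have hbsum : ∀ n, ∑ i ∈ Finset.range n, b i ^ 2 ≤ C₁ := fun n => by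
    simp only [hb2]
    refine le_of_tendsto (tendsto_finsetSum (Finset.range n)
      fun i _ => (hsumj i).hasSum.tendsto_sum_nat) (Eventually.of_forall fun m => ?_)
    exact hdouble n m
  -- The functional `f i` is continuous for `s₂`, so it can be computed on the finite expansions `S
  -- n` of `x` along `e'`, where Cauchy–Schwarz produces `b i`.
  have hfb : ∀ i x, ‖f i x‖ ≤ b i * s₂ x := fun i x => by
    have hlip : ∀ y, ‖f i y‖ ≤ K₁ * s₂ y := fun y => by
      have h1 : ‖f i y‖ ≤ ‖L₁ (e i)‖ * ‖L₁ y‖ := by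
        rw [hf]; exact norm_inner_le_norm _ _
      have h2 : ‖L₁ (e i)‖ ≤ 1 := by
        rcases he.norm_or i with h | h
        · exact h.le
        · rw [show L₁ (e i) = 0 from h]; simp
      have h3 := hb₁ y
      rw [hL₁] at h3
      nlinarith [norm_nonneg (L₁ y)]
    let S : ℕ → F := fun n => ∑ j ∈ Finset.range n, inner ℂ (L₂ (e' j)) (L₂ x) • e' j
    have hS : Tendsto (fun n => s₂ (x - S n)) atTop (𝓝 0) := by
      have h1 : ∀ n, s₂ (x - S n) = ‖L₂ x - ∑ j ∈ Finset.range n,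
          inner ℂ (L₂ (e' j)) (L₂ x) • L₂ (e' j)‖ := fun n => by
        rw [hL₂, map_sub, map_sum]; simp only [map_smul]
      simp only [h1]
      simpa using ((hlim' x).const_sub (L₂ x)).norm
    have hfS : Tendsto (fun n => ‖f i (S n)‖) atTop (𝓝 ‖f i x‖) := by
      refine Tendsto.norm ?_
      rw [tendsto_iff_norm_sub_tendsto_zero]
      refine squeeze_zero (fun _ => norm_nonneg _) (fun n => ?_) (by simpa using hS.const_mul K₁)
      rw [norm_sub_rev, ← map_sub]
      exact hlip _
    refine le_of_tendsto hfS (Eventually.of_forall fun n => ?_)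
    have h1 : ‖f i (S n)‖ ≤ ∑ j ∈ Finset.range n, ‖inner ℂ (L₂ (e' j)) (L₂ x)‖ * ‖f i (e' j)‖ := by
      simp only [S, map_sum, map_smul]
      exact (norm_sum_le _ _).trans (Finset.sum_le_sum fun j _ => norm_smul_le _ _)
    refine h1.trans ?_
    refine (Real.sum_mul_le_sqrt_mul_sqrt _ _ _).trans ?_
    rw [mul_comm]
    refine mul_le_mul ?_ ?_ (Real.sqrt_nonneg _) (Real.sqrt_nonneg _)
    · exact Real.sqrt_le_sqrt ((hsumj i).sum_le_tsum _ fun _ _ => sq_nonneg _)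
    · rw [Real.sqrt_le_left (apply_nonneg _ _), hL₂]
      exact he'.sum_inner_sq_le _ _
  -- The summand `p` serves only to make the new seminorm dominate `p`.
  refine ⟨p + s₂, hp.add hs₂, fun x => le_add_of_nonneg_right (apply_nonneg s₂ x), f, b, e,
    fun i => ⟨Real.sqrt_nonneg _, fun x => (hfb i x).trans ?_⟩, ?_, fun x => ?_⟩
  · exact mul_le_mul_of_nonneg_left (le_add_of_nonneg_left (apply_nonneg p x)) (Real.sqrt_nonneg _)
  · refine summable_of_sum_range_le (c := C₁ + C₀)
      (fun i => mul_nonneg (Real.sqrt_nonneg _) (apply_nonneg _ _)) fun n => ?_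
    refine le_trans ?_ (add_le_add (hbsum n) (hpe n))
    rw [← Finset.sum_add_distrib]
    refine Finset.sum_le_sum fun i _ => ?_
    -- `b p ≤ b² + p²`, and both sums of squares are bounded.
    nlinarith [sq_nonneg (b i - p (e i)), sq_nonneg (b i), sq_nonneg (p (e i))]
  · refine squeeze_zero (fun _ => apply_nonneg _ _) (fun n => hb₀ _) ?_
    have h1 : ∀ n, s₁ (x - ∑ i ∈ Finset.range n, f i x • e i) = ‖L₁ x - ∑ j ∈ Finset.range n,
        inner ℂ (L₁ (e j)) (L₁ x) • L₁ (e j)‖ := fun n => by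
      rw [hL₁, map_sub, map_sum]; simp only [map_smul, hf]
    simp only [h1]
    simpa using (((hlim x).const_sub (L₁ x)).norm).const_mul K₀

end TwoSumming

/-! ### Inductive limits -/

section InductiveLimit

/-- A Hilbertian seminorm on `D`, given by a linear map `J`, induces a Hilbertian seminorm on each
quotient of `D`. -/
theorem exists_quotient_hilbertMap {D B H : Type*} [AddCommGroup D] [Module ℂ D] [AddCommGroup B]
    [Module ℂ B] [NormedAddCommGroup H] [InnerProductSpace ℂ H] [CompleteSpace H]
    (π : D →ₗ[ℂ] B) (hπ : Function.Surjective π) (J : D →ₗ[ℂ] H) :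
    ∃ Q : B →ₗ[ℂ] H, (∀ x, ‖Q (π x)‖ ≤ ‖J x‖) ∧
      ∀ b, ∀ ε > 0, ∃ x, π x = b ∧ ‖J x - Q b‖ < ε := by
  obtain ⟨σ, hσ⟩ := LinearMap.exists_rightInverse_of_surjective π (LinearMap.range_eq_top.2 hπ)
  have hσ' : ∀ b, π (σ b) = b := fun b => LinearMap.congr_fun hσ b
  -- `‖Q b‖` is the quotient seminorm, the distance of `J x` from `J (ker π)` for any `x` over `b`.
  -- The projection to the orthogonal complement removes the dependence on the section `σ`.
  let K : Submodule ℂ H := (LinearMap.ker π).map J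
  let P := Kᗮ.starProjection
  let Q : B →ₗ[ℂ] H := P.toLinearMap ∘ₗ J ∘ₗ σ
  have hQ : ∀ x, Q (π x) = P (J x) := fun x => by
    have h1 : J (σ (π x) - x) ∈ K := ⟨_, by simp [hσ'], rfl⟩
    have h2 : P (J (σ (π x) - x)) = 0 := by
      rw [Submodule.starProjection_apply_eq_zero_iff]
      exact Submodule.le_orthogonal_orthogonal K h1
    rw [map_sub, map_sub, sub_eq_zero] at h2
    exact h2
  refine ⟨Q, fun x => ?_, fun b ε hε => ?_⟩
  · rw [hQ]
    exact Submodule.norm_starProjection_apply_le _ _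
  · have h1 : J (σ b) - P (J (σ b)) ∈ K.topologicalClosure := by
      rw [← Submodule.orthogonal_orthogonal_eq_closure]
      exact Submodule.sub_starProjection_mem_orthogonal _
    obtain ⟨_, ⟨k, hk, rfl⟩, hk'⟩ := Metric.mem_closure_iff.1 h1 ε hε
    refine ⟨σ b - k, by rw [map_sub, hσ', LinearMap.mem_ker.1 hk, sub_zero], ?_⟩
    rw [dist_eq_norm] at hk'
    have h2 : J (σ b - k) - Q b = J (σ b) - P (J (σ b)) - J k := by
      rw [map_sub]
      exact sub_right_comm _ _ _
    rw [h2]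
    exact hk'

/-- The direct sum of linear maps into Hilbert spaces. -/
noncomputable def directSumMap {G : ℕ → Type*} [∀ m, AddCommGroup (G m)] [∀ m, Module ℂ (G m)] {H : Type*}
    [NormedAddCommGroup H] [InnerProductSpace ℂ H] (L : ∀ m, G m →ₗ[ℂ] H) :
    (Π₀ m, G m) →ₗ[ℂ] lp (fun _ : ℕ => H) 2 :=
  DFinsupp.lsum ℕ fun m => (lp.lsingle 2 m) ∘ₗ L m

theorem directSumMap_apply {G : ℕ → Type*} [∀ m, AddCommGroup (G m)] [∀ m, Module ℂ (G m)]
    {H : Type*} [NormedAddCommGroup H] [InnerProductSpace ℂ H] (L : ∀ m, G m →ₗ[ℂ] H)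
    (x : Π₀ m, G m) (m : ℕ) : directSumMap L x m = L m (x m) := by
  induction x using DFinsupp.induction with
  | h0 => simp [directSumMap]
  | ha i b f _ _ ih =>
    rw [map_add, lp.coeFn_add, Pi.add_apply, ih, DFinsupp.add_apply, map_add]
    congr 1
    simp only [directSumMap, DFinsupp.lsum_single, LinearMap.comp_apply]
    change lp.single (E := fun _ : ℕ => H) 2 i (L i b) m = _
    by_cases h : m = i
    · subst h
      simp
    · rw [lp.single_apply_ne _ _ _ h, DFinsupp.single_eq_of_ne h, map_zero]

theorem norm_directSumMap_single {G : ℕ → Type*} [∀ m, AddCommGroup (G m)] [∀ m, Module ℂ (G m)]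
    {H : Type*} [NormedAddCommGroup H] [InnerProductSpace ℂ H] (L : ∀ m, G m →ₗ[ℂ] H)
    (m : ℕ) (y : G m) : ‖directSumMap L (DFinsupp.single m y)‖ = ‖L m y‖ := by
  simp only [directSumMap, DFinsupp.lsum_single, LinearMap.comp_apply]
  exact lp.norm_single (by norm_num) _ _

theorem lp.hasSum_norm_sq {ι : Type*} {E : ι → Type*} [∀ i, NormedAddCommGroup (E i)]
    (x : lp E 2) : HasSum (fun i => ‖x i‖ ^ 2) (‖x‖ ^ 2) := by
  simpa using lp.hasSum_norm (p := 2) (by norm_num) x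

theorem isLocallyConvexTopology_of_withSeminorms {F : Type*} [AddCommGroup F] [Module ℂ F]
    {ι : Type*} {p : SeminormFamily ℂ F ι} {t : TopologicalSpace F}
    (h : WithSeminorms p) : IsLocallyConvexTopology t :=
  ⟨h.topologicalAddGroup, h.continuousSMul, h.toLocallyConvexSpace⟩

variable {X : Type*} [AddCommGroup X] [Module ℂ X] {A : ℕ → Submodule ℂ X}
  {τ : ∀ m, TopologicalSpace (A m)} {B : Submodule ℂ X} {h : ∀ m, A m ≤ B}

/-- The topology of the single seminorm `s` is admissible, hence coarser than the limit topology. -/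
theorem continuous_inductiveLimitTopology (hτ : ∀ m, IsLocallyConvexTopology (τ m))
    {s : Seminorm ℂ B}
    (hs : ∀ m, @Continuous _ _ (τ m) _ (s.comp (Submodule.inclusion (h m)))) :
    @Continuous _ _ (inductiveLimitTopology τ h) _ s := by
  let p : SeminormFamily ℂ B (Fin 1) := fun _ => s
  let t : TopologicalSpace B := p.moduleFilterBasis.topology
  have hp : WithSeminorms p := ⟨rfl⟩
  have ht : t ∈ admissibleTopologies τ h := by
    refine ⟨isLocallyConvexTopology_of_withSeminorms hp, fun m => ?_⟩
    let := τ m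
    have := (hτ m).1
    exact WithSeminorms.continuous_of_continuous_comp hp _ fun _ => hs m
  exact continuous_le_dom (sInf_le ht) (hp.continuous_seminorm 0)

/-- `B` is a quotient of the direct sum of the `A m`. The Hilbert maps of the steps, combined with
weights, give Hilbert maps `J` and `J'` on the direct sum, and these descend to `B`. Continuity is
tested on each step separately, so any weights are allowed; those of `J'` grow so fast that the
2-summing constants of the steps have a finite weighted sum. -/
theorem IsHilbertSummable.inductiveLimit (hτ : ∀ m, IsLocallyConvexTopology (τ m))
    (hB : ∀ u ∈ B, ∃ m, u ∈ A m)
    (hA : ∀ m (p : Seminorm ℂ (A m)), @Continuous _ _ (τ m) _ p → IsHilbertSummable (τ m) p)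
    (p : Seminorm ℂ B)
    (hp : ∀ m, @Continuous _ _ (τ m) _ (p.comp (Submodule.inclusion (h m)))) :
    IsHilbertSummable (inductiveLimitTopology τ h) p := by
  classical
  choose s q hs hsc hps hqc hTS using fun m => hA m _ (hp m)
  choose s' q' hs' hsc' hqs' _ _ using fun m => hA m _ (hqc m)
  have hTS' : ∀ m, IsTwoSumming (s m) (s' m) := fun m => (hTS m).mono le_rfl (hqs' m)
  choose C hC using hTS'
  have hC0 : ∀ m, 0 ≤ C m := fun m => by simpa using hC m 0 Fin.elim0 (fun a => by simp)
  choose L hL using hs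
  choose L' hL' using hs'
  -- `∑ 1 / c m = 1` gives `p ≤ ‖Q ·‖`. The ratio `c m / c' m` absorbs the constant `C m` and leaves
  -- a factor `4^(-m)`; `C m + 1` keeps the weight positive.
  let c : ℕ → ℝ := fun m => 2 ^ (m + 1)
  let c' : ℕ → ℝ := fun m => 2 ^ m * c m * Real.sqrt (C m + 1)
  have hc : ∀ m, 0 < c m := fun m => by positivity
  have hc' : ∀ m, 0 < c' m := fun m => by
    have : 0 < Real.sqrt (C m + 1) := Real.sqrt_pos.2 (by linarith [hC0 m])
    have := hc m
    positivity
  let π : (Π₀ m, A m) →ₗ[ℂ] B := DFinsupp.lsum ℕ fun m => Submodule.inclusion (h m)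
  have hπs : ∀ m (y : A m), π (DFinsupp.single m y) = Submodule.inclusion (h m) y := fun m y => by
    simp [π]
  have hπ : Function.Surjective π := fun b => by
    obtain ⟨m, hm⟩ := hB b.1 b.2
    exact ⟨DFinsupp.single m ⟨b.1, hm⟩, hπs _ _⟩
  let J := directSumMap fun m => (c m : ℂ) • L m
  let J' := directSumMap fun m => (c' m : ℂ) • L' m
  have hJ : ∀ x m, ‖J x m‖ = c m * s m (x m) := fun x m => by
    rw [directSumMap_apply, LinearMap.smul_apply, norm_smul, Complex.norm_real, hL,
      Real.norm_of_nonneg (hc m).le]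
  obtain ⟨Q, hQ, hQa⟩ := exists_quotient_hilbertMap π hπ J
  obtain ⟨Q', hQ', hQa'⟩ := exists_quotient_hilbertMap π hπ J'
  have : TopologicalSpace.SeparableSpace (lp (fun _ : ℕ => ℂ) 2) := lp.separableSpace _
  have : TopologicalSpace.SeparableSpace (lp (fun _ : ℕ => lp (fun _ : ℕ => ℂ) 2) 2) :=
    lp.separableSpace _
  -- `16 / 3 = 4 ∑ 4^(-m)` is the sum of the bounds `hm` for the components.
  refine ⟨(normSeminorm ℂ _).comp Q, (normSeminorm ℂ _).comp Q',
    isHilbertian_of_linearMap Q fun _ => rfl, ?_, fun b => ?_, ?_, 16 / 3, fun n x hx => ?_⟩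
  · refine continuous_inductiveLimitTopology hτ fun m => ?_
    let := τ m
    have := (hτ m).1
    have := (hτ m).2.1
    refine Seminorm.continuous_of_le (q := (c m).toNNReal • s m)
      ((hsc m).const_smul (c m).toNNReal) fun y => ?_
    change ‖Q (Submodule.inclusion (h m) y)‖ ≤ (c m).toNNReal • s m y
    rw [← hπs, NNReal.smul_def, Real.coe_toNNReal _ (hc m).le]
    refine (hQ _).trans (le_of_eq ?_)
    rw [norm_directSumMap_single, LinearMap.smul_apply, norm_smul, Complex.norm_real, hL,
      Real.norm_of_nonneg (hc m).le]
    rfl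
  · refine le_of_forall_pos_le_add fun ε hε => ?_
    obtain ⟨x, rfl, hx⟩ := hQa b ε hε
    have h1 : p (π x) ≤ ∑ m ∈ x.support, s m (x m) := by
      have : π x = ∑ m ∈ x.support, Submodule.inclusion (h m) (x m) := by
        simp only [π, DFinsupp.lsum_apply_apply, DFinsupp.sumAddHom_apply]
        rfl
      rw [this]
      refine (Finset.le_sum_of_subadditive p (map_zero p).le (map_add_le_add p) _ _).trans ?_
      exact Finset.sum_le_sum fun m _ => hps m (x m)
    have h2 : ∑ m ∈ x.support, s m (x m) ≤ ‖J x‖ := by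
      calc ∑ m ∈ x.support, s m (x m) ≤ ∑ m ∈ x.support, (1 / 2) ^ m * (1 / 2) * ‖J x‖ := by
            refine Finset.sum_le_sum fun m _ => ?_
            have h3 : ‖J x m‖ ≤ ‖J x‖ := lp.norm_apply_le_norm (by norm_num) _ _
            rw [hJ] at h3
            have h4 : s m (x m) = (1 / 2) ^ m * (1 / 2) * (c m * s m (x m)) := by
              have : (1 / 2 : ℝ) ^ m * (1 / 2) * c m = 1 := by
                simp only [c, ← pow_succ]
                rw [← mul_pow]; norm_num
              rw [← mul_assoc, this, one_mul]
            rw [h4]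
            exact mul_le_mul_of_nonneg_left h3 (by positivity)
        _ ≤ 1 * ‖J x‖ := by
            rw [← Finset.sum_mul, ← Finset.sum_mul]
            refine mul_le_mul_of_nonneg_right ?_ (norm_nonneg _)
            have := summable_geometric_two.sum_le_tsum x.support fun _ _ => by positivity
            rw [tsum_geometric_two] at this
            linarith
        _ = ‖J x‖ := one_mul _
    have h3 : ‖J x‖ ≤ ‖Q (π x)‖ + ε := by
      have := norm_sub_norm_le (J x) (Q (π x))
      linarith
    exact h1.trans (h2.trans h3)
  · refine continuous_inductiveLimitTopology hτ fun m => ?_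
    let := τ m
    have := (hτ m).1
    have := (hτ m).2.1
    refine Seminorm.continuous_of_le (q := (c' m).toNNReal • s' m)
      ((hsc' m).const_smul (c' m).toNNReal) fun y => ?_
    change ‖Q' (Submodule.inclusion (h m) y)‖ ≤ (c' m).toNNReal • s' m y
    rw [← hπs, NNReal.smul_def, Real.coe_toNNReal _ (hc' m).le]
    refine (hQ' _).trans (le_of_eq ?_)
    rw [norm_directSumMap_single, LinearMap.smul_apply, norm_smul, Complex.norm_real, hL',
      Real.norm_of_nonneg (hc' m).le]
    rfl
  -- With an error `1 / (n + 1)` for each of the `n` representatives, Cauchy–Schwarz bounds the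
  -- total error by `(∑ ‖a i‖²)^(1/2)`. The norm at most doubles, which is the factor 4 in `hcontr`.
  · choose y hy hyx using fun i => hQa' (x i) (1 / (n + 1)) (by positivity)
    have hcontr : ∀ a : Fin n → ℂ, ‖∑ i, a i • J' (y i)‖ ^ 2 ≤ 4 * ∑ i, ‖a i‖ ^ 2 := fun a => by
      have h1 : ‖∑ i, a i • J' (y i)‖ ≤ ‖∑ i, a i • Q' (x i)‖ + ∑ i, ‖a i‖ * (1 / (n + 1)) := by
        have e1 : ∑ i, a i • J' (y i) = ∑ i, a i • Q' (x i) + ∑ i, a i • (J' (y i) - Q' (x i)) := by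
          rw [← Finset.sum_add_distrib]
          exact Finset.sum_congr rfl fun i _ => by rw [← smul_add, add_sub_cancel]
        rw [e1]
        refine (norm_add_le _ _).trans (add_le_add_right ?_ _)
        refine (norm_sum_le _ _).trans (Finset.sum_le_sum fun i _ => ?_)
        rw [norm_smul]
        exact mul_le_mul_of_nonneg_left (hyx i).le (norm_nonneg _)
      have h2 : ‖∑ i, a i • Q' (x i)‖ ^ 2 ≤ ∑ i, ‖a i‖ ^ 2 := by
        have := hx a
        change ‖Q' (∑ i, a i • x i)‖ ^ 2 ≤ _ at this
        simpa only [map_sum, map_smul] using this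
      have h3 : (∑ i, ‖a i‖ * (1 / ((n : ℝ) + 1))) ^ 2 ≤ ∑ i, ‖a i‖ ^ 2 := by
        rw [← Finset.sum_mul, mul_pow]
        have h4 := sq_sum_le_card_mul_sum_sq (s := Finset.univ) (f := fun i => ‖a i‖)
        simp only [Finset.card_univ, Fintype.card_fin] at h4
        have h0 : 0 ≤ ∑ i, ‖a i‖ ^ 2 := Finset.sum_nonneg fun _ _ => sq_nonneg _
        rw [div_pow, one_pow, mul_one_div, div_le_iff₀ (by positivity)]
        nlinarith [mul_nonneg h0 (Nat.cast_nonneg (α := ℝ) n),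
          mul_nonneg h0 (sq_nonneg (n : ℝ))]
      calc ‖∑ i, a i • J' (y i)‖ ^ 2
          ≤ (‖∑ i, a i • Q' (x i)‖ + ∑ i, ‖a i‖ * (1 / ((n : ℝ) + 1))) ^ 2 :=
            pow_le_pow_left₀ (norm_nonneg _) h1 2
        _ ≤ _ := by
            nlinarith [sq_nonneg (‖∑ i, a i • Q' (x i)‖ - ∑ i, ‖a i‖ * (1 / ((n : ℝ) + 1)))]
    have hm : ∀ m, ∑ i, ‖J (y i) m‖ ^ 2 ≤ 4 * (1 / 4 : ℝ) ^ m := fun m => by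
      -- The factor `1/2` undoes the 4 of `hcontr`, so the rescaled components form an admissible
      -- family on the step `m`.
      have h1 := hC m n (fun i => (((c' m / 2 : ℝ)) : ℂ) • y i m) fun a => by
        have e1 : s' m (∑ i, a i • (((c' m / 2 : ℝ)) : ℂ) • y i m)
            = ‖(∑ i, a i • J' (y i) : lp (fun _ : ℕ => lp (fun _ : ℕ => ℂ) 2) 2) m‖ / 2 := by
          have e2 : (∑ i, a i • J' (y i) : lp (fun _ : ℕ => lp (fun _ : ℕ => ℂ) 2) 2)
              = J' (∑ i, a i • y i) := by simp only [map_sum, map_smul]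
          have e3 : ∑ i, a i • (((c' m / 2 : ℝ)) : ℂ) • y i m
              = (((c' m / 2 : ℝ)) : ℂ) • (∑ i, a i • y i) m := by
            rw [DFinsupp.finsetSum_apply, Finset.smul_sum]
            exact Finset.sum_congr rfl fun i _ => by rw [DFinsupp.smul_apply, smul_comm]
          rw [e2, e3, directSumMap_apply, map_smul_eq_mul, LinearMap.smul_apply, norm_smul, hL',
            Complex.norm_real, Complex.norm_real, Real.norm_of_nonneg (hc' m).le,
            Real.norm_of_nonneg (by linarith [hc' m])]
          ring
        rw [e1]
        have e4 := lp.norm_apply_le_norm (p := 2) (by norm_num)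
          (∑ i, a i • J' (y i) : lp (fun _ : ℕ => lp (fun _ : ℕ => ℂ) 2) 2) m
        have e5 := hcontr a
        nlinarith [norm_nonneg ((∑ i, a i • J' (y i) :
          lp (fun _ : ℕ => lp (fun _ : ℕ => ℂ) 2) 2) m)]
      have h2 : ∀ i, ‖J (y i) m‖ ^ 2
          = (2 * c m / c' m) ^ 2 * s m ((((c' m / 2 : ℝ)) : ℂ) • y i m) ^ 2 := fun i => by
        rw [hJ, map_smul_eq_mul, Complex.norm_real, Real.norm_of_nonneg (by linarith [hc' m]),
          ← mul_pow]
        congr 1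
        have := (hc' m).ne'
        field_simp
      simp only [h2, ← Finset.mul_sum]
      have h3 : (2 * c m / c' m) ^ 2 = 4 * (1 / 4) ^ m / (C m + 1) := by
        have e1 : Real.sqrt (C m + 1) ^ 2 = C m + 1 := Real.sq_sqrt (by linarith [hC0 m])
        have e2 : (c' m) ^ 2 = 4 ^ m * (c m) ^ 2 * (C m + 1) := by
          simp only [c', mul_pow, e1]
          rw [← pow_mul, mul_comm m 2, pow_mul]; norm_num
        rw [div_pow, e2, mul_pow, one_div, inv_pow]
        have := (hc m).ne'
        have : C m + 1 ≠ 0 := by linarith [hC0 m]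
        field_simp
        norm_num
      rw [h3, div_mul_eq_mul_div, div_le_iff₀ (by linarith [hC0 m])]
      exact mul_le_mul_of_nonneg_left (by linarith) (by positivity)
    have hsum : HasSum (fun m => ∑ i, ‖J (y i) m‖ ^ 2) (∑ i, ‖J (y i)‖ ^ 2) :=
      hasSum_sum fun i _ => lp.hasSum_norm_sq (J (y i))
    have hgeo : HasSum (fun m : ℕ => 4 * (1 / 4 : ℝ) ^ m) (4 * (1 - 1 / 4)⁻¹) :=
      (hasSum_geometric_of_lt_one (by norm_num) (by norm_num)).mul_left 4
    have hle := hasSum_le hm hsum hgeo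
    refine le_trans (Finset.sum_le_sum fun i _ => ?_) (hle.trans (by norm_num))
    have h1 := hQ (y i)
    rw [hy] at h1
    exact pow_le_pow_left₀ (norm_nonneg _) h1 2

end InductiveLimit

/-! ### Smooth families of smooth functions -/

section SmoothFamilies

variable {E : Type*} [NormedAddCommGroup E] [NormedSpace ℝ E]
  {P : Type*} [NormedAddCommGroup P] [NormedSpace ℝ P]
  {G : Type*} [NormedAddCommGroup G] [NormedSpace ℝ G]

/-- Induction on `r`, with the parameter kept as a variable so that joint smoothness survives each
derivative. -/
theorem ContDiffOn.iteratedFDeriv_snd {g : P × E → G} {U : Set E} (hU : IsOpen U)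
    (hg : ContDiffOn ℝ ∞ g (univ ×ˢ U)) (r : ℕ) :
    ContDiffOn ℝ ∞ (fun z : P × E => iteratedFDeriv ℝ r (fun y => g (z.1, y)) z.2)
      (univ ×ˢ U) := by
  induction r with
  | zero =>
    simp only [iteratedFDeriv_zero_eq_comp]
    exact (continuousMultilinearCurryFin0 ℝ E G).symm.contDiff.comp_contDiffOn hg
  | succ r ih =>
    simp only [iteratedFDeriv_succ_eq_comp_left]
    have hc : ContDiff ℝ ∞ (fun x : E →L[ℝ] (E [×r]→L[ℝ] G) =>
        ((continuousMultilinearCurryLeftEquiv ℝ (fun _ : Fin (r + 1) => E) G).symm x :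
          E [×(r + 1)]→L[ℝ] G)) :=
      LinearIsometryEquiv.contDiff (E := E →L[ℝ] (E [×r]→L[ℝ] G)) (F := E [×(r + 1)]→L[ℝ] G) _
    refine hc.comp_contDiffOn fun z hz => ContDiffAt.contDiffWithinAt ?_
    have hopen : (univ : Set P) ×ˢ U ∈ 𝓝 z := (isOpen_univ.prod hU).mem_nhds hz
    refine ContDiffAt.fderiv (n := ∞)
      (f := fun (z : P × E) y => iteratedFDeriv ℝ r (fun y => g (z.1, y)) y) (g := Prod.snd)
      ?_ contDiffAt_snd (by simp)
    have h1 : ContDiffAt ℝ ∞ (fun z : P × E => iteratedFDeriv ℝ r (fun y => g (z.1, y)) z.2)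
        ((fun w : (P × E) × E => (w.1.1, w.2)) (z, z.2)) := ih.contDiffAt hopen
    exact h1.comp (z, z.2) (f := fun w : (P × E) × E => (w.1.1, w.2)) (by fun_prop)

variable {H : Type*} [TopologicalSpace H] {I : ModelWithCorners ℝ E H}
  {N : Type*} [TopologicalSpace N] [ChartedSpace H N]

/-- The chart derivatives are jointly continuous in the parameter and the point; over a compact set
of points this is continuity for uniform convergence. Continuity of `u` on families of test
functions comes from here. -/
theorem continuous_smoothTopology [I.Boundaryless] {g : P → smoothFunctions I N}
    (hg : ContMDiff (𝓘(ℝ, P).prod I) 𝓘(ℝ, ℂ) ∞ fun z : P × N => (g z.1).1 z.2) :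
    @Continuous _ _ _ (smoothTopology I N) g := by
  refine continuous_iInf_rng.2 fun e => continuous_iInf_rng.2 fun r => continuous_induced_rng.2 ?_
  rw [continuous_iff_continuousAt]
  intro s
  have hU : IsOpen (e.1.extend I).target := e.1.isOpen_extend_target
  have h1 : ContDiffOn ℝ ∞ (fun z : P × E => (g z.1).1 ((e.1.extend I).symm z.2))
      (univ ×ˢ (e.1.extend I).target) := by
    rw [← contMDiffOn_iff_contDiffOn]
    have h2 : ContMDiffOn 𝓘(ℝ, P × E) I ∞ (fun z : P × E => (e.1.extend I).symm z.2)
        (univ ×ˢ (e.1.extend I).target) := by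
      refine (contMDiffOn_extend_symm (n := ∞) e.2).comp contDiff_snd.contMDiff.contMDiffOn ?_
      rintro z ⟨-, hz⟩
      rw [OpenPartialHomeomorph.extend_target'] at hz
      exact hz
    have h3 : ContMDiffOn 𝓘(ℝ, P × E) 𝓘(ℝ, P) ∞ (fun z : P × E => z.1)
        (univ ×ˢ (e.1.extend I).target) := contDiff_fst.contMDiff.contMDiffOn
    exact hg.comp_contMDiffOn (h3.prodMk h2)
  have h2 := (h1.iteratedFDeriv_snd hU r).continuousOn
  refine UniformOnFun.tendsto_iff_tendstoUniformlyOn.2 fun K hK => ?_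
  intro V hV
  obtain ⟨v, hv, hvV⟩ := hK.1.mem_uniformity_of_prod
    (f := fun (s : P) (y : E) => iteratedFDeriv ℝ r ((g s).1 ∘ (e.1.extend I).symm) y)
    (h2.mono (prod_mono subset_rfl hK.2)) (mem_univ s) (symm_le_uniformity hV)
  rw [nhdsWithin_univ] at hv
  filter_upwards [hv] with s' hs' y hy
  exact hvV s' hs' y hy


theorem IsCompactDistribution.comp_continuous {u : Module.Dual ℂ (smoothFunctions I N)}
    (hu : IsCompactDistribution I N u) {X : Type*} [TopologicalSpace X]
    {g : X → smoothFunctions I N} (hg : @Continuous _ _ _ (smoothTopology I N) g) :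
    Continuous fun x => u (g x) :=
  @Continuous.comp _ _ _ _ (smoothTopology I N) _ _ _ hu hg

/-! ### Supports -/

/-- Compactly supported distributions have compact support. -/
theorem IsCompactDistribution.exists_isCompact [I.Boundaryless] [SigmaCompactSpace N]
    [WeaklyLocallyCompactSpace N]
    {u : Module.Dual ℂ (smoothFunctions I N)} (hu : IsCompactDistribution I N u) :
    ∃ K : Set N, IsCompact K ∧ ∀ f : smoothFunctions I N, (∀ᶠ x in 𝓝ˢ K, f.1 x = 0) → u f = 0 := by
  by_contra! hcon
  let K : CompactExhaustion N := default
  choose f hf hfu using fun n => hcon (K n) (K.isCompact n)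
  -- Rescaled so that `u (g n) = 1`, while `g n → 0` in `C^∞`: every compact set lies in `K n` for
  -- large `n`, where `g n` vanishes with all its derivatives.
  let g : ℕ → smoothFunctions I N := fun n => (u (f n))⁻¹ • f n
  have hg1 : ∀ n, u (g n) = 1 := fun n => by
    rw [map_smul, smul_eq_mul, inv_mul_cancel₀ (hfu n)]
  have hg0 : ∀ n, ∀ᶠ x in 𝓝ˢ (K n), (g n).1 x = 0 := fun n => by
    filter_upwards [hf n] with x hx
    change (u (f n))⁻¹ * (f n).1 x = 0
    rw [hx, mul_zero]
  have hlim : Tendsto g atTop (@nhds _ (smoothTopology I N) 0) := by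
    rw [nhds_iInf, tendsto_iInf]
    intro e
    rw [nhds_iInf, tendsto_iInf]
    intro r
    rw [nhds_induced, tendsto_comap_iff]
    refine UniformOnFun.tendsto_iff_tendstoUniformlyOn.2 fun L hL => ?_
    have h1 : IsCompact ((e.1.extend I).symm '' L) :=
      hL.1.image_of_continuousOn ((e.1.continuousOn_extend_symm).mono hL.2)
    obtain ⟨n₀, hn₀⟩ := K.exists_superset_of_isCompact h1
    intro V hV
    filter_upwards [eventually_ge_atTop n₀] with n hn y hy
    have h2 : (e.1.extend I).symm y ∈ K n := K.subset hn (hn₀ ⟨y, hy, rfl⟩)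
    have h3 : ContinuousAt (e.1.extend I).symm y :=
      e.1.continuousOn_extend_symm.continuousAt (e.1.isOpen_extend_target.mem_nhds (hL.2 hy))
    have h4 : ((g n).1 ∘ (e.1.extend I).symm) =ᶠ[𝓝 y]
        ((0 : smoothFunctions I N).1 ∘ (e.1.extend I).symm) :=
      h3.eventually (Filter.Eventually.filter_mono (nhds_le_nhdsSet h2) (hg0 n))
    have h5 := (h4.iteratedFDeriv ℝ r).eq_of_nhds
    change (iteratedFDeriv ℝ r ((0 : smoothFunctions I N).1 ∘ (e.1.extend I).symm) y,
      iteratedFDeriv ℝ r ((g n).1 ∘ (e.1.extend I).symm) y) ∈ V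
    rw [h5]
    exact refl_mem_uniformity hV
  have h6 : Tendsto (fun n => u (g n)) atTop (𝓝 (u 0)) :=
    Tendsto.comp (g := u) ((@Continuous.tendsto _ _ (smoothTopology I N) _ _ hu 0)) hlim
  simp only [hg1, map_zero] at h6
  exact one_ne_zero (tendsto_nhds_unique tendsto_const_nhds h6)

/-! ### Localized functions -/

namespace PhaseLocalizer

variable (c : PhaseLocalizer I N)

/-- Outside the chart the coordinates are meaningless, but there the cutoff vanishes on a
neighbourhood. -/
theorem contMDiff_mul_comp_extend {φ : P × E → ℂ} (hφ : ContDiff ℝ ∞ φ) :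
    ContMDiff (𝓘(ℝ, P).prod I) 𝓘(ℝ, ℂ) ∞
      fun z : P × N => c.cutoff z.2 * φ (z.1, c.chart.extend I z.2) := by
  intro z
  have hcut : ContMDiffAt (𝓘(ℝ, P).prod I) 𝓘(ℝ, ℂ) ∞ (fun z : P × N => c.cutoff z.2) z :=
    (c.smooth z.2).comp z contMDiffAt_snd
  by_cases hz : z.2 ∈ c.chart.source
  · have h1 : ContMDiffAt (𝓘(ℝ, P).prod I) 𝓘(ℝ, E) ∞
        (fun z : P × N => c.chart.extend I z.2) z :=
      (c.chart.contMDiffAt_extend c.chart_mem hz).comp z contMDiffAt_snd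
    have h2 : ContMDiffAt (𝓘(ℝ, P).prod I) 𝓘(ℝ, P × E) ∞
        (fun z : P × N => (z.1, c.chart.extend I z.2)) z := contMDiffAt_fst.prodMk_space h1
    have h3 : ContMDiffAt (𝓘(ℝ, P).prod I) 𝓘(ℝ, ℂ) ∞
        (fun z : P × N => φ (z.1, c.chart.extend I z.2)) z :=
      (hφ.contMDiff.contMDiffAt (x := (z.1, c.chart.extend I z.2))).comp z h2
    exact contDiff_mul.contMDiff.contMDiffAt.comp z (hcut.prodMk_space h3)
  · have h1 : z.2 ∉ tsupport c.cutoff := fun h => hz (c.tsupport_subset h)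
    have h2 : ∀ᶠ w : P × N in 𝓝 z, c.cutoff w.2 = 0 :=
      continuous_snd.continuousAt.eventually (notMem_tsupport_iff_eventuallyEq.1 h1)
    refine (contMDiffAt_const (c := (0 : ℂ))).congr_of_eventuallyEq ?_
    filter_upwards [h2] with w hw
    rw [hw, zero_mul]

variable [IsManifold I ∞ N]

/-- The smooth function that is `χ · φ` in the coordinates of the chart. -/
noncomputable def localized (φ : E → ℂ) (hφ : ContDiff ℝ ∞ φ) : smoothFunctions I N :=
  ⟨fun x => c.cutoff x * φ (c.chart.extend I x),
    (c.contMDiff_mul_comp_extend (P := ℝ) (φ := fun z => φ z.2) (hφ.comp contDiff_snd)).comp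
      (f := fun x : N => ((0 : ℝ), x)) (contMDiff_const.prodMk contMDiff_id)⟩

theorem continuous_localized [I.Boundaryless] {φ : P → E → ℂ}
    (hφ : ContDiff ℝ ∞ fun z : P × E => φ z.1 z.2) (hφ' : ∀ s, ContDiff ℝ ∞ (φ s)) :
    @Continuous _ _ _ (smoothTopology I N) fun s => c.localized (φ s) (hφ' s) :=
  continuous_smoothTopology (c.contMDiff_mul_comp_extend hφ)

theorem contDiff_cexp_neg_I (η : E →L[ℝ] ℝ) :
    ContDiff ℝ ∞ fun y : E => Complex.exp (-Complex.I * (η y : ℂ)) :=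
  (contDiff_const.mul (Complex.ofRealCLM.contDiff.comp η.contDiff)).cexp

theorem continuous_fourier [I.Boundaryless] {u : Module.Dual ℂ (smoothFunctions I N)}
    (hu : IsCompactDistribution I N u) : Continuous (c.fourier u) := by
  have h1 : ContDiff ℝ ∞ fun z : (E →L[ℝ] ℝ) × E => Complex.exp (-Complex.I * (z.1 z.2 : ℂ)) := by
    have : ContDiff ℝ ∞ fun z : (E →L[ℝ] ℝ) × E => z.1 z.2 :=
      isBoundedBilinearMap_apply.contDiff
    exact (contDiff_const.mul (Complex.ofRealCLM.contDiff.comp this)).cexp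
  exact hu.comp_continuous
    (c.continuous_localized (φ := fun (η : E →L[ℝ] ℝ) y => Complex.exp (-Complex.I * (η y : ℂ))) h1
    contDiff_cexp_neg_I)

/-- Replacement of the cutoff by its product with a smooth function of the coordinates. -/
noncomputable def mulCutoff (φ : E → ℂ) (hφ : ContDiff ℝ ∞ φ) : PhaseLocalizer I N :=
  { c with
    cutoff := (c.localized φ hφ).1
    smooth := (c.localized φ hφ).2
    hasCompactSupport := c.hasCompactSupport.mul_right
    tsupport_subset :=
      (closure_mono (Function.support_mul_subset_left _ _)).trans c.tsupport_subset }

theorem footprint_mulCutoff_subset (φ : E → ℂ) (hφ : ContDiff ℝ ∞ φ) :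
    (c.mulCutoff φ hφ).footprint ⊆ c.footprint := fun _ hz =>
  ⟨closure_mono (Function.support_mul_subset_left _ _) hz.1, hz.2⟩

theorem wave_mulCutoff (φ : E → ℂ) (hφ : ContDiff ℝ ∞ φ) (η : E →L[ℝ] ℝ) :
    (c.mulCutoff φ hφ).wave η =
      c.localized (fun y => φ y * Complex.exp (-Complex.I * (η y : ℂ)))
        (hφ.mul (contDiff_cexp_neg_I η)) := by
  ext x
  change c.cutoff x * φ (c.chart.extend I x) * _ = c.cutoff x * (φ (c.chart.extend I x) * _)
  rw [mul_assoc]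
  rfl

/-- The linear function `y ↦ -i a(y)`. -/
noncomputable def negICoord (a : E →L[ℝ] ℝ) (y : E) : ℂ := -Complex.I * (a y : ℂ)

theorem contDiff_negICoord (a : E →L[ℝ] ℝ) : ContDiff ℝ ∞ (negICoord a) :=
  contDiff_const.mul (Complex.ofRealCLM.contDiff.comp a.contDiff)

/-- The entire function `(e^z - 1 - z) / z²`. -/
noncomputable def expRemainder : ℂ → ℂ := dslope (dslope Complex.exp 0) 0

theorem cexp_eq_expRemainder (z : ℂ) : Complex.exp z = 1 + z + z ^ 2 * expRemainder z := by
  have h1 : ∀ w, Complex.exp w = 1 + w * dslope Complex.exp 0 w := fun w => by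
    have := sub_smul_dslope Complex.exp 0 w
    simp only [sub_zero, smul_eq_mul, Complex.exp_zero] at this
    rw [this]; ring
  have h2 : dslope Complex.exp 0 z = 1 + z * expRemainder z := by
    have := sub_smul_dslope (dslope Complex.exp 0) 0 z
    simp only [sub_zero, smul_eq_mul, dslope_same, Complex.deriv_exp, Complex.exp_zero] at this
    rw [expRemainder, this]; ring
  rw [h1 z, h2]; ring

theorem contDiff_expRemainder : ContDiff ℝ ∞ expRemainder := by
  have h1 : Differentiable ℂ (dslope Complex.exp 0) := by
    rw [← differentiableOn_univ, Complex.differentiableOn_dslope univ_mem]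
    exact Complex.differentiable_exp.differentiableOn
  have h2 : Differentiable ℂ expRemainder := by
    rw [← differentiableOn_univ, expRemainder, Complex.differentiableOn_dslope univ_mem]
    exact h1.differentiableOn
  exact (h2.contDiff (n := ∞)).restrict_scalars ℝ

/-- The expansion `e^(hz) = 1 + hz + (hz)² R(hz)` is an exact identity between test functions, and
`u` of the remainder is continuous in `h`. The second order term therefore has derivative zero,
without any differential calculus in `C^∞`. -/
theorem hasDerivAt_fourier [I.Boundaryless] {u : Module.Dual ℂ (smoothFunctions I N)}
    (hu : IsCompactDistribution I N u) (η a : E →L[ℝ] ℝ) (t : ℝ) :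
    HasDerivAt (fun t : ℝ => c.fourier u (η + t • a))
      ((c.mulCutoff (negICoord a) (contDiff_negICoord a)).fourier u (η + t • a)) t := by
  set ξ := η + t • a with hξ
  let φ : ℝ → E → ℂ := fun h y => negICoord a y ^ 2 * expRemainder (h * negICoord a y) *
    Complex.exp (-Complex.I * (ξ y : ℂ))
  have hφ : ContDiff ℝ ∞ fun z : ℝ × E => φ z.1 z.2 := by
    have h1 : ContDiff ℝ ∞ fun z : ℝ × E => negICoord a z.2 :=
      (contDiff_negICoord a).comp contDiff_snd
    have h2 : ContDiff ℝ ∞ fun z : ℝ × E => (z.1 : ℂ) :=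
      Complex.ofRealCLM.contDiff.comp contDiff_fst
    exact ((h1.pow 2).mul (contDiff_expRemainder.comp (h2.mul h1))).mul
      ((contDiff_cexp_neg_I ξ).comp contDiff_snd)
  have hφ' : ∀ h, ContDiff ℝ ∞ (φ h) := fun h =>
    hφ.comp (f := fun y : E => (h, y)) (contDiff_const.prodMk contDiff_id)
  have hcont : Continuous fun h : ℝ => u (c.localized (φ h) (hφ' h)) :=
    hu.comp_continuous (c.continuous_localized hφ hφ')
  have hexp : ∀ s : ℝ, c.fourier u (η + s • a) = c.fourier u ξ +
      (s - t : ℝ) * (c.mulCutoff (negICoord a) (contDiff_negICoord a)).fourier u ξ +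
      ((s - t : ℝ) : ℂ) ^ 2 * u (c.localized (φ (s - t)) (hφ' (s - t))) := fun s => by
    have hw : c.wave (η + s • a) = c.wave ξ + ((s - t : ℝ) : ℂ) •
        (c.mulCutoff (negICoord a) (contDiff_negICoord a)).wave ξ +
        ((s - t : ℝ) : ℂ) ^ 2 • c.localized (φ (s - t)) (hφ' (s - t)) := by
      rw [wave_mulCutoff]
      ext x
      set y := c.chart.extend I x with hy
      change c.cutoff x * Complex.exp (-Complex.I * ((η + s • a) y : ℝ)) =
        c.cutoff x * Complex.exp (-Complex.I * (ξ y : ℝ)) + ((s - t : ℝ) : ℂ) *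
          (c.cutoff x * (negICoord a y * Complex.exp (-Complex.I * (ξ y : ℝ)))) +
        ((s - t : ℝ) : ℂ) ^ 2 * (c.cutoff x * (negICoord a y ^ 2 *
          expRemainder ((s - t : ℝ) * negICoord a y) * Complex.exp (-Complex.I * (ξ y : ℂ))))
      have h1 : -Complex.I * (((η + s • a) y : ℝ) : ℂ) =
          -Complex.I * (ξ y : ℝ) + ((s - t : ℝ) : ℂ) * negICoord a y := by
        simp only [hξ, negICoord, add_apply, smul_apply, smul_eq_mul]
        push_cast
        ring
      rw [h1, Complex.exp_add, cexp_eq_expRemainder (((s - t : ℝ) : ℂ) * negICoord a y)]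
      ring
    simp only [fourier]
    rw [hw, map_add, map_add, map_smul, map_smul, smul_eq_mul, smul_eq_mul]
  simp only [hexp]
  have hd : HasDerivAt (fun s : ℝ => ((s - t : ℝ) : ℂ)) 1 t := by
    have := ((hasDerivAt_id t).sub_const t).ofReal_comp
    simpa using this
  have h1 := hd.mul_const ((c.mulCutoff (negICoord a) (contDiff_negICoord a)).fourier u ξ)
  have h2 : HasDerivAt (fun s : ℝ => ((s - t : ℝ) : ℂ) ^ 2 *
      u (c.localized (φ (s - t)) (hφ' (s - t)))) 0 t := by
    rw [hasDerivAt_iff_tendsto_slope]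
    have h3 : Tendsto (fun s : ℝ => ((s - t : ℝ) : ℂ) * u (c.localized (φ (s - t)) (hφ' (s - t))))
        (𝓝[≠] t) (𝓝 0) := by
      have h4 : Continuous fun s : ℝ =>
          ((s - t : ℝ) : ℂ) * u (c.localized (φ (s - t)) (hφ' (s - t))) :=
        (Complex.continuous_ofReal.comp (continuous_id.sub continuous_const)).mul
          (hcont.comp (continuous_id.sub continuous_const))
      have h5 := h4.tendsto t
      simp only [sub_self, Complex.ofReal_zero, zero_mul] at h5
      exact h5.mono_left nhdsWithin_le_nhds
    refine h3.congr' ?_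
    filter_upwards [self_mem_nhdsWithin] with s hs
    have hst : ((s - t : ℝ) : ℂ) ≠ 0 := by
      exact_mod_cast sub_ne_zero.2 hs
    rw [slope_def_module, sub_self, Complex.ofReal_zero, zero_pow two_ne_zero, zero_mul, sub_zero,
      Complex.real_smul, Complex.ofReal_inv]
    field_simp
  have h3 := ((hasDerivAt_const t (c.fourier u ξ)).add h1).add h2
  simp only [zero_add, add_zero, one_mul] at h3
  exact h3

end PhaseLocalizer

end SmoothFamilies

/-! ### Coordinates on the cotangent bundle -/

section Cotangent

variable {E : Type*} [NormedAddCommGroup E] [NormedSpace ℝ E]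
  {H : Type*} [TopologicalSpace H] {I : ModelWithCorners ℝ E H}
  {N : Type*} [TopologicalSpace N] [ChartedSpace H N] [IsManifold I ∞ N]

/-- The target of the Hom bundle is the trivial line bundle, whose coordinates are the identity;
only the tangent trivialization remains. -/
theorem continuousAt_cotangentBundle {X : Type*} [TopologicalSpace X]
    {f : X → CotangentBundle I N} {t₀ : X} :
    ContinuousAt f t₀ ↔ ContinuousAt (fun t => (f t).1) t₀ ∧
      ContinuousAt (fun t => (f t).2.comp
        ((trivializationAt E (TangentSpace I : N → Type _) (f t₀).1).symmL ℝ (f t).1)) t₀ := by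
  refine (continuousAt_hom_bundle (F₁ := E) (E₁ := (TangentSpace I : N → Type _)) (F₂ := ℝ)
    (E₂ := Bundle.Trivial N ℝ) (σ := RingHom.id ℝ) f).trans (and_congr Iff.rfl (iff_of_eq ?_))
  congr 1
  ext t v
  simp only [ContinuousLinearMap.inCoordinates, ContinuousLinearMap.comp_apply]
  have := Bundle.Trivial.continuousLinearMapAt_trivialization ℝ N ℝ (f t).1
  erw [this]
  rfl

/-- The covector at `x` with coordinates `η` in the chart `e`. -/
noncomputable def covectorOf (I : ModelWithCorners ℝ E H) (e : OpenPartialHomeomorph N H)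
    (p : N × (E →L[ℝ] ℝ)) :
    CotangentBundle I N :=
  ⟨p.1, p.2.comp (mfderiv I 𝓘(ℝ, E) (e.extend I) p.1)⟩

theorem continuousAt_covectorOf {e : OpenPartialHomeomorph N H}
    (he : e ∈ IsManifold.maximalAtlas I ∞ N) {p : N × (E →L[ℝ] ℝ)} (hp : p.1 ∈ e.source) :
    ContinuousAt (covectorOf I e) p := by
  rw [continuousAt_cotangentBundle]
  refine ⟨continuousAt_fst, ?_⟩
  have h1 : ContMDiffAt I 𝓘(ℝ, E →L[ℝ] E) ∞
      (inTangentCoordinates I 𝓘(ℝ, E) id (e.extend I) (mfderiv I 𝓘(ℝ, E) (e.extend I)) p.1) p.1 :=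
    (e.contMDiffAt_extend he hp).mfderiv_const (by simp)
  have h2 : ContinuousAt (fun q : N × (E →L[ℝ] ℝ) => q.2.comp
      (inTangentCoordinates I 𝓘(ℝ, E) id (e.extend I) (mfderiv I 𝓘(ℝ, E) (e.extend I)) p.1 q.1)) p :=
    continuousAt_snd.clm_comp (h1.continuousAt.comp continuousAt_fst)
  refine h2.congr (Eventually.of_forall fun q => ?_)
  ext v
  simp only [inTangentCoordinates, ContinuousLinearMap.inCoordinates, covectorOf,
    ContinuousLinearMap.comp_apply, TangentBundle.continuousLinearMapAt_model_space]
  rfl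

/-- Without boundary the chart has open target, so both composites are the identity near the point
and the chain rule applies. -/
theorem exists_mfderiv_extend_inverse [I.Boundaryless] {e : OpenPartialHomeomorph N H}
    (he : e ∈ IsManifold.maximalAtlas I ∞ N) {x : N} (hx : x ∈ e.source) :
    ∃ D : E →L[ℝ] TangentSpace I x,
      (∀ v, mfderiv I 𝓘(ℝ, E) (e.extend I) x (D v) = v) ∧
      ∀ v, D (mfderiv I 𝓘(ℝ, E) (e.extend I) x v) = v := by
  have h1 : MDifferentiableAt I 𝓘(ℝ, E) (e.extend I) x :=
    (e.contMDiffAt_extend he hx).mdifferentiableAt (by simp)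
  have hxt : e.extend I x ∈ (e.extend I).target :=
    (e.extend I).map_source (by rwa [e.extend_source])
  have hopen : (e.extend I).target ∈ 𝓝 (e.extend I x) := e.isOpen_extend_target.mem_nhds hxt
  have hleft : (e.extend I).symm (e.extend I x) = x := e.extend_left_inv hx
  have h2 : MDifferentiableAt 𝓘(ℝ, E) I (e.extend I).symm (e.extend I x) := by
    have h3 := contMDiffOn_extend_symm (I := I) (n := ∞) he
    rw [← OpenPartialHomeomorph.extend_target'] at h3
    exact (h3.contMDiffAt hopen).mdifferentiableAt (by simp)
  have h1' : MDifferentiableAt I 𝓘(ℝ, E) (e.extend I) ((e.extend I).symm (e.extend I x)) := by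
    rwa [hleft]
  have h4 := mfderiv_comp (I := 𝓘(ℝ, E)) (I' := I) (I'' := 𝓘(ℝ, E)) (e.extend I x) h1' h2
  have h5 := mfderiv_comp (I := I) (I' := 𝓘(ℝ, E)) (I'' := I) x h2 h1
  have h6 : ((e.extend I) ∘ (e.extend I).symm) =ᶠ[𝓝 (e.extend I x)] id := by
    filter_upwards [hopen] with y hy using (e.extend I).right_inv hy
  have h7 : ((e.extend I).symm ∘ (e.extend I)) =ᶠ[𝓝 x] id := by
    filter_upwards [e.open_source.mem_nhds hx] with y hy using e.extend_left_inv hy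
  rw [h6.mfderiv_eq, mfderiv_id] at h4
  rw [h7.mfderiv_eq, mfderiv_id] at h5
  rw [hleft] at h4
  refine ⟨mfderiv 𝓘(ℝ, E) I (e.extend I).symm (e.extend I x), fun v => ?_, fun v => ?_⟩
  · exact (DFunLike.congr_fun h4 v).symm
  · exact (DFunLike.congr_fun h5 v).symm

theorem covectorOf_mem_puncturedCotangent [I.Boundaryless] {e : OpenPartialHomeomorph N H}
    (he : e ∈ IsManifold.maximalAtlas I ∞ N) {x : N} (hx : x ∈ e.source) (η : E →L[ℝ] ℝ) :
    covectorOf I e (x, η) ∈ puncturedCotangent I N ↔ η ≠ 0 := by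
  obtain ⟨D, hD, -⟩ := exists_mfderiv_extend_inverse he hx
  refine not_congr ⟨fun h => ?_, fun h => ?_⟩
  · ext v
    have h1 := DFunLike.congr_fun h (D v)
    have h2 : η (mfderiv I 𝓘(ℝ, E) (e.extend I) x (D v)) = 0 := h1
    rwa [hD] at h2
  · subst h
    exact ContinuousLinearMap.zero_comp _

theorem smul_covectorOf (e : OpenPartialHomeomorph N H) (x : N) (η : E →L[ℝ] ℝ) (t : ℝ) :
    covectorOf I e (x, t • η) =
      ⟨(covectorOf I e (x, η)).1, t • (covectorOf I e (x, η)).2⟩ := rfl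

theorem PhaseLocalizer.mem_footprint (c : PhaseLocalizer I N) (z : CotangentBundle I N) :
    z ∈ c.footprint ↔ ∃ x ∈ tsupport c.cutoff, ∃ η ∈ c.cone, η ≠ 0 ∧
      covectorOf I c.chart (x, η) = z := by
  constructor
  · rintro ⟨hz, η, hη, h0, h⟩
    refine ⟨z.1, hz, η, hη, h0, ?_⟩
    obtain ⟨x, ξ⟩ := z
    have : ξ = η.comp (mfderiv I 𝓘(ℝ, E) (c.chart.extend I) x) := by ext v; exact h v
    rw [this]; rfl
  · rintro ⟨x, hx, η, hη, h0, rfl⟩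
    exact ⟨hx, η, hη, h0, fun v => rfl⟩

theorem continuousAt_smul_cotangent {z : CotangentBundle I N} (t : ℝ) :
    ContinuousAt (fun z : CotangentBundle I N => (⟨z.1, t • z.2⟩ : CotangentBundle I N)) z := by
  have h := (continuousAt_cotangentBundle (I := I) (N := N) (f := id) (t₀ := z)).1 continuousAt_id
  exact continuousAt_cotangentBundle.2 ⟨h.1, h.2.const_smul t⟩

end Cotangent

/-! ### Cones over compact sets -/

/-- The cone with vertex `0` spanned by a set. -/
def rayCone {V : Type*} [AddCommGroup V] [Module ℝ V] (K : Set V) : Set V :=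
  {z | ∃ t : ℝ, 0 ≤ t ∧ ∃ y ∈ K, z = t • y}

/-- The closed condition `‖z‖ y = ‖y‖ z` eliminates the scalar, and projection along the compact `K`
is a closed map. The hypothesis `0 ∉ K` excludes the spurious solution `y = 0`. -/
theorem IsCompact.isClosed_rayCone {V : Type*} [NormedAddCommGroup V] [NormedSpace ℝ V] {K : Set V}
    (hK : IsCompact K) (h0 : (0 : V) ∉ K) : IsClosed (rayCone K) := by
  have h1 : rayCone K = Prod.snd '' {p : K × V | ‖p.2‖ • (p.1 : V) = ‖(p.1 : V)‖ • p.2} := by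
    ext z
    constructor
    · rintro ⟨t, ht, y, hy, rfl⟩
      refine ⟨(⟨y, hy⟩, t • y), ?_, rfl⟩
      simp only [mem_ofPred_eq, norm_smul, Real.norm_of_nonneg ht, smul_smul]
      rw [mul_comm]
    · rintro ⟨⟨⟨y, hy⟩, z⟩, h, rfl⟩
      have hy0 : ‖y‖ ≠ 0 := norm_ne_zero_iff.2 fun h => h0 (h ▸ hy)
      refine ⟨‖y‖⁻¹ * ‖z‖, by positivity, y, hy, ?_⟩
      have h' : ‖z‖ • y = ‖y‖ • z := h
      rw [mul_smul, h', smul_smul, inv_mul_cancel₀ hy0, one_smul]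
  rw [h1]
  have := isCompact_iff_compactSpace.1 hK
  refine isClosedMap_snd_of_compactSpace _ (isClosed_eq ?_ ?_) <;> fun_prop

theorem smul_mem_rayCone {V : Type*} [AddCommGroup V] [Module ℝ V] {K : Set V} {z : V}
    (hz : z ∈ rayCone K) {t : ℝ} (ht : 0 < t) : t • z ∈ rayCone K := by
  obtain ⟨s, hs, y, hy, rfl⟩ := hz
  exact ⟨t * s, by positivity, y, hy, (mul_smul _ _ _).symm⟩

section Localization

variable {E : Type*} [NormedAddCommGroup E] [NormedSpace ℝ E]
  {H : Type*} [TopologicalSpace H] {I : ModelWithCorners ℝ E H}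
  {N : Type*} [TopologicalSpace N] [ChartedSpace H N] [IsManifold I ∞ N]

/-! ### Rapid decrease away from the wave front set -/

namespace PhaseLocalizer

/-- Replacement of the cone of frequencies. -/
def withCone (c : PhaseLocalizer I N) (V : Set (E →L[ℝ] ℝ)) (hV : IsClosed V)
    (hV' : ∀ η ∈ V, ∀ t : ℝ, 0 < t → t • η ∈ V) : PhaseLocalizer I N :=
  { c with cone := V, isClosed_cone := hV, smul_mem_cone := hV' }

theorem support_real_smul_subset_right (ψ : N → ℝ) (f : N → ℂ) :
    Function.support (fun x => ψ x • f x) ⊆ Function.support f :=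
  fun x hx h => hx (show ψ x • f x = 0 by rw [h, smul_zero])

/-- Multiplication of the cutoff with a smooth real function. -/
noncomputable def smulCutoff (c : PhaseLocalizer I N) (ψ : N → ℝ) (hψ : ContMDiff I 𝓘(ℝ) ∞ ψ) :
    PhaseLocalizer I N :=
  { c with
    cutoff := fun x => ψ x • c.cutoff x
    smooth := hψ.smul c.smooth
    hasCompactSupport := c.hasCompactSupport.mono (support_real_smul_subset_right ψ c.cutoff)
    tsupport_subset := (closure_mono (support_real_smul_subset_right ψ c.cutoff)).trans
      c.tsupport_subset }

theorem tsupport_smulCutoff_subset (c : PhaseLocalizer I N) (ψ : N → ℝ)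
    (hψ : ContMDiff I 𝓘(ℝ) ∞ ψ) : tsupport (c.smulCutoff ψ hψ).cutoff ⊆ tsupport ψ :=
  closure_mono (fun x hx h => hx (show ψ x • c.cutoff x = 0 by rw [h, zero_smul]))

/-- Rapid decrease on the cone spanned by `S`. -/
def DecreasingOn (c : PhaseLocalizer I N) (u : Module.Dual ℂ (smoothFunctions I N))
    (S : Set (E →L[ℝ] ℝ)) : Prop :=
  ∀ n : ℕ, ∃ C : ℝ, ∀ η ∈ rayCone S, (1 + ‖η‖) ^ n * ‖c.fourier u η‖ ≤ C

theorem DecreasingOn.union {c : PhaseLocalizer I N} {u : Module.Dual ℂ (smoothFunctions I N)}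
    {S S' : Set (E →L[ℝ] ℝ)} (h : c.DecreasingOn u S) (h' : c.DecreasingOn u S') :
    c.DecreasingOn u (S ∪ S') := fun n => by
  obtain ⟨C, hC⟩ := h n
  obtain ⟨C', hC'⟩ := h' n
  refine ⟨max C C', ?_⟩
  rintro η ⟨t, ht, y, hy | hy, rfl⟩
  · exact (hC _ ⟨t, ht, y, hy, rfl⟩).trans (le_max_left _ _)
  · exact (hC' _ ⟨t, ht, y, hy, rfl⟩).trans (le_max_right _ _)

theorem DecreasingOn.mono {c : PhaseLocalizer I N} {u : Module.Dual ℂ (smoothFunctions I N)}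
    {S S' : Set (E →L[ℝ] ℝ)} (h : c.DecreasingOn u S') (hS : S ⊆ S') :
    c.DecreasingOn u S := fun n => by
  obtain ⟨C, hC⟩ := h n
  refine ⟨C, ?_⟩
  rintro η ⟨t, ht, y, hy, rfl⟩
  exact hC _ ⟨t, ht, y, hS hy, rfl⟩

theorem exists_ball_subset {W : Set (CotangentBundle I N)} (hW : IsOpen W)
    {e : OpenPartialHomeomorph N H} (he : e ∈ IsManifold.maximalAtlas I ∞ N)
    {x : N} (hx : x ∈ e.source) {η : E →L[ℝ] ℝ} (hη : covectorOf I e (x, η) ∈ W) :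
    ∃ A : Set N, IsOpen A ∧ x ∈ A ∧ ∃ δ > 0, ∀ y ∈ A, ∀ ξ ∈ Metric.closedBall η δ,
      covectorOf I e (y, ξ) ∈ W := by
  have h1 := (continuousAt_covectorOf he (p := (x, η)) hx).preimage_mem_nhds (hW.mem_nhds hη)
  obtain ⟨A, hA, B, hB, hAB⟩ := mem_nhds_prod_iff.1 h1
  obtain ⟨A', hA', hA'o, hxA'⟩ := mem_nhds_iff.1 hA
  obtain ⟨δ, hδ, hδB⟩ := Metric.nhds_basis_closedBall.mem_iff.1 hB
  exact ⟨A', hA'o, hxA', δ, hδ, fun y hy ξ hξ => hAB ⟨hA' hy, hδB hξ⟩⟩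

variable [FiniteDimensional ℝ E]

/-- Microlocal smoothness gives decrease only for small footprints. Compactness of the unit
directions in the cone yields, near each base point, all directions at once; a partition of unity
over the compact support of the cutoff then adds up the pieces. -/
theorem rapidlyDecreasing_of_microlocallySmoothAt [T2Space N] [SigmaCompactSpace N]
    (c : PhaseLocalizer I N) {u : Module.Dual ℂ (smoothFunctions I N)}
    (hc : ∀ z ∈ c.footprint, MicrolocallySmoothAt u z) : c.RapidlyDecreasing u := by
  classical
  let K : Set (E →L[ℝ] ℝ) := c.cone ∩ Metric.sphere 0 1
  have hK : IsCompact K := (isCompact_sphere 0 1).inter_left c.isClosed_cone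
  have hK0 : ∀ η ∈ K, η ≠ 0 := fun η hη h => by
    have := hη.2
    rw [h] at this
    simp at this
  have hloc : ∀ x ∈ tsupport c.cutoff, ∃ A : Set N, IsOpen A ∧ x ∈ A ∧
      ∀ (ψ : N → ℝ) (hψ : ContMDiff I 𝓘(ℝ) ∞ ψ), tsupport ψ ⊆ A →
        (c.smulCutoff ψ hψ).DecreasingOn u K := by
    intro x hx
    refine hK.induction_on (p := fun S => ∃ A : Set N, IsOpen A ∧ x ∈ A ∧
      ∀ (ψ : N → ℝ) (hψ : ContMDiff I 𝓘(ℝ) ∞ ψ), tsupport ψ ⊆ A →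
        (c.smulCutoff ψ hψ).DecreasingOn u S) ?_ ?_ ?_ ?_
    · refine ⟨univ, isOpen_univ, mem_univ _, fun ψ hψ _ n => ⟨0, ?_⟩⟩
      rintro η ⟨t, ht, y, hy, rfl⟩
      exact absurd hy (notMem_empty _)
    · rintro S S' hS ⟨A, hA, hxA, h⟩
      exact ⟨A, hA, hxA, fun ψ hψ hψA => (h ψ hψ hψA).mono hS⟩
    · rintro S S' ⟨A, hA, hxA, h⟩ ⟨A', hA', hxA', h'⟩
      exact ⟨A ∩ A', hA.inter hA', ⟨hxA, hxA'⟩, fun ψ hψ hψA =>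
        (h ψ hψ (hψA.trans inter_subset_left)).union (h' ψ hψ (hψA.trans inter_subset_right))⟩
    · intro η hη
      obtain ⟨W, hWo, hWc, hzW, hW⟩ := hc (covectorOf I c.chart (x, η))
        ((c.mem_footprint _).2 ⟨x, hx, η, hη.1, hK0 η hη, rfl⟩)
      obtain ⟨A, hA, hxA, δ, hδ, hAW⟩ := exists_ball_subset hWo c.chart_mem
        (c.tsupport_subset hx) hzW
      refine ⟨K ∩ Metric.closedBall η δ, inter_mem_nhdsWithin _ (Metric.closedBall_mem_nhds _ hδ),
        A, hA, hxA, fun ψ hψ hψA => ?_⟩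
      have hKδ : IsCompact (K ∩ Metric.closedBall η δ) := hK.inter_right Metric.isClosed_closedBall
      let c' := (c.smulCutoff ψ hψ).withCone (rayCone (K ∩ Metric.closedBall η δ))
        (hKδ.isClosed_rayCone fun h => hK0 0 h.1 rfl) fun η hη t ht => smul_mem_rayCone hη ht
      refine hW c' fun z hz => ?_
      obtain ⟨y, hy, ξ, ⟨t, ht, ζ, hζ, rfl⟩, h0, rfl⟩ := (c'.mem_footprint z).1 hz
      have ht0 : 0 < t := lt_of_le_of_ne ht fun h => h0 (by rw [← h, zero_smul])
      rw [smul_covectorOf]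
      exact hWc _ (hAW y (hψA (c.tsupport_smulCutoff_subset ψ hψ hy)) ζ hζ.2) t ht0
  choose! A hA hxA hAψ using hloc
  obtain ⟨T, hTs, hT⟩ := c.hasCompactSupport.elim_nhds_subcover A
    fun x hx => (hA x hx).mem_nhds (hxA x hx)
  have hcov : tsupport c.cutoff ⊆ ⋃ i : T, A i.1 := fun x hx => by
    obtain ⟨i, hi, hxi⟩ := mem_iUnion₂.1 (hT hx)
    exact mem_iUnion.2 ⟨⟨i, hi⟩, hxi⟩
  obtain ⟨f, hf⟩ := SmoothPartitionOfUnity.exists_isSubordinate I (isClosed_tsupport c.cutoff)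
    (fun i : T => A i.1) (fun i => hA i.1 (hTs _ i.2)) hcov
  have hsum : ∀ η, c.fourier u η = ∑ i : T, (c.smulCutoff (f i) (f i).contMDiff).fourier u η := by
    intro η
    have hw : c.wave η = ∑ i : T, (c.smulCutoff (f i) (f i).contMDiff).wave η := by
      ext x
      have h1 : (∑ i : T, (c.smulCutoff (f i) (f i).contMDiff).wave η).1 x =
          ∑ i : T, ((c.smulCutoff (f i) (f i).contMDiff).wave η).1 x := by
        rw [AddSubmonoidClass.coe_finsetSum, Finset.sum_apply]
      rw [h1]
      change c.cutoff x * _ = ∑ i : T, (f i x • c.cutoff x) *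
        Complex.exp (-Complex.I * (η (c.chart.extend I x) : ℂ))
      rw [← Finset.sum_mul, ← Finset.sum_smul]
      by_cases hx : x ∈ tsupport c.cutoff
      · have h2 := f.sum_eq_one hx
        rw [finsum_eq_sum_of_fintype] at h2
        rw [h2, one_smul]
      · rw [image_eq_zero_of_notMem_tsupport hx, smul_zero]
    simp only [fourier, hw, map_sum]
  intro n
  have hAψ' : ∀ i : T, (c.smulCutoff (f i) (f i).contMDiff).DecreasingOn u K := fun i =>
    hAψ i.1 (hTs _ i.2) (f i) (f i).contMDiff (hf i)
  choose C hC using fun i => hAψ' i n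
  -- The vertex `η = 0` has no direction on the sphere and is bounded separately.
  refine ⟨max (∑ i, C i) ((1 + ‖(0 : E →L[ℝ] ℝ)‖) ^ n * ‖c.fourier u 0‖), fun η hη => ?_⟩
  by_cases h0 : η = 0
  · subst h0
    exact le_max_right _ _
  · refine le_trans ?_ (le_max_left _ _)
    have hmem : η ∈ rayCone K := by
      have hn : ‖η‖ ≠ 0 := norm_ne_zero_iff.2 h0
      refine ⟨‖η‖, norm_nonneg _, ‖η‖⁻¹ • η, ⟨c.smul_mem_cone η hη _ (by positivity), ?_⟩, ?_⟩
      · rw [mem_sphere_zero_iff_norm, norm_smul, norm_inv, norm_norm, inv_mul_cancel₀ hn]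
      · rw [smul_smul, mul_inv_cancel₀ hn, one_smul]
    rw [hsum]
    calc (1 + ‖η‖) ^ n * ‖∑ i : T, (c.smulCutoff (f i) (f i).contMDiff).fourier u η‖
        ≤ (1 + ‖η‖) ^ n * ∑ i : T, ‖(c.smulCutoff (f i) (f i).contMDiff).fourier u η‖ :=
          mul_le_mul_of_nonneg_left (norm_sum_le _ _) (by positivity)
      _ ≤ ∑ i, C i := by
          rw [Finset.mul_sum]
          exact Finset.sum_le_sum fun i _ => hC i η hmem

/-- The rapid decrease of the Fourier transform away from the wave front set. -/
theorem rapidlyDecreasing_of_mem [I.Boundaryless] [T2Space N] [SigmaCompactSpace N] (c : PhaseLocalizer I N)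
    {Γ : Set (CotangentBundle I N)} (hc : Disjoint c.footprint Γ)
    {u : Module.Dual ℂ (smoothFunctions I N)} (hu : u ∈ distributionsWF Γ) :
    c.RapidlyDecreasing u := by
  refine c.rapidlyDecreasing_of_microlocallySmoothAt fun z hz => ?_
  by_contra h
  refine Set.disjoint_left.1 hc hz (hu.2 ⟨?_, h⟩)
  obtain ⟨x, hx, η, hη, h0, rfl⟩ := (c.mem_footprint z).1 hz
  exact (covectorOf_mem_puncturedCotangent c.chart_mem (c.tsupport_subset hx) η).2 h0

/-! ### The seminorms of the Hörmander topology -/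

/-- The seminorm `u ↦ sup_{η ∈ V} (1 + |η|)^n |(χ u)^(η)|`. -/
noncomputable def fourierSeminorm (c : PhaseLocalizer I N) (n : ℕ)
    (F : Submodule ℂ (Module.Dual ℂ (smoothFunctions I N)))
    (h : ∀ u ∈ F, c.RapidlyDecreasing u) : Seminorm ℂ F :=
  have hb : ∀ u : F, BddAbove (range fun η : c.cone => (1 + ‖η.1‖) ^ n * ‖c.fourier u.1 η‖) :=
    fun u => by
      obtain ⟨C, hC⟩ := h u.1 u.2 n
      exact ⟨C, by rintro _ ⟨η, rfl⟩; exact hC η.1 η.2⟩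
  Seminorm.of (fun u => ⨆ η : c.cone, (1 + ‖η.1‖) ^ n * ‖c.fourier u.1 η‖)
    (fun u v => by
      refine Real.iSup_le (fun η => ?_) (add_nonneg
        (Real.iSup_nonneg fun _ => by positivity) (Real.iSup_nonneg fun _ => by positivity))
      refine le_trans ?_ (add_le_add (le_ciSup (hb u) η) (le_ciSup (hb v) η))
      rw [← mul_add]
      exact mul_le_mul_of_nonneg_left (norm_add_le _ _) (by positivity))
    (fun a u => by
      rw [Real.mul_iSup_of_nonneg (norm_nonneg _)]
      congr 1
      ext η
      have : c.fourier (a • u : F).1 η.1 = a * c.fourier u.1 η.1 := rfl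
      rw [this, norm_mul]
      ring)

variable {c : PhaseLocalizer I N} {n : ℕ}
    {F : Submodule ℂ (Module.Dual ℂ (smoothFunctions I N))}
    {h : ∀ u ∈ F, c.RapidlyDecreasing u}

theorem le_fourierSeminorm (u : F) {η : E →L[ℝ] ℝ} (hη : η ∈ c.cone) :
    (1 + ‖η‖) ^ n * ‖c.fourier u.1 η‖ ≤ c.fourierSeminorm n F h u := by
  have hb : BddAbove (range fun η : c.cone => (1 + ‖η.1‖) ^ n * ‖c.fourier u.1 η‖) := by
    obtain ⟨C, hC⟩ := h u.1 u.2 n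
    exact ⟨C, by rintro _ ⟨η, rfl⟩; exact hC η.1 η.2⟩
  exact le_ciSup hb (⟨η, hη⟩ : c.cone)

theorem fourierSeminorm_le {u : F} {C : ℝ} (hC : 0 ≤ C)
    (hu : ∀ η ∈ c.cone, (1 + ‖η‖) ^ n * ‖c.fourier u.1 η‖ ≤ C) :
    c.fourierSeminorm n F h u ≤ C :=
  Real.iSup_le (fun η => hu η.1 η.2) hC

end PhaseLocalizer

variable [FiniteDimensional ℝ E] [I.Boundaryless] [T2Space N] [SigmaCompactSpace N]

/-- The seminorms that define the Hörmander topology. -/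
noncomputable def hormanderSeminorms (Γ : Set (CotangentBundle I N)) :
    SeminormFamily ℂ (distributionsWF Γ)
      (smoothFunctions I N ⊕ {c : PhaseLocalizer I N // Disjoint c.footprint Γ} × ℕ) :=
  Sum.elim
    (fun f => (normSeminorm ℂ ℂ).comp ((Module.Dual.eval ℂ _ f).comp (Submodule.subtype _)))
    (fun i => i.1.1.fourierSeminorm i.2 _ fun _ hu => i.1.1.rapidlyDecreasing_of_mem i.1.2 hu)

theorem isTopologicalAddGroup_hormanderTopology (Γ : Set (CotangentBundle I N)) :
    @IsTopologicalAddGroup (distributionsWF Γ) (hormanderTopology Γ) _ := by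
  refine topologicalAddGroup_inf ?_ ?_
  · refine topologicalAddGroup_iInf fun f => ?_
    exact topologicalAddGroup_induced ((Module.Dual.eval ℂ _ f).comp (Submodule.subtype _))
  · refine topologicalAddGroup_iInf fun c => topologicalAddGroup_iInf fun n => ?_
    let L : distributionsWF Γ →+ UniformFun c.1.cone ℂ :=
      { toFun := fun u => UniformFun.ofFun
          (fun η : c.1.cone => (((1 + ‖(η : E →L[ℝ] ℝ)‖) ^ n : ℝ) : ℂ) * c.1.fourier u.1 η)
        map_zero' := by
          funext η
          change _ * (0 : ℂ) = 0
          rw [mul_zero]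
        map_add' := fun u v => by
          funext η
          exact mul_add _ _ _ }
    exact topologicalAddGroup_induced L

theorem nhds_zero_hormanderTopology (Γ : Set (CotangentBundle I N)) :
    @nhds (distributionsWF Γ) (hormanderTopology Γ) 0 =
      ⨅ i, comap (hormanderSeminorms Γ i) (𝓝 0) := by
  rw [iInf_sum, iInf_prod]
  unfold hormanderTopology
  rw [nhds_inf, nhds_iInf, nhds_iInf]
  congr 1
  · refine iInf_congr fun f => ?_
    rw [nhds_induced]
    change comap (fun u : distributionsWF Γ => u.1 f) (𝓝 0) =
      comap (norm ∘ fun u : distributionsWF Γ => u.1 f) (𝓝 0)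
    rw [← comap_comap, comap_norm_nhds_zero]
  · refine iInf_congr fun c => ?_
    rw [nhds_iInf]
    refine iInf_congr fun n => ?_
    rw [nhds_induced]
    have h0 : (UniformFun.ofFun fun η : c.1.cone => (((1 + ‖(η : E →L[ℝ] ℝ)‖) ^ n : ℝ) : ℂ) *
        c.1.fourier (0 : distributionsWF Γ).1 η) = 0 := by
      funext η
      change _ * (0 : ℂ) = 0
      rw [mul_zero]
    rw [h0]
    have h1 := ((UniformFun.hasBasis_nhds_zero_of_basis (α := c.1.cone)
      (Metric.nhds_basis_ball (x := (0 : ℂ)))).comap fun u : distributionsWF Γ =>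
        UniformFun.ofFun fun η : c.1.cone => (((1 + ‖(η : E →L[ℝ] ℝ)‖) ^ n : ℝ) : ℂ) *
          c.1.fourier u.1 η)
    have h2 := (Metric.nhds_basis_ball (x := (0 : ℝ))).comap
      (hormanderSeminorms Γ (Sum.inr (c, n)))
    have h3 : ∀ (u : distributionsWF Γ) (η : c.1.cone),
        ‖(((1 + ‖(η : E →L[ℝ] ℝ)‖) ^ n : ℝ) : ℂ) * c.1.fourier u.1 η‖ =
          (1 + ‖(η : E →L[ℝ] ℝ)‖) ^ n * ‖c.1.fourier u.1 η‖ := fun u η => by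
      rw [norm_mul, Complex.norm_real, Real.norm_of_nonneg (by positivity)]
    -- A neighbourhood for uniform convergence gives strict bounds at each `η`, the seminorm is
    -- their supremum; hence the loss `ε / 2` in one direction.
    refine h1.ext h2 (fun ε hε => ⟨ε, hε, fun u hu η => ?_⟩)
      (fun ε hε => ⟨ε / 2, half_pos hε, fun u hu => ?_⟩)
    · have hu' : ‖hormanderSeminorms Γ (Sum.inr (c, n)) u‖ < ε := mem_ball_zero_iff.1 hu
      rw [mem_ball_zero_iff]
      change ‖(((1 + ‖(η : E →L[ℝ] ℝ)‖) ^ n : ℝ) : ℂ) * c.1.fourier u.1 η‖ < ε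
      rw [h3]
      refine lt_of_le_of_lt ?_ ((le_abs_self _).trans_lt hu')
      exact PhaseLocalizer.le_fourierSeminorm
        (h := fun _ hu => c.1.rapidlyDecreasing_of_mem c.2 hu) u η.2
    · rw [mem_preimage, mem_ball_zero_iff, Real.norm_of_nonneg (apply_nonneg _ _)]
      refine lt_of_le_of_lt (PhaseLocalizer.fourierSeminorm_le
        (h := fun _ hu => c.1.rapidlyDecreasing_of_mem c.2 hu) (half_pos hε).le fun η hη => ?_)
        (half_lt_self hε)
      have := mem_ball_zero_iff.1 (hu ⟨η, hη⟩)
      change ‖(((1 + ‖η‖) ^ n : ℝ) : ℂ) * c.1.fourier u.1 η‖ < ε / 2 at this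
      rw [h3 u ⟨η, hη⟩] at this
      exact this.le

theorem withSeminorms_hormanderTopology (Γ : Set (CotangentBundle I N)) :
    WithSeminorms (topology := hormanderTopology Γ) (hormanderSeminorms Γ) := by
  let t := hormanderTopology Γ
  have := isTopologicalAddGroup_hormanderTopology Γ
  rw [SeminormFamily.withSeminorms_iff_nhds_eq_iInf]
  exact nhds_zero_hormanderTopology Γ

theorem isLocallyConvexTopology_hormanderTopology (Γ : Set (CotangentBundle I N)) :
    IsLocallyConvexTopology (hormanderTopology Γ) :=
  isLocallyConvexTopology_of_withSeminorms (withSeminorms_hormanderTopology Γ)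

end Localization

/-! ### A Sobolev inequality on cubes -/

section Sobolev

open MeasureTheory

/-- Write `f a = f r - ∫_a^r f'` and average over `r` in an interval of length one. -/
theorem enorm_le_lintegral_add_deriv {f f' : ℝ → ℂ} (hf : ∀ r, HasDerivAt f (f' r) r)
    (hf' : Continuous f') (a : ℝ) :
    ‖f a‖ₑ ≤ ∫⁻ r in Icc a (a + 1), ‖f r‖ₑ + ‖f' r‖ₑ := by
  have hfc : Continuous f := continuous_iff_continuousAt.2 fun r => (hf r).continuousAt
  have hv : volume (Icc a (a + 1)) = 1 := by simp
  have h1 : ∀ r ∈ Icc a (a + 1), ‖f a‖ₑ ≤ ‖f r‖ₑ + ∫⁻ r in Icc a (a + 1), ‖f' r‖ₑ := by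
    intro r hr
    have h2 : ∫ x in a..r, f' x = f r - f a :=
      intervalIntegral.integral_eq_sub_of_hasDerivAt (fun x _ => hf x)
        (hf'.intervalIntegrable _ _)
    have h3 : f a = f r - ∫ x in a..r, f' x := by rw [h2]; abel
    calc ‖f a‖ₑ ≤ ‖f r‖ₑ + ‖∫ x in a..r, f' x‖ₑ := by
          conv_lhs => rw [h3]
          exact enorm_sub_le
      _ ≤ _ := by
          gcongr
          rw [intervalIntegral.integral_of_le hr.1]
          refine (enorm_integral_le_lintegral_enorm _).trans ?_
          exact lintegral_mono_set fun x hx => ⟨hx.1.le, hx.2.trans hr.2⟩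
  calc ‖f a‖ₑ = ∫⁻ _ in Icc a (a + 1), ‖f a‖ₑ := by
        rw [setLIntegral_const, hv, mul_one]
    _ ≤ ∫⁻ r in Icc a (a + 1), (‖f r‖ₑ + ∫⁻ r in Icc a (a + 1), ‖f' r‖ₑ) :=
        setLIntegral_mono' measurableSet_Icc h1
    _ = _ := by
        rw [lintegral_add_left hfc.enorm.measurable, setLIntegral_const, hv, mul_one,
          lintegral_add_left hfc.enorm.measurable]

variable {n : ℕ}

/-- `F S` stands for the mixed derivative in the variables of `S`. The one-variable bound in a new
variable `i` leads to the families `S ↦ F S` and `S ↦ F (insert i S)`; the induction hypothesis is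
needed for both, so `F` is quantified after `s`. -/
theorem enorm_le_sum_lmarginal (t : Fin n → ℝ) (s : Finset (Fin n)) :
    ∀ (F : Finset (Fin n) → (Fin n → ℝ) → ℂ), (∀ S, Continuous (F S)) →
      (∀ S, ∀ i ∈ s, i ∉ S → ∀ x r, HasDerivAt (fun r => F S (Function.update x i r))
        (F (insert i S) (Function.update x i r)) r) →
      ∀ x : Fin n → ℝ, (∀ i ∈ s, x i = t i) →
        ‖F ∅ x‖ₑ ≤ ∑ S ∈ s.powerset,
          (∫⋯∫⁻_s, (fun y => ‖F S y‖ₑ) ∂fun i => volume.restrict (Icc (t i) (t i + 1))) x := by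
  induction s using Finset.induction_on with
  | empty => intro F _ _ x _; simp
  | insert i s hi ih =>
    intro F hF hd x hx
    have hmeas : ∀ S, Measurable fun y => ‖F S y‖ₑ := fun S => (hF S).enorm.measurable
    have hupd : Continuous fun r : ℝ => Function.update x i r :=
      continuous_const.update i continuous_id
    have h1 := enorm_le_lintegral_add_deriv (f := fun r => F ∅ (Function.update x i r))
      (f' := fun r => F (insert i ∅) (Function.update x i r))
      (fun r => hd ∅ i (Finset.mem_insert_self _ _) (Finset.notMem_empty _) x r)
      ((hF _).comp hupd) (t i)
    have h0 : Function.update x i (t i) = x := by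
      rw [← hx i (Finset.mem_insert_self _ _), Function.update_eq_self]
    simp only [h0] at h1
    have hxr : ∀ r, ∀ j ∈ s, Function.update x i r j = t j := fun r j hj => by
      have hji : j ≠ i := fun h => hi (h ▸ hj)
      rw [Function.update_of_ne hji, hx j (Finset.mem_insert_of_mem hj)]
    have h2 : ∀ r, ‖F ∅ (Function.update x i r)‖ₑ ≤ _ := fun r =>
      ih F hF (fun S j hj hjS => hd S j (Finset.mem_insert_of_mem hj) hjS)
        (Function.update x i r) (hxr r)
    have h3 : ∀ r, ‖F (insert i ∅) (Function.update x i r)‖ₑ ≤ _ := fun r =>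
      ih (fun S => F (insert i S)) (fun S => hF _) (fun S j hj hjS y r => by
        have h := hd (insert i S) j (Finset.mem_insert_of_mem hj) (by
          rw [Finset.mem_insert, not_or]
          exact ⟨fun h => hi (h ▸ hj), hjS⟩) y r
        rwa [Finset.insert_comm] at h) (Function.update x i r) (hxr r)
    have hmu : Measurable fun r : ℝ => Function.update x i r := hupd.measurable
    refine h1.trans ((lintegral_mono fun r => add_le_add (h2 r) (h3 r)).trans (le_of_eq ?_))
    rw [lintegral_add_left, lintegral_finsetSum, lintegral_finsetSum,
      Finset.sum_powerset_insert hi]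
    · congr 1
      · refine Finset.sum_congr rfl fun S _ => ?_
        rw [lmarginal_insert _ (hmeas S) hi]
      · refine Finset.sum_congr rfl fun S _ => ?_
        rw [lmarginal_insert _ (hmeas _) hi]
    · exact fun S _ => (Measurable.lmarginal _ (hmeas _)).comp hmu
    · exact fun S _ => (Measurable.lmarginal _ (hmeas _)).comp hmu
    · exact Finset.measurable_sum _ fun S _ => (Measurable.lmarginal _ (hmeas S)).comp hmu

/-- The value of a function at the lowest vertex of a unit cube is bounded by the integrals over
the cube of its mixed derivatives. -/
theorem enorm_le_sum_lintegral_cube (F : Finset (Fin n) → (Fin n → ℝ) → ℂ)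
    (hF : ∀ S, Continuous (F S))
    (hd : ∀ S, ∀ i, i ∉ S → ∀ x r, HasDerivAt (fun r => F S (Function.update x i r))
        (F (insert i S) (Function.update x i r)) r) (t : Fin n → ℝ) :
    ‖F ∅ t‖ₑ ≤ ∑ S, ∫⁻ y in Icc t (t + 1), ‖F S y‖ₑ := by
  have h := enorm_le_sum_lmarginal t Finset.univ F hF (fun S i _ => hd S i) t fun _ _ => rfl
  rw [Finset.powerset_univ] at h
  refine h.trans (le_of_eq (Finset.sum_congr rfl fun S _ => ?_))
  simp only [lmarginal_univ]
  rw [← Measure.restrict_pi_pi, ← pi_univ_Icc t (t + 1)]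
  rfl

end Sobolev

/-! ### Summability of the seminorms of the Hörmander topology -/

section HormanderNuclear

open MeasureTheory

variable {E : Type*} [NormedAddCommGroup E] [NormedSpace ℝ E]
  {H : Type*} [TopologicalSpace H] {I : ModelWithCorners ℝ E H}
  {N : Type*} [TopologicalSpace N] [ChartedSpace H N] [IsManifold I ∞ N]

/-- The linear map `t ↦ ∑ t_i a_i`. -/
noncomputable def combinationMap {V : Type*} [NormedAddCommGroup V] [NormedSpace ℝ V] {n : ℕ}
    (a : Fin n → V) : (Fin n → ℝ) →L[ℝ] V :=
  ∑ i, (ContinuousLinearMap.proj i : (Fin n → ℝ) →L[ℝ] ℝ).smulRight (a i)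

theorem combinationMap_apply {V : Type*} [NormedAddCommGroup V] [NormedSpace ℝ V] {n : ℕ}
    (a : Fin n → V) (t : Fin n → ℝ) : combinationMap a t = ∑ i, t i • a i := by
  simp [combinationMap]

theorem combinationMap_update {V : Type*} [NormedAddCommGroup V] [NormedSpace ℝ V] {n : ℕ}
    (a : Fin n → V) (t : Fin n → ℝ) (i : Fin n) (r : ℝ) :
    combinationMap a (Function.update t i r) =
      combinationMap a (Function.update t i 0) + r • a i := by
  have h : Function.update t i r = Function.update t i 0 + Pi.single i r := by
    ext j
    by_cases hj : j = i
    · subst hj; simp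
    · simp [hj]
  rw [h, map_add]
  congr 1
  rw [combinationMap_apply, Finset.sum_eq_single i]
  · simp
  · intro j _ hj; simp [hj]
  · simp

namespace PhaseLocalizer

/-- The localizer whose cutoff is multiplied with the coordinates `-i a_j`, `j ∈ S`. -/
noncomputable def mulCoords (c : PhaseLocalizer I N) {n : ℕ} (a : Fin n → E →L[ℝ] ℝ)
    (S : Finset (Fin n)) : PhaseLocalizer I N :=
  c.mulCutoff (fun y => ∏ j ∈ S, negICoord (a j) y)
    (contDiff_prod fun j _ => contDiff_negICoord (a j))

theorem fourier_mulCoords_empty (c : PhaseLocalizer I N) {n : ℕ} (a : Fin n → E →L[ℝ] ℝ)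
    (u : Module.Dual ℂ (smoothFunctions I N)) (η : E →L[ℝ] ℝ) :
    (c.mulCoords a ∅).fourier u η = c.fourier u η := by
  have : (c.mulCoords a ∅).wave η = c.wave η := by
    ext x
    change c.cutoff x * (∏ j ∈ (∅ : Finset (Fin n)), negICoord (a j) (c.chart.extend I x)) * _ =
      c.cutoff x * _
    rw [Finset.prod_empty, mul_one]
    rfl
  simp only [fourier, this]

theorem fourier_mulCoords_insert (c : PhaseLocalizer I N) {n : ℕ} (a : Fin n → E →L[ℝ] ℝ)
    {S : Finset (Fin n)} {i : Fin n} (hi : i ∉ S)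
    (u : Module.Dual ℂ (smoothFunctions I N)) (η : E →L[ℝ] ℝ) :
    (c.mulCoords a (insert i S)).fourier u η =
      ((c.mulCoords a S).mulCutoff (negICoord (a i)) (contDiff_negICoord (a i))).fourier u η := by
  have : (c.mulCoords a (insert i S)).wave η =
      ((c.mulCoords a S).mulCutoff (negICoord (a i)) (contDiff_negICoord (a i))).wave η := by
    ext x
    change c.cutoff x * (∏ j ∈ insert i S, negICoord (a j) (c.chart.extend I x)) *
        Complex.exp (-Complex.I * (η (c.chart.extend I x) : ℂ)) =
      c.cutoff x * (∏ j ∈ S, negICoord (a j) (c.chart.extend I x)) *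
        negICoord (a i) (c.chart.extend I x) *
        Complex.exp (-Complex.I * (η (c.chart.extend I x) : ℂ))
    rw [Finset.prod_insert hi]
    ring
  simp only [fourier, this]

theorem hasDerivAt_fourier_mulCoords [I.Boundaryless] (c : PhaseLocalizer I N) {n : ℕ}
    (a : Fin n → E →L[ℝ] ℝ) {S : Finset (Fin n)} {i : Fin n} (hi : i ∉ S)
    {u : Module.Dual ℂ (smoothFunctions I N)} (hu : IsCompactDistribution I N u)
    (x : Fin n → ℝ) (r : ℝ) :
    HasDerivAt (fun r => (c.mulCoords a S).fourier u (combinationMap a (Function.update x i r)))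
      ((c.mulCoords a (insert i S)).fourier u (combinationMap a (Function.update x i r))) r := by
  have h : (fun r => combinationMap a (Function.update x i r)) =
      fun r => combinationMap a (Function.update x i 0) + r • a i :=
    funext fun r => combinationMap_update a x i r
  rw [fourier_mulCoords_insert c a hi, congrFun h r]
  refine ((c.mulCoords a S).hasDerivAt_fourier hu _ _ r).congr_of_eventuallyEq
    (Eventually.of_forall fun r => ?_)
  exact congrArg _ (congrFun h r)

end PhaseLocalizer

/-- The weights at the lowest vertex and at any point of a unit cube are comparable, so the weight
can be moved under the integral. -/
theorem one_add_norm_le_mul {V : Type*} [NormedAddCommGroup V] [NormedSpace ℝ V] {n : ℕ}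
    (A : (Fin n → ℝ) →L[ℝ] V) {t y : Fin n → ℝ} (hy : y ∈ Icc t (t + 1)) :
    1 + ‖A t‖ ≤ (1 + ‖A‖) * (1 + ‖A y‖) := by
  have h1 : ‖t - y‖ ≤ 1 := by
    rw [pi_norm_le_iff_of_nonneg zero_le_one]
    intro i
    have h2 := hy.1 i
    have h3 := hy.2 i
    simp only [Pi.add_apply, Pi.one_apply] at h3
    rw [Pi.sub_apply, Real.norm_eq_abs, abs_le]
    constructor <;> linarith
  have h4 : ‖A t‖ ≤ ‖A y‖ + ‖A‖ := by
    have h5 : A t = A y + A (t - y) := by rw [← map_add]; congr 1; abel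
    rw [h5]
    refine (norm_add_le _ _).trans (add_le_add_right ?_ _)
    refine (A.le_opNorm _).trans ?_
    exact mul_le_of_le_one_right (norm_nonneg _) h1
  nlinarith [norm_nonneg (A y), norm_nonneg A, mul_nonneg (norm_nonneg A) (norm_nonneg (A y))]

/-- The squared exponent `-2 (n + 1)` lies below `-n`. -/
theorem memLp_one_add_norm_rpow (n : ℕ) (K : ℝ) (μ : Measure (Fin n → ℝ)) (hμ : μ ≤ volume) :
    MemLp (fun y : Fin n → ℝ => K * (1 + ‖y‖) ^ (-((n : ℝ) + 1))) 2 μ := by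
  have h0 : ∀ y : Fin n → ℝ, 0 < 1 + ‖y‖ := fun y => by positivity
  have hc : Continuous fun y : Fin n → ℝ => K * (1 + ‖y‖) ^ (-((n : ℝ) + 1)) :=
    continuous_const.mul ((continuous_const.add continuous_norm).rpow_const
      fun y => Or.inl (h0 y).ne')
  refine MemLp.mono_measure hμ ((memLp_two_iff_integrable_sq hc.aestronglyMeasurable).2 ?_)
  have h1 : Integrable (fun y : Fin n → ℝ => (1 + ‖y‖) ^ (-(2 * ((n : ℝ) + 1)))) volume := by
    refine integrable_one_add_norm ?_
    rw [Module.finrank_fin_fun]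
    have : (0 : ℝ) ≤ n := Nat.cast_nonneg n
    linarith
  refine (h1.const_mul (K ^ 2)).congr (Eventually.of_forall fun y => ?_)
  simp only [mul_pow]
  congr 1
  rw [← Real.rpow_natCast, ← Real.rpow_mul (h0 y).le]
  congr 1
  push_cast
  ring

theorem enorm_eq_ofReal_mul {K : ℝ} (hK : 0 ≤ K) (z : ℂ) :
    ‖((K : ℝ) : ℂ) * z‖ₑ = ENNReal.ofReal K * ‖z‖ₑ := by
  rw [enorm_mul, ← ofReal_norm (K : ℂ), Complex.norm_real, Real.norm_of_nonneg hK]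

variable [FiniteDimensional ℝ E] [I.Boundaryless] [T2Space N] [SigmaCompactSpace N]

/-- The cubes `t + [0,1]^n` with `t ≥ 0` stay in the orthant, so their images stay in the cone of
frequencies. Derivatives along the `a i` are Fourier transforms with the cutoff multiplied by
coordinates; the footprint does not grow, so Hörmander seminorms control them as well. -/
theorem exists_isHilbertSummable_orthant {Γ : Set (CotangentBundle I N)} (c : PhaseLocalizer I N)
    (hc : Disjoint c.footprint Γ) {n : ℕ} (a : Fin n → E →L[ℝ] ℝ) {κ : ℝ} (hκ : 0 < κ)
    (hbound : ∀ t : Fin n → ℝ, 0 ≤ t → κ * ‖t‖ ≤ ‖combinationMap a t‖)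
    (hcone : ∀ t : Fin n → ℝ, 0 ≤ t → combinationMap a t ∈ c.cone) (m : ℕ) :
    ∃ s : Seminorm ℂ (distributionsWF Γ), IsHilbertSummable (hormanderTopology Γ) s ∧
      ∀ (u : distributionsWF Γ) (t : Fin n → ℝ), 0 ≤ t →
        (1 + ‖combinationMap a t‖) ^ m * ‖c.fourier u.1 (combinationMap a t)‖ ≤ s u := by
  let τ := hormanderTopology Γ
  have hτ := isLocallyConvexTopology_hormanderTopology Γ
  have := hτ.1
  have := hτ.2.1
  let A := combinationMap a
  let μ : Measure (Fin n → ℝ) := volume.restrict (Ici 0)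
  have hdis : ∀ S, Disjoint (c.mulCoords a S).footprint Γ := fun S =>
    hc.mono_left (c.footprint_mulCutoff_subset _ _)
  have hcont : ∀ (S : Finset (Fin n)) (u : distributionsWF Γ),
      Continuous fun y => (c.mulCoords a S).fourier u.1 (A y) := fun S u =>
    ((c.mulCoords a S).continuous_fourier u.2.1).comp A.continuous
  have hex : ∀ S : Finset (Fin n), ∃ s : Seminorm ℂ (distributionsWF Γ),
      IsHilbertSummable τ s ∧ ∀ u : distributionsWF Γ, ENNReal.ofReal (s u) =
        eLpNorm (fun y => (((1 + ‖A y‖) ^ m : ℝ) : ℂ) * (c.mulCoords a S).fourier u.1 (A y)) 2 μ := by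
    intro S
    let f : distributionsWF Γ →ₗ[ℂ] ((Fin n → ℝ) → ℂ) :=
      { toFun := fun u y => (((1 + ‖A y‖) ^ m : ℝ) : ℂ) * (c.mulCoords a S).fourier u.1 (A y)
        map_add' := fun u v => by
          ext y; exact mul_add _ _ _
        map_smul' := fun b u => by
          ext y; exact mul_left_comm _ _ _ }
    -- The additional `n + 1` powers pay for square integrability over the orthant.
    let q := hormanderSeminorms Γ (Sum.inr (⟨c.mulCoords a S, hdis S⟩, m + (n + 1)))
    have hq : Continuous q := (withSeminorms_hormanderTopology Γ).continuous_seminorm _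
    -- With `κ' ≤ 1` the bound below for `A` also holds for the weights: `κ' (1 + ‖y‖) ≤ 1 + ‖A y‖`.
    let κ' : ℝ := min 1 κ
    have hκ' : 0 < κ' := lt_min one_pos hκ
    refine IsHilbertSummable.exists_eLpNorm_eq f
      (fun y => (κ'⁻¹) ^ (n + 1) * (1 + ‖y‖) ^ (-((n : ℝ) + 1)))
      (memLp_one_add_norm_rpow n _ μ Measure.restrict_le_self) (fun u => ?_) hq ?_
    · refine Continuous.aestronglyMeasurable (Continuous.mul ?_ (hcont S u))
      exact Complex.continuous_ofReal.comp
        ((continuous_const.add A.continuous.norm).pow m)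
    · refine (ae_restrict_iff' measurableSet_Ici).2 (Eventually.of_forall fun y hy u => ?_)
      have h1 : (1 + ‖A y‖) ^ (m + (n + 1)) * ‖(c.mulCoords a S).fourier u.1 (A y)‖ ≤ q u :=
        PhaseLocalizer.le_fourierSeminorm
          (h := fun _ hu => (c.mulCoords a S).rapidlyDecreasing_of_mem (hdis S) hu) u
          (hcone y hy)
      have h2 : ‖f u y‖ = (1 + ‖A y‖) ^ m * ‖(c.mulCoords a S).fourier u.1 (A y)‖ := by
        change ‖(((1 + ‖A y‖) ^ m : ℝ) : ℂ) * (c.mulCoords a S).fourier u.1 (A y)‖ = _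
        rw [norm_mul, Complex.norm_real, Real.norm_of_nonneg (by positivity)]
      have h3 : κ' * (1 + ‖y‖) ≤ 1 + ‖A y‖ := by
        have h4 := hbound y hy
        have h5 : κ' * ‖y‖ ≤ κ * ‖y‖ := mul_le_mul_of_nonneg_right (min_le_right _ _) (norm_nonneg _)
        have h6 : κ' ≤ 1 := min_le_left _ _
        have h7 : κ * ‖y‖ ≤ ‖A y‖ := h4
        linarith
      have h8 : (κ' * (1 + ‖y‖)) ^ (n + 1) * ‖f u y‖ ≤ q u := by
        refine le_trans ?_ h1
        rw [h2, pow_add (1 + ‖A y‖) m, mul_comm ((1 + ‖A y‖) ^ m) ((1 + ‖A y‖) ^ (n + 1)), mul_assoc]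
        exact mul_le_mul_of_nonneg_right (pow_le_pow_left₀ (by positivity) h3 _) (by positivity)
      have h9 : (1 + ‖y‖) ^ (-((n : ℝ) + 1)) = ((1 + ‖y‖) ^ (n + 1))⁻¹ := by
        rw [Real.rpow_neg (by positivity)]
        congr 1
        exact_mod_cast Real.rpow_natCast (1 + ‖y‖) (n + 1)
      rw [h9, inv_pow, ← mul_inv, ← mul_pow, inv_mul_eq_div, le_div_iff₀ (by positivity), mul_comm]
      exact h8
  choose s hs hse using hex
  let C : NNReal := ⟨(1 + ‖A‖) ^ m, by positivity⟩
  let s₀ : Seminorm ℂ (distributionsWF Γ) := ∑ S, s S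
  refine ⟨C • s₀, (IsHilbertSummable.finset_sum _ fun S _ => hs S).of_le_mul
    C fun u => le_of_eq rfl, fun u t ht => ?_⟩
  · have h1 := enorm_le_sum_lintegral_cube
      (fun S y => (c.mulCoords a S).fourier u.1 (A y)) (fun S => hcont S u)
      (fun S i hi x r => c.hasDerivAt_fourier_mulCoords a hi u.2.1 x r) t
    simp only [c.fourier_mulCoords_empty] at h1
    have hcube : volume (Icc t (t + 1)) = 1 := by
      rw [Real.volume_Icc_pi]; simp
    have hprob : IsProbabilityMeasure (volume.restrict (Icc t (t + 1))) := ⟨by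
      rw [Measure.restrict_apply_univ, hcube]⟩
    have hsub : Icc t (t + 1) ⊆ Ici (0 : Fin n → ℝ) := fun y hy => ht.trans hy.1
    have h2 : ∀ S, ENNReal.ofReal ((1 + ‖A t‖) ^ m) *
        ∫⁻ y in Icc t (t + 1), ‖(c.mulCoords a S).fourier u.1 (A y)‖ₑ ≤
        ENNReal.ofReal ((1 + ‖A‖) ^ m) * ENNReal.ofReal (s S u) := fun S => by
      have hm : ∀ S, Continuous fun y =>
          (((1 + ‖A y‖) ^ m : ℝ) : ℂ) * (c.mulCoords a S).fourier u.1 (A y) := fun S =>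
        (Complex.continuous_ofReal.comp
          ((continuous_const.add A.continuous.norm).pow m)).mul (hcont S u)
      calc ENNReal.ofReal ((1 + ‖A t‖) ^ m) *
            ∫⁻ y in Icc t (t + 1), ‖(c.mulCoords a S).fourier u.1 (A y)‖ₑ
          = ∫⁻ y in Icc t (t + 1), ENNReal.ofReal ((1 + ‖A t‖) ^ m) *
              ‖(c.mulCoords a S).fourier u.1 (A y)‖ₑ :=
            (lintegral_const_mul _ (hcont S u).enorm.measurable).symm
        _ ≤ ∫⁻ y in Icc t (t + 1), ENNReal.ofReal ((1 + ‖A‖) ^ m) *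
              ‖(((1 + ‖A y‖) ^ m : ℝ) : ℂ) * (c.mulCoords a S).fourier u.1 (A y)‖ₑ := by
            refine setLIntegral_mono' measurableSet_Icc fun y hy => ?_
            rw [enorm_eq_ofReal_mul (by positivity), ← mul_assoc,
              ← ENNReal.ofReal_mul (by positivity), ← mul_pow]
            gcongr
            exact one_add_norm_le_mul A hy
        _ = ENNReal.ofReal ((1 + ‖A‖) ^ m) * ∫⁻ y in Icc t (t + 1),
              ‖(((1 + ‖A y‖) ^ m : ℝ) : ℂ) * (c.mulCoords a S).fourier u.1 (A y)‖ₑ :=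
            lintegral_const_mul _ (hm S).enorm.measurable
        _ ≤ _ := by
            gcongr
            rw [hse, ← eLpNorm_one_eq_lintegral_enorm]
            -- The cube has volume one, so the `L¹` norm over it is at most the `L²` norm.
            refine (eLpNorm_le_eLpNorm_of_exponent_le one_le_two
              (hm S).aestronglyMeasurable).trans ?_
            exact eLpNorm_mono_measure _ (Measure.restrict_mono hsub le_rfl)
    have h3 : ENNReal.ofReal ((1 + ‖A t‖) ^ m * ‖c.fourier u.1 (A t)‖) ≤
        ENNReal.ofReal ((1 + ‖A‖) ^ m * ∑ S, s S u) := by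
      rw [ENNReal.ofReal_mul (by positivity), ofReal_norm, ENNReal.ofReal_mul (by positivity),
        ENNReal.ofReal_sum_of_nonneg fun S _ => apply_nonneg _ _, Finset.mul_sum]
      refine (mul_le_mul_right h1 _).trans ?_
      rw [Finset.mul_sum]
      exact Finset.sum_le_sum fun S _ => h2 S
    have h4 := (ENNReal.ofReal_le_ofReal_iff (mul_nonneg (by positivity)
      (Finset.sum_nonneg fun S _ => apply_nonneg _ _))).1 h3
    refine h4.trans (le_of_eq ?_)
    have h5 : ∑ S, s S u = s₀ u :=
      (sum_apply _ _ _).symm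
    rw [h5]
    rfl

end HormanderNuclear

/-- Every neighbourhood of a unit vector contains a simplex which is a neighbourhood of it, and the
cone over the simplex is the bijective linear image of an orthant. -/
theorem exists_simplex_mem_nhds {V : Type*} [NormedAddCommGroup V] [NormedSpace ℝ V]
    [FiniteDimensional ℝ V] {v : V} (hv : ‖v‖ = 1) {U : Set V} (hU : U ∈ 𝓝 v) :
    ∃ (n : ℕ) (a : Fin n → V) (K : Set V), IsCompact K ∧ K ⊆ U ∧ (0 : V) ∉ K ∧ K ∈ 𝓝 v ∧
      (∀ t : Fin n → ℝ, 0 ≤ t → 1 / 2 * ‖t‖ ≤ ‖combinationMap a t‖) ∧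
      (∀ t : Fin n → ℝ, 0 ≤ t → combinationMap a t ∈ rayCone K) ∧
      ∀ w ∈ rayCone K, ∃ t : Fin n → ℝ, 0 ≤ t ∧ combinationMap a t = w := by
  -- Within distance `1/2` of `v`, a norming functional `l` of `v` is at least `1/2`. This keeps the
  -- simplex away from `0` and bounds nonnegative combinations of its vertices from below.
  obtain ⟨b, hb, hbU⟩ := exists_mem_interior_convexHull_affineBasis
    (inter_mem hU (Metric.ball_mem_nhds v (show (0 : ℝ) < 1 / 2 by norm_num)))
  obtain ⟨l, hl, hlv⟩ := exists_dual_vector ℝ v (by rw [hv]; exact one_ne_zero)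
  have hlv' : l v = 1 := by rw [hlv, hv]; rfl
  have hlb : ∀ w ∈ convexHull ℝ (range b), 1 / 2 ≤ l w := fun w hw => by
    have h1 : ‖w - v‖ < 1 / 2 := by simpa [dist_eq_norm] using (hbU hw).2
    have h2 : |l (w - v)| ≤ 1 * ‖w - v‖ := hl ▸ l.le_opNorm (w - v)
    rw [map_sub, hlv'] at h2
    have h3 := (abs_le.1 h2).1
    linarith
  have hbm : ∀ i, b i ∈ convexHull ℝ (range b) := fun i => subset_convexHull ℝ _ (mem_range_self i)
  refine ⟨_, b, convexHull ℝ (range b), (finite_range b).isCompact_convexHull ℝ,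
    fun w hw => (hbU hw).1, fun h => ?_, mem_interior_iff_mem_nhds.1 hb, fun t ht => ?_,
    fun t ht => ?_, ?_⟩
  · have := hlb 0 h
    rw [map_zero] at this
    linarith
  · have h1 : ‖t‖ ≤ ∑ i, t i := by
      rw [pi_norm_le_iff_of_nonneg (Finset.sum_nonneg fun i _ => ht i)]
      intro i
      rw [Real.norm_of_nonneg (ht i)]
      exact Finset.single_le_sum (f := t) (fun i _ => ht i) (Finset.mem_univ i)
    have h2 : l (combinationMap b t) ≤ ‖combinationMap b t‖ := by
      have := l.le_opNorm (combinationMap b t)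
      rw [hl, one_mul] at this
      exact (le_abs_self _).trans this
    refine le_trans ?_ h2
    rw [combinationMap_apply, map_sum]
    calc 1 / 2 * ‖t‖ ≤ 1 / 2 * ∑ i, t i := by gcongr
      _ = ∑ i, t i * (1 / 2) := by rw [Finset.mul_sum]; simp only [mul_comm]
      _ ≤ _ := Finset.sum_le_sum fun i _ => by
        rw [map_smul, smul_eq_mul]
        exact mul_le_mul_of_nonneg_left (hlb _ (hbm i)) (ht i)
  · have hsum : 0 ≤ ∑ i, t i := Finset.sum_nonneg fun i _ => ht i
    rcases hsum.eq_or_lt with h0 | h0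
    · have : t = 0 := by
        ext i
        exact (Finset.sum_eq_zero_iff_of_nonneg fun i _ => ht i).1 h0.symm i (Finset.mem_univ i)
      exact ⟨0, le_rfl, b 0, hbm 0, by rw [this, map_zero, zero_smul]⟩
    · refine ⟨∑ i, t i, h0.le, ∑ i, ((∑ i, t i)⁻¹ * t i) • b i, ?_, ?_⟩
      · refine (convex_convexHull ℝ _).sum_mem (fun i _ => mul_nonneg (by positivity) (ht i)) ?_
          fun i _ => hbm i
        rw [← Finset.mul_sum, inv_mul_cancel₀ h0.ne']
      · rw [combinationMap_apply, Finset.smul_sum]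
        refine Finset.sum_congr rfl fun i _ => ?_
        rw [smul_smul, mul_inv_cancel_left₀ h0.ne']
  · rintro _ ⟨r, hr, w, hw, rfl⟩
    rw [b.convexHull_eq_nonneg_coord] at hw
    refine ⟨r • fun i => b.coord i w, fun i => mul_nonneg hr (hw i), ?_⟩
    rw [map_smul, combinationMap_apply, b.linear_combination_coord_eq_self]

/-! ### Summability for all continuous seminorms of a closed cone -/

section HormanderNuclear

variable {E : Type*} [NormedAddCommGroup E] [NormedSpace ℝ E]
  {H : Type*} [TopologicalSpace H] {I : ModelWithCorners ℝ E H}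
  {N : Type*} [TopologicalSpace N] [ChartedSpace H N] [IsManifold I ∞ N]
  [FiniteDimensional ℝ E] [I.Boundaryless] [T2Space N] [SigmaCompactSpace N]

/-- Since the cutoff has compact support and `Γ` is closed, `η₀` can be thickened to a simplex whose
cone still avoids `Γ` over the support. This cone may leave `c.cone`, which is harmless: it is the
cone of another seminorm of the same topology. -/
theorem exists_isHilbertSummable_mem_nhds {Γ : Set (CotangentBundle I N)} (hΓ : IsClosedCone Γ)
    (c : PhaseLocalizer I N) (hc : Disjoint c.footprint Γ) {η₀ : E →L[ℝ] ℝ} (hη₀ : η₀ ∈ c.cone)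
    (hn : ‖η₀‖ = 1) (m : ℕ) :
    ∃ K ∈ 𝓝 η₀, ∃ s : Seminorm ℂ (distributionsWF Γ), IsHilbertSummable (hormanderTopology Γ) s ∧
      ∀ (u : distributionsWF Γ), ∀ η ∈ rayCone K, (1 + ‖η‖) ^ m * ‖c.fourier u.1 η‖ ≤ s u := by
  obtain ⟨hconic, C, hC, hΓC⟩ := hΓ
  have h0 : η₀ ≠ 0 := norm_ne_zero_iff.1 (by rw [hn]; exact one_ne_zero)
  have hU : ∀ᶠ η in 𝓝 η₀, ∀ x ∈ tsupport c.cutoff, covectorOf I c.chart (x, η) ∉ C := by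
    refine IsCompact.eventually_forall_of_forall_eventually c.hasCompactSupport fun x hx => ?_
    have hx' := c.tsupport_subset hx
    have h1 : covectorOf I c.chart (x, η₀) ∉ C := fun h => by
      refine disjoint_left.1 hc ((c.mem_footprint _).2 ⟨x, hx, η₀, hη₀, h0, rfl⟩) ?_
      rw [hΓC]
      exact ⟨h, (covectorOf_mem_puncturedCotangent c.chart_mem hx' η₀).2 h0⟩
    have h2 : ContinuousAt (fun z : (E →L[ℝ] ℝ) × N => covectorOf I c.chart (z.2, z.1)) (η₀, x) :=
      ContinuousAt.comp (g := covectorOf I c.chart) (f := Prod.swap)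
        (continuousAt_covectorOf c.chart_mem hx') continuous_swap.continuousAt
    exact h2.eventually (hC.isOpen_compl.mem_nhds h1)
  obtain ⟨n, a, K, hK, hKU, hK0, hKη, hbound, hmem, hsurj⟩ := exists_simplex_mem_nhds hn hU
  let c' := c.withCone (rayCone K) (hK.isClosed_rayCone hK0) fun η hη t ht => smul_mem_rayCone hη ht
  have hc' : Disjoint c'.footprint Γ := by
    rw [disjoint_left]
    intro z hz hzΓ
    obtain ⟨x, hx, ξ, ⟨t, ht, ζ, hζ, rfl⟩, h1, rfl⟩ := (c'.mem_footprint z).1 hz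
    have ht0 : 0 < t := lt_of_le_of_ne ht fun h => h1 (by rw [← h, zero_smul])
    have h2 := hconic _ hzΓ t⁻¹ (inv_pos.2 ht0)
    rw [smul_covectorOf] at h2
    simp only [smul_smul, inv_mul_cancel₀ ht0.ne', one_smul] at h2
    rw [hΓC] at h2
    exact hKU hζ x hx h2.1
  obtain ⟨s, hs, hsu⟩ := exists_isHilbertSummable_orthant c' hc' a (by norm_num) hbound hmem m
  refine ⟨K, hKη, s, hs, fun u η hη => ?_⟩
  obtain ⟨t, ht, rfl⟩ := hsurj η hη
  exact hsu u t ht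

theorem rayCone_mono {V : Type*} [AddCommGroup V] [Module ℝ V] {K L : Set V} (h : K ⊆ L) :
    rayCone K ⊆ rayCone L := by
  rintro _ ⟨t, ht, y, hy, rfl⟩
  exact ⟨t, ht, y, h hy, rfl⟩

theorem isHilbertSummable_eval (Γ : Set (CotangentBundle I N)) (f : smoothFunctions I N) :
    IsHilbertSummable (hormanderTopology Γ) (hormanderSeminorms Γ (Sum.inl f)) := by
  refine IsHilbertSummable.of_linear ((Module.Dual.eval ℂ _ f).comp (Submodule.subtype _)) ?_
    fun _ => rfl
  exact continuous_inf_dom_left (continuous_iInf_dom (i := f) continuous_induced_dom)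

theorem isHilbertSummable_hormanderSeminorms {Γ : Set (CotangentBundle I N)} (hΓ : IsClosedCone Γ)
    (i) : IsHilbertSummable (hormanderTopology Γ) (hormanderSeminorms Γ i) := by
  rcases i with f | ⟨⟨c, hc⟩, m⟩
  · exact isHilbertSummable_eval Γ f
  have hK : IsCompact (c.cone ∩ Metric.sphere 0 1) :=
    (isCompact_sphere _ _).inter_left c.isClosed_cone
  obtain ⟨s, hs, hsu⟩ : ∃ s : Seminorm ℂ (distributionsWF Γ),
      IsHilbertSummable (hormanderTopology Γ) s ∧ ∀ (u : distributionsWF Γ),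
        ∀ η ∈ rayCone (c.cone ∩ Metric.sphere 0 1), (1 + ‖η‖) ^ m * ‖c.fourier u.1 η‖ ≤ s u := by
    refine hK.induction_on (p := fun K => ∃ s : Seminorm ℂ (distributionsWF Γ),
      IsHilbertSummable (hormanderTopology Γ) s ∧ ∀ (u : distributionsWF Γ),
        ∀ η ∈ rayCone K, (1 + ‖η‖) ^ m * ‖c.fourier u.1 η‖ ≤ s u) ?_ ?_ ?_ ?_
    · exact ⟨0, IsHilbertSummable.zero, fun u η ⟨t, _, y, hy, _⟩ => hy.elim⟩
    · rintro K L hKL ⟨s, hs, h⟩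
      exact ⟨s, hs, fun u η hη => h u η (rayCone_mono hKL hη)⟩
    · rintro K L ⟨s, hs, h⟩ ⟨s', hs', h'⟩
      refine ⟨s + s', hs.add hs', fun u η hη => ?_⟩
      obtain ⟨t, ht, y, hy | hy, rfl⟩ := hη
      · exact (h u _ ⟨t, ht, y, hy, rfl⟩).trans (le_add_of_nonneg_right (apply_nonneg s' u))
      · exact (h' u _ ⟨t, ht, y, hy, rfl⟩).trans (le_add_of_nonneg_left (apply_nonneg s u))
    · rintro η ⟨hη, hη1⟩
      obtain ⟨K, hK, s, hs, h⟩ := exists_isHilbertSummable_mem_nhds hΓ c hc hη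
        (by simpa using hη1) m
      exact ⟨K, mem_nhdsWithin_of_mem_nhds hK, s, hs, h⟩
  -- Evaluation at `c.wave 0` accounts for the frequency `0`, which has no direction on the sphere.
  refine (hs.add (isHilbertSummable_eval Γ (c.wave 0))).mono fun u => ?_
  refine c.fourierSeminorm_le (h := fun _ hu => c.rapidlyDecreasing_of_mem hc hu) ?_ fun η hη => ?_
  · exact apply_nonneg _ u
  rcases eq_or_ne η 0 with rfl | h0
  · rw [norm_zero, add_zero, one_pow, one_mul]
    exact le_add_of_nonneg_left (apply_nonneg s u)
  · refine (hsu u η ?_).trans (le_add_of_nonneg_right (apply_nonneg _ u))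
    have hn : 0 < ‖η‖ := norm_pos_iff.2 h0
    refine ⟨‖η‖, hn.le, ‖η‖⁻¹ • η, ⟨c.smul_mem_cone η hη _ (inv_pos.2 hn), ?_⟩, ?_⟩
    · rw [mem_sphere_zero_iff_norm, norm_smul, norm_inv, norm_norm, inv_mul_cancel₀ hn.ne']
    · rw [smul_smul, mul_inv_cancel₀ hn.ne', one_smul]

/-- All continuous seminorms of `E'_Γ` are summable. -/
theorem isHilbertSummable_of_continuous {Γ : Set (CotangentBundle I N)} (hΓ : IsClosedCone Γ)
    (p : Seminorm ℂ (distributionsWF Γ)) (hp : @Continuous _ _ (hormanderTopology Γ) _ p) :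
    IsHilbertSummable (hormanderTopology Γ) p := by
  obtain ⟨S, C, -, hC⟩ := @Seminorm.bound_of_continuous _ _ _ _ _ _ _ (hormanderTopology Γ)
    (withSeminorms_hormanderTopology Γ) p hp
  refine (IsHilbertSummable.finset_sum S fun i _ =>
    isHilbertSummable_hormanderSeminorms hΓ i).of_le_mul C fun u => (hC u).trans ?_
  exact mul_le_mul_of_nonneg_left (Seminorm.finset_sup_le_sum _ S u) C.2

end HormanderNuclear

/-! ### Closed cones in the cotangent bundle -/

section Cones

variable {E : Type*} [NormedAddCommGroup E] [NormedSpace ℝ E]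
  {H : Type*} [TopologicalSpace H] {I : ModelWithCorners ℝ E H}
  {N : Type*} [TopologicalSpace N] [ChartedSpace H N] [IsManifold I ∞ N]

/-- The union of the rays through the points of `L`. -/
def raySaturation (L : Set (CotangentBundle I N)) : Set (CotangentBundle I N) :=
  {w | ∃ t : ℝ, 0 < t ∧ ∃ z ∈ L, w = ⟨z.1, t • z.2⟩}

theorem isConicSet_raySaturation (L : Set (CotangentBundle I N)) :
    IsConicSet (raySaturation L) := by
  rintro _ ⟨s, hs, z, hz, rfl⟩ t ht
  exact ⟨t * s, mul_pos ht hs, z, hz, by simp only [smul_smul]⟩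

theorem IsConicSet.raySaturation_subset {S L : Set (CotangentBundle I N)} (hS : IsConicSet S)
    (h : L ⊆ S) : raySaturation L ⊆ S := by
  rintro _ ⟨t, ht, z, hz, rfl⟩
  exact hS z (h hz) t ht

theorem subset_raySaturation (L : Set (CotangentBundle I N)) : L ⊆ raySaturation L :=
  fun z hz => ⟨1, one_pos, z, hz, by rw [one_smul]⟩

theorem isConicSet_puncturedCotangent : IsConicSet (puncturedCotangent I N) :=
  fun _ hz _ ht => smul_ne_zero ht.ne' hz

theorem IsConicSet.interior {S : Set (CotangentBundle I N)} (hS : IsConicSet S) :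
    IsConicSet (_root_.interior S) := by
  intro z hz t ht
  have hcont : Continuous fun z : CotangentBundle I N =>
      (⟨z.1, t⁻¹ • z.2⟩ : CotangentBundle I N) :=
    continuous_iff_continuousAt.2 fun z => continuousAt_smul_cotangent t⁻¹
  refine interior_maximal ?_ (isOpen_interior.preimage hcont) (show _ ∈ _root_.interior S from ?_)
  · intro w hw
    have := hS _ (interior_subset hw) t ht
    simpa only [smul_smul, mul_inv_cancel₀ ht.ne', one_smul] using this
  · simpa only [smul_smul, inv_mul_cancel₀ ht.ne', one_smul] using hz

theorem IsClosedCone.union {S T : Set (CotangentBundle I N)} (hS : IsClosedCone S)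
    (hT : IsClosedCone T) : IsClosedCone (S ∪ T) := by
  obtain ⟨h1, C, hC, rfl⟩ := hS
  obtain ⟨h2, D, hD, rfl⟩ := hT
  exact ⟨fun z hz t ht => hz.imp (fun h => h1 z h t ht) fun h => h2 z h t ht,
    C ∪ D, hC.union hD, (union_inter_distrib_right _ _ _).symm⟩

theorem isClosedCone_empty : IsClosedCone (∅ : Set (CotangentBundle I N)) :=
  ⟨fun _ h => h.elim, ∅, isClosed_empty, (empty_inter _).symm⟩

theorem IsClosedCone.accumulate {P : ℕ → Set (CotangentBundle I N)} (hP : ∀ i, IsClosedCone (P i))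
    (n : ℕ) : IsClosedCone (accumulate P n) := by
  induction n with
  | zero => rw [accumulate_zero_nat]; exact hP 0
  | succ n ih => rw [accumulate_succ]; exact ih.union (hP _)

/-- The coordinates of a covector in the local trivialization around `x₀`. -/
noncomputable abbrev cotangentTrivialization (I : ModelWithCorners ℝ E H) [IsManifold I ∞ N]
    (x₀ : N) :
    Bundle.Trivialization (E →L[ℝ] ℝ)
      (Bundle.TotalSpace.proj : CotangentBundle I N → N) :=
  trivializationAt (E →L[ℝ] ℝ) (fun x : N => TangentSpace I x →L[ℝ] ℝ) x₀

theorem cotangentTrivialization_smul (x₀ : N) {z : CotangentBundle I N}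
    (hz : z.1 ∈ (cotangentTrivialization I x₀).baseSet) (t : ℝ) :
    (cotangentTrivialization I x₀ ⟨z.1, t • z.2⟩).2 = t • (cotangentTrivialization I x₀ z).2 :=
  ((cotangentTrivialization I x₀).linear ℝ hz).map_smul t z.2

/-- The set of covectors with base point in `A` and coordinates in `B`. -/
noncomputable def cotangentBox (I : ModelWithCorners ℝ E H) [IsManifold I ∞ N] (x₀ : N)
    (A : Set N) (B : Set (E →L[ℝ] ℝ)) : Set (CotangentBundle I N) :=
  {z | z.1 ∈ A ∧ (cotangentTrivialization I x₀ z).2 ∈ B}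

theorem isCompact_cotangentBox {x₀ : N} {A : Set N} {B : Set (E →L[ℝ] ℝ)} (hA : IsCompact A)
    (hB : IsCompact B) (hAx : A ⊆ (cotangentTrivialization I x₀).baseSet) :
    IsCompact (cotangentBox I x₀ A B) := by
  let e := cotangentTrivialization I x₀
  have h : cotangentBox I x₀ A B = e.toOpenPartialHomeomorph.symm '' (A ×ˢ B) := by
    ext z
    constructor
    · rintro ⟨h1, h2⟩
      refine ⟨e z, ⟨?_, h2⟩, e.left_inv (e.mem_source.2 (hAx h1))⟩
      rw [e.coe_fst' (hAx h1)]
      exact h1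
    · rintro ⟨⟨x, v⟩, ⟨h1, h2⟩, rfl⟩
      have hx : (x, v) ∈ e.target := e.mem_target.2 (hAx h1)
      refine ⟨?_, ?_⟩
      · have := e.proj_symm_apply hx
        exact this.symm ▸ h1
      · have := e.apply_symm_apply hx
        exact (congrArg Prod.snd this).symm ▸ h2
  rw [h]
  refine (hA.prod hB).image_of_continuousOn (e.toOpenPartialHomeomorph.continuousOn_symm.mono ?_)
  rintro ⟨x, v⟩ ⟨h1, -⟩
  exact e.mem_target.2 (hAx h1)

theorem cotangentBox_mem_nhds {x₀ : N} {A : Set N} {B : Set (E →L[ℝ] ℝ)} {z : CotangentBundle I N}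
    (hx : z.1 ∈ (cotangentTrivialization I x₀).baseSet) (hA : A ∈ 𝓝 z.1)
    (hB : B ∈ 𝓝 (cotangentTrivialization I x₀ z).2) : cotangentBox I x₀ A B ∈ 𝓝 z := by
  let e := cotangentTrivialization I x₀
  have h1 : ContinuousAt e z := e.continuousAt (e.mem_source.2 hx)
  have h2 : ContinuousAt (Bundle.TotalSpace.proj : CotangentBundle I N → N) z :=
    (e.continuousAt_proj (e.mem_source.2 hx))
  filter_upwards [h2 hA, (continuousAt_snd.comp h1) hB] with w hw1 hw2
  exact ⟨hw1, hw2⟩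

theorem mem_puncturedCotangent_iff {x₀ : N} {z : CotangentBundle I N}
    (hx : z.1 ∈ (cotangentTrivialization I x₀).baseSet) :
    z ∈ puncturedCotangent I N ↔ (cotangentTrivialization I x₀ z).2 ≠ 0 := by
  let e := cotangentTrivialization I x₀
  refine not_congr ?_
  have h := (e.continuousLinearEquivAt ℝ z.1 hx).map_eq_zero_iff (x := z.2)
  rw [← h]
  rfl

theorem raySaturation_cotangentBox {x₀ : N} {A : Set N} {B : Set (E →L[ℝ] ℝ)}
    (hB : (0 : E →L[ℝ] ℝ) ∉ B) (hAx : A ⊆ (cotangentTrivialization I x₀).baseSet) :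
    raySaturation (cotangentBox I x₀ A B) =
      cotangentBox I x₀ A (rayCone B) ∩ puncturedCotangent I N := by
  ext z
  constructor
  · rintro ⟨t, ht, z, ⟨hz1, hz2⟩, rfl⟩
    have h := cotangentTrivialization_smul x₀ (hAx hz1) t
    refine ⟨⟨hz1, ?_⟩, ?_⟩
    · rw [h]; exact ⟨t, ht.le, _, hz2, rfl⟩
    · refine (mem_puncturedCotangent_iff (z := ⟨z.1, t • z.2⟩) (hAx hz1)).2 ?_
      rw [h]
      exact smul_ne_zero ht.ne' fun h0 => hB (h0 ▸ hz2)
  · rintro ⟨⟨h1, t, ht, η, hη, h2⟩, h3⟩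
    rw [mem_puncturedCotangent_iff (hAx h1), h2] at h3
    have ht0 : 0 < t := ht.lt_of_ne fun h => h3 (by rw [← h, zero_smul])
    refine ⟨t, ht0, ⟨z.1, t⁻¹ • z.2⟩, ⟨h1, ?_⟩, ?_⟩
    · rw [cotangentTrivialization_smul x₀ (hAx h1), h2, smul_smul, inv_mul_cancel₀ ht0.ne', one_smul]
      exact hη
    · simp only [smul_smul, mul_inv_cancel₀ ht0.ne', one_smul]

/-- In coordinates the saturation is `A` times the cone over `B`, without the zero covectors; that
cone is closed since `B` is compact and avoids `0`. -/
theorem isClosedCone_raySaturation_cotangentBox [T2Space N] {x₀ : N} {A : Set N}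
    {B : Set (E →L[ℝ] ℝ)} (hA : IsCompact A) (hBc : IsCompact B) (hB : (0 : E →L[ℝ] ℝ) ∉ B)
    (hAx : A ⊆ (cotangentTrivialization I x₀).baseSet) :
    IsClosedCone (raySaturation (cotangentBox I x₀ A B)) := by
  refine ⟨isConicSet_raySaturation _, cotangentBox I x₀ A (rayCone B), ?_,
    raySaturation_cotangentBox hB hAx⟩
  let e := cotangentTrivialization I x₀
  have hproj : Continuous (Bundle.TotalSpace.proj : CotangentBundle I N → N) :=
    FiberBundle.continuous_proj _ _
  have h1 : IsClosed {z : CotangentBundle I N | z.1 ∈ A} := hA.isClosed.preimage hproj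
  have h2 : ContinuousOn (fun z => (e z).2) {z : CotangentBundle I N | z.1 ∈ A} :=
    continuous_snd.comp_continuousOn (e.continuousOn.mono fun z hz => e.mem_source.2 (hAx hz))
  exact h2.preimage_isClosed_of_isClosed h1 (hBc.isClosed_rayCone hB)

theorem secondCountableTopology_cotangentBundle [FiniteDimensional ℝ E]
    [SecondCountableTopology N] : SecondCountableTopology (CotangentBundle I N) := by
  obtain ⟨s, hs, hsu⟩ := TopologicalSpace.countable_cover_nhds fun x : N =>
    (cotangentTrivialization I x).open_baseSet.mem_nhds
      (FiberBundle.mem_baseSet_trivializationAt' x)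
  have : SecondCountableTopology (E →L[ℝ] ℝ) := inferInstance
  refine ChartedSpace.secondCountable_of_countable_cover (N × (E →L[ℝ] ℝ))
    (s := (fun x => (⟨x, 0⟩ : CotangentBundle I N)) '' s) ?_ (hs.image _)
  rw [biUnion_image, eq_univ_iff_forall]
  intro z
  obtain ⟨x, hx, hz⟩ := mem_iUnion₂.1 (hsu.symm ▸ mem_univ z.1)
  exact mem_iUnion₂.2 ⟨x, hx, (cotangentTrivialization I x).mem_source.2 hz⟩

/-- Open cones have exhaustions by closed cones. -/
theorem exists_isConeExhaustion [FiniteDimensional ℝ E] [LocallyCompactSpace N] [T2Space N]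
    [SecondCountableTopology N] {Υ : Set (CotangentBundle I N)} (hΥ : IsOpen Υ)
    (hconic : IsConicSet Υ) (hpunct : Υ ⊆ puncturedCotangent I N) :
    ∃ Γ : ℕ → Set (CotangentBundle I N), IsConeExhaustion Υ Γ := by
  have hloc : ∀ z ∈ Υ, ∃ L : Set (CotangentBundle I N), IsCompact L ∧ L ⊆ Υ ∧
      IsClosedCone (raySaturation L) ∧ L ∈ 𝓝 z := by
    intro z hz
    let e := cotangentTrivialization I z.1
    have hx : z.1 ∈ e.baseSet := FiberBundle.mem_baseSet_trivializationAt' z.1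
    have hzs : z ∈ e.source := e.mem_source.2 hx
    have hz0 : (e z).2 ≠ 0 := (mem_puncturedCotangent_iff hx).1 (hpunct hz)
    have h1 : e.toOpenPartialHomeomorph.symm ⁻¹' Υ ∈ 𝓝 (z.1, (e z).2) := by
      have h2 : (z.1, (e z).2) = e z := Prod.ext (e.coe_fst' hx).symm rfl
      rw [h2]
      refine (e.toOpenPartialHomeomorph.continuousAt_symm (e.map_source hzs)).preimage_mem_nhds ?_
      have h3 : e.toOpenPartialHomeomorph.symm (e z) = z := e.left_inv hzs
      exact h3.symm ▸ hΥ.mem_nhds hz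
    obtain ⟨A₀, hA₀, B₀, hB₀, hAB⟩ := mem_nhds_prod_iff.1 h1
    obtain ⟨A, hA, hAA, hAc⟩ := local_compact_nhds
      (inter_mem hA₀ (e.open_baseSet.mem_nhds hx))
    obtain ⟨B, hB, hBB, hBc⟩ := local_compact_nhds
      (inter_mem hB₀ (isOpen_compl_singleton.mem_nhds hz0))
    have hAx : A ⊆ e.baseSet := fun x hx => (hAA hx).2
    refine ⟨cotangentBox I z.1 A B, isCompact_cotangentBox hAc hBc hAx, ?_,
      isClosedCone_raySaturation_cotangentBox hAc hBc (fun h => (hBB h).2 rfl) hAx,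
      cotangentBox_mem_nhds hx hA hB⟩
    rintro w ⟨hw1, hw2⟩
    have h4 : (w.1, (e w).2) = e w := Prod.ext (e.coe_fst' (hAx hw1)).symm rfl
    have h5 : e.toOpenPartialHomeomorph.symm (w.1, (e w).2) ∈ Υ :=
      hAB ⟨(hAA hw1).1, (hBB hw2).1⟩
    rw [h4] at h5
    have h6 : e.toOpenPartialHomeomorph.symm (e w) = w := e.left_inv (e.mem_source.2 (hAx hw1))
    rwa [h6] at h5
  choose! L hLc hLΥ hLcone hLn using hloc
  have := secondCountableTopology_cotangentBundle (I := I) (N := N)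
  obtain ⟨s, hs, hsc, hcov⟩ := TopologicalSpace.countable_cover_nhdsWithin
    (f := fun z => interior (L z)) (s := Υ)
    fun z hz => mem_nhdsWithin_of_mem_nhds (interior_mem_nhds.2 (hLn z hz))
  -- The empty cone is not excluded; the microcausal cone is empty for `k = d = 1`.
  rcases s.eq_empty_or_nonempty with rfl | hne
  · have : Υ = ∅ := subset_empty_iff.1 (by simpa using hcov)
    exact ⟨fun _ => ∅, fun _ => isClosedCone_empty, fun _ => empty_subset _, by simp [this]⟩
  obtain ⟨f, rfl⟩ := hsc.exists_eq_range hne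
  have hf : ∀ i, f i ∈ Υ := fun i => hs (mem_range_self i)
  let P : ℕ → Set (CotangentBundle I N) := fun i => raySaturation (L (f i))
  have hP : ∀ n, IsClosedCone (accumulate P n) := IsClosedCone.accumulate fun i => hLcone _ (hf i)
  have hPΥ : ∀ n, accumulate P n ⊆ Υ := fun n => iUnion₂_subset fun i _ =>
    hconic.raySaturation_subset (hLΥ _ (hf i))
  have hcover : Υ ⊆ ⋃ n, interior (accumulate P n) := fun z hz => by
    obtain ⟨_, ⟨i, rfl⟩, hi⟩ := mem_iUnion₂.1 (hcov hz)
    exact mem_iUnion.2 ⟨i, interior_mono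
      ((subset_raySaturation (L (f i))).trans (subset_accumulate (s := P))) hi⟩
  have hmono : Monotone fun n => interior (accumulate P n) :=
    fun m n h => interior_mono (monotone_accumulate h)
  -- `accumulate P n` consists of the rays through finitely many compact sets, and interiors of
  -- cones are conic. So it suffices that one later interior contains these compact sets.
  have hnext : ∀ n, ∃ n', n < n' ∧ accumulate P n ⊆ interior (accumulate P n') := by
    intro n
    have hcomp : IsCompact (⋃ i ∈ Iic n, L (f i)) :=
      (finite_Iic n).isCompact_biUnion fun i _ => hLc _ (hf i)
    obtain ⟨n', hn'⟩ := hcomp.elim_directed_cover (fun n => interior (accumulate P n))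
      (fun n => isOpen_interior) ((iUnion₂_subset fun i _ => hLΥ _ (hf i)).trans hcover)
      hmono.directed_le
    -- The `n + 1` forces the chosen stages to tend to infinity, so that their union is still all of
    -- `Υ`.
    refine ⟨max (n + 1) n', by omega, iUnion₂_subset fun i hi =>
      (hP _).1.interior.raySaturation_subset ?_⟩
    exact ((subset_biUnion_of_mem (u := fun i => L (f i)) (show i ∈ Iic n from hi)).trans hn').trans
      (hmono (le_max_right _ _))
  choose next hlt hnext using hnext
  have hle : ∀ m, m ≤ next^[m] 0 := fun m => by
    induction m with
    | zero => exact Nat.zero_le _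
    | succ m ih => rw [Function.iterate_succ_apply']; exact ih.trans_lt (hlt _)
  refine ⟨fun m => accumulate P (next^[m] 0), fun m => hP _, fun m => ?_,
    subset_antisymm (iUnion_subset fun m => hPΥ _) fun z hz => ?_⟩
  · rw [Function.iterate_succ_apply']
    exact hnext _
  · obtain ⟨n, hn⟩ := mem_iUnion.1 (hcover hz)
    exact mem_iUnion.2 ⟨n, monotone_accumulate (hle n) (interior_subset hn)⟩

end Cones

/-! ### Infima and induced locally convex topologies -/

section Abstract

variable {X : Type*} [AddCommGroup X] [Module ℂ X] {A : ℕ → Submodule ℂ X}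

/-- The infimum of locally convex topologies is locally convex. -/
theorem isLocallyConvexTopology_sInf {S : Set (TopologicalSpace X)}
    (hS : ∀ t ∈ S, IsLocallyConvexTopology t) : IsLocallyConvexTopology (sInf S) :=
  ⟨topologicalAddGroup_sInf fun t ht => (hS t ht).1,
    continuousSMul_sInf fun t ht => (hS t ht).2.1,
    LocallyConvexSpace.sInf fun t ht => (hS t ht).2.2⟩

/-- Local convexity and continuity of the inclusions pass to infima, so the infimum of the
admissible topologies is admissible. -/
theorem isLeast_inductiveLimitTopology (τ : ∀ m, TopologicalSpace (A m)) {B : Submodule ℂ X}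
    (h : ∀ m, A m ≤ B) : IsLeast (admissibleTopologies τ h) (inductiveLimitTopology τ h) :=
  ⟨⟨isLocallyConvexTopology_sInf fun _ ht => ht.1, fun m =>
    continuous_sInf_rng.2 fun _ ht => ht.2 m⟩, fun _ ht => sInf_le ht⟩

theorem isLocallyConvexTopology_induced {Y : Type*} [AddCommGroup Y] [Module ℂ Y]
    [t : TopologicalSpace Y] [IsTopologicalAddGroup Y] [ContinuousSMul ℂ Y] [LocallyConvexSpace ℝ Y]
    (f : X →ₗ[ℂ] Y) : IsLocallyConvexTopology (t.induced f) :=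
  ⟨topologicalAddGroup_induced f, continuousSMul_induced f,
    LocallyConvexSpace.induced (f.restrictScalars ℝ)⟩

end Abstract

/-! ### The inductive limit of the spaces `E'_Γ` -/

section Distributions

variable {E : Type*} [NormedAddCommGroup E] [NormedSpace ℝ E]
  {H : Type*} [TopologicalSpace H] {I : ModelWithCorners ℝ E H}
  {N : Type*} [TopologicalSpace N] [ChartedSpace H N] [IsManifold I ∞ N]

theorem continuous_eval_hormanderTopology (Γ : Set (CotangentBundle I N))
    (f : smoothFunctions I N) :
    @Continuous _ _ (hormanderTopology Γ) _ fun u : distributionsWF Γ => u.1 f :=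
  continuous_inf_dom_left (continuous_iInf_dom (i := f) continuous_induced_dom)

/-- A larger cone admits fewer localizers, so the seminorms of the target are among those of the
source. -/
theorem continuous_inclusion_hormanderTopology {Γ Γ' : Set (CotangentBundle I N)} (h : Γ ⊆ Γ') :
    @Continuous _ _ (hormanderTopology Γ) (hormanderTopology Γ')
      (Submodule.inclusion (distributionsWF_mono h)) := by
  refine continuous_inf_rng.2 ⟨continuous_iInf_rng.2 fun f => continuous_induced_rng.2 ?_,
    continuous_iInf_rng.2 fun c => continuous_iInf_rng.2 fun n => continuous_induced_rng.2 ?_⟩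
  · exact continuous_eval_hormanderTopology Γ f
  · exact continuous_inf_dom_right (continuous_iInf_dom (i := ⟨c.1, c.2.mono_right h⟩)
      (continuous_iInf_dom (i := n) continuous_induced_dom))

/-- The evaluations at the test functions. -/
def evalDistributions (S : Set (CotangentBundle I N)) :
    distributionsWF S →ₗ[ℂ] (smoothFunctions I N → ℂ) :=
  LinearMap.pi fun f => (Module.Dual.eval ℂ _ f).comp (Submodule.subtype _)

/-- Pointwise convergence on test functions is an admissible topology, Hausdorff since distinct
functionals differ on some test function; the limit topology is finer. -/
theorem t2Space_inductiveLimitTopology {Υ : Set (CotangentBundle I N)}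
    {Γ : ℕ → Set (CotangentBundle I N)} (h : ∀ m, distributionsWF (Γ m) ≤ distributionsWF Υ) :
    @T2Space _ (inductiveLimitTopology (fun m => hormanderTopology (Γ m)) h) := by
  let t : TopologicalSpace (distributionsWF Υ) :=
    TopologicalSpace.induced (evalDistributions Υ) inferInstance
  have ht : t ∈ admissibleTopologies (fun m => hormanderTopology (Γ m)) h :=
    ⟨isLocallyConvexTopology_induced _, fun m => (@continuous_induced_rng _ _ _ _ _ _
      (hormanderTopology (Γ m))).2 <| (@continuous_pi_iff _ _ _ (hormanderTopology (Γ m)) _ _).2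
        fun f => continuous_eval_hormanderTopology (Γ m) f⟩
  have hinj : Function.Injective (evalDistributions Υ) := fun u v huv =>
    Subtype.ext (LinearMap.ext fun f => congrFun huv f)
  refine @T2Space.of_injective_continuous _ _
    (inductiveLimitTopology (fun m => hormanderTopology (Γ m)) h) _ _ _ hinj ?_
  exact continuous_le_dom (sInf_le ht) continuous_induced_dom

theorem MicrolocallySmoothAt.isOpen (u : Module.Dual ℂ (smoothFunctions I N)) :
    IsOpen {z | MicrolocallySmoothAt u z} := by
  rw [isOpen_iff_mem_nhds]
  rintro z ⟨W, hW, hWc, hz, h⟩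
  filter_upwards [hW.mem_nhds hz] with w hw
  exact ⟨W, hW, hWc, hw, h⟩

theorem isConicSet_waveFrontSet (u : Module.Dual ℂ (smoothFunctions I N)) :
    IsConicSet (waveFrontSet u) := by
  rintro z ⟨hz, hzu⟩ t ht
  refine ⟨isConicSet_puncturedCotangent z hz t ht, ?_⟩
  rintro ⟨W, hW, hWc, hzW, h⟩
  refine hzu ⟨W, hW, hWc, ?_, h⟩
  have := hWc _ hzW t⁻¹ (inv_pos.2 ht)
  simpa only [smul_smul, inv_mul_cancel₀ ht.ne', one_smul] using this

theorem isOpen_puncturedCotangent : IsOpen (puncturedCotangent I N) := by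
  rw [isOpen_iff_mem_nhds]
  intro z hz
  let e := cotangentTrivialization I z.1
  have hx : z.1 ∈ e.baseSet := FiberBundle.mem_baseSet_trivializationAt' z.1
  have hz0 := (mem_puncturedCotangent_iff hx).1 hz
  filter_upwards [cotangentBox_mem_nhds hx (e.open_baseSet.mem_nhds hx)
    (isOpen_compl_singleton.mem_nhds hz0)] with w hw
  exact (mem_puncturedCotangent_iff hw.1).2 hw.2

/-- There are no singularities outside of the support. -/
theorem fst_mem_of_mem_waveFrontSet [I.Boundaryless] {u : Module.Dual ℂ (smoothFunctions I N)}
    {K : Set N} (hK : IsClosed K)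
    (hu : ∀ f : smoothFunctions I N, (∀ᶠ x in 𝓝ˢ K, f.1 x = 0) → u f = 0)
    {z : CotangentBundle I N} (hz : z ∈ waveFrontSet u) : z.1 ∈ K := by
  by_contra hzK
  have hproj : Continuous (Bundle.TotalSpace.proj : CotangentBundle I N → N) :=
    FiberBundle.continuous_proj _ _
  refine hz.2 ⟨{w | w.1 ∉ K}, hK.isOpen_compl.preimage hproj, fun w hw _ _ => hw, hzK,
    fun c hc n => ⟨‖c.fourier u 0‖, fun η hη => ?_⟩⟩
  rcases eq_or_ne η 0 with rfl | h0
  · simp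
  have h1 : c.fourier u η = 0 := by
    refine hu _ ?_
    have h2 : (tsupport c.cutoff)ᶜ ∈ 𝓝ˢ K := by
      refine (isClosed_tsupport _).isOpen_compl.mem_nhdsSet.2 fun x hxK hx => ?_
      exact hc ((c.mem_footprint _).2 ⟨x, hx, η, hη, h0, rfl⟩) hxK
    filter_upwards [h2] with x hx
    change c.cutoff x * _ = 0
    rw [image_eq_zero_of_notMem_tsupport hx, zero_mul]
  rw [h1, norm_zero, mul_zero]
  exact norm_nonneg _

/-- Over a compact set there is a compact set of covectors that meets all rays. -/
theorem exists_isCompact_raySaturation [FiniteDimensional ℝ E] [LocallyCompactSpace N] {K : Set N}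
    (hK : IsCompact K) :
    ∃ L : Set (CotangentBundle I N), IsCompact L ∧ L ⊆ puncturedCotangent I N ∧
      ∀ z ∈ puncturedCotangent I N, z.1 ∈ K → z ∈ raySaturation L := by
  have hloc : ∀ x : N, ∃ A ∈ 𝓝 x, A ⊆ (cotangentTrivialization I x).baseSet ∧ IsCompact A :=
    fun x => local_compact_nhds ((cotangentTrivialization I x).open_baseSet.mem_nhds
      (FiberBundle.mem_baseSet_trivializationAt' x))
  choose A hA hAx hAc using hloc
  obtain ⟨s, -, hs⟩ := hK.elim_nhds_subcover A fun x _ => hA x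
  refine ⟨⋃ x ∈ s, cotangentBox I x (A x) (Metric.sphere 0 1),
    s.isCompact_biUnion fun x _ => isCompact_cotangentBox (hAc x) (isCompact_sphere _ _) (hAx x),
    iUnion₂_subset fun x _ z hz => (mem_puncturedCotangent_iff (hAx x hz.1)).2 ?_, ?_⟩
  · exact ne_zero_of_mem_unit_sphere (⟨_, hz.2⟩ : Metric.sphere (0 : E →L[ℝ] ℝ) 1)
  intro z hz hzK
  obtain ⟨x, hx, hzx⟩ := mem_iUnion₂.1 (hs hzK)
  have hb := hAx x hzx
  have h0 := (mem_puncturedCotangent_iff hb).1 hz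
  have hn : 0 < ‖(cotangentTrivialization I x z).2‖ := norm_pos_iff.2 h0
  refine ⟨_, hn, ⟨z.1, ‖(cotangentTrivialization I x z).2‖⁻¹ • z.2⟩,
    mem_iUnion₂.2 ⟨x, hx, hzx, ?_⟩, ?_⟩
  · rw [cotangentTrivialization_smul x hb, mem_sphere_zero_iff_norm, norm_smul, norm_inv, norm_norm,
      inv_mul_cancel₀ hn.ne']
  · simp only [smul_smul, mul_inv_cancel₀ hn.ne', one_smul]

/-- Over the compact support of `u`, a compact set `L` of covectors meets all rays. The points of
`L` where `u` is singular form a compact subset of `Υ`, which the increasing interiors of the `Γ m`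
absorb; dilations then give the whole wave front set. -/
theorem IsConeExhaustion.exists_mem_distributionsWF [FiniteDimensional ℝ E] [I.Boundaryless]
    [T2Space N] [LocallyCompactSpace N] [SigmaCompactSpace N] {Υ : Set (CotangentBundle I N)}
    {Γ : ℕ → Set (CotangentBundle I N)} (hΓ : IsConeExhaustion Υ Γ)
    {u : Module.Dual ℂ (smoothFunctions I N)} (hu : u ∈ distributionsWF Υ) :
    ∃ m, u ∈ distributionsWF (Γ m) := by
  obtain ⟨K, hK, hKu⟩ := hu.1.exists_isCompact
  obtain ⟨L, hL, hLp, hLK⟩ := exists_isCompact_raySaturation (I := I) hK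
  have hQ : IsCompact (L \ {z | MicrolocallySmoothAt u z}) :=
    hL.diff (MicrolocallySmoothAt.isOpen u)
  have hsub : ∀ m, Γ m ⊆ Γ (m + 1) := fun m => (hΓ.subset_interior m).trans interior_subset
  have hcov : L \ {z | MicrolocallySmoothAt u z} ⊆ ⋃ m, interior (Γ m) := fun z hz => by
    have h1 : z ∈ Υ := hu.2 ⟨hLp hz.1, hz.2⟩
    rw [← hΓ.iUnion_eq] at h1
    obtain ⟨m, hm⟩ := mem_iUnion.1 h1
    exact mem_iUnion.2 ⟨m + 1, hΓ.subset_interior m hm⟩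
  have hmono : Monotone fun m => interior (Γ m) :=
    fun m n h => interior_mono (monotone_nat_of_le_succ hsub h)
  obtain ⟨m, hm⟩ := hQ.elim_directed_cover _ (fun m => isOpen_interior) hcov hmono.directed_le
  refine ⟨m, hu.1, fun z hz => ?_⟩
  obtain ⟨t, ht, w, hw, rfl⟩ := hLK z hz.1 (fst_mem_of_mem_waveFrontSet hK.isClosed hKu hz)
  refine (hΓ.isClosedCone m).1 w (interior_subset (hm ⟨hw, fun h => ?_⟩)) t ht
  have h1 := isConicSet_waveFrontSet u _ hz t⁻¹ (inv_pos.2 ht)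
  simp only [smul_smul, inv_mul_cancel₀ ht.ne', one_smul] at h1
  exact h1.2 h

/-- The spaces `E'_Γ` of an exhaustion of `Υ` by closed cones have the inductive limit `E'_Υ`. -/
theorem IsConeExhaustion.isLocallyConvexInductiveLimit [FiniteDimensional ℝ E] [I.Boundaryless]
    [T2Space N] [LocallyCompactSpace N] [SigmaCompactSpace N] {Υ : Set (CotangentBundle I N)}
    {Γ : ℕ → Set (CotangentBundle I N)} (hΓ : IsConeExhaustion Υ Γ) :
    IsLocallyConvexInductiveLimit (fun m => hormanderTopology (Γ m)) hΓ.distributionsWF_le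
      (inductiveLimitTopology (fun m => hormanderTopology (Γ m)) hΓ.distributionsWF_le) where
  locallyConvex m := isLocallyConvexTopology_hormanderTopology (Γ m)
  continuous_inclusion m := ⟨_, continuous_inclusion_hormanderTopology
    ((hΓ.subset_interior m).trans interior_subset)⟩
  exists_mem _ hu := hΓ.exists_mem_distributionsWF hu
  isLeast := isLeast_inductiveLimitTopology _ _

theorem IsConeExhaustion.isNuclearTopology [FiniteDimensional ℝ E] [I.Boundaryless]
    [T2Space N] [LocallyCompactSpace N] [SigmaCompactSpace N] {Υ : Set (CotangentBundle I N)}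
    {Γ : ℕ → Set (CotangentBundle I N)} (hΓ : IsConeExhaustion Υ Γ) :
    IsNuclearTopology
      (inductiveLimitTopology (fun m => hormanderTopology (Γ m)) hΓ.distributionsWF_le) := by
  have hleast := isLeast_inductiveLimitTopology (fun m => hormanderTopology (Γ m))
    hΓ.distributionsWF_le
  refine isNuclearTopology_of_isHilbertSummable hleast.1.1
    (t2Space_inductiveLimitTopology _) fun p hp => ?_
  refine IsHilbertSummable.inductiveLimit
    (fun m => isLocallyConvexTopology_hormanderTopology (Γ m))
    (fun u hu => hΓ.exists_mem_distributionsWF hu)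
    (fun m q hq => isHilbertSummable_of_continuous (hΓ.isClosedCone m) q hq) p fun m => ?_
  exact @Continuous.comp _ _ _ (hormanderTopology (Γ m)) (inductiveLimitTopology _ _) _
    (Submodule.inclusion (hΓ.distributionsWF_le m)) p hp (hleast.1.2 m)

end Distributions

/-! ### Tangent spaces of finite products -/

section Pi

variable {ι : Type*} [Fintype ι] {E : Type*} [NormedAddCommGroup E] [NormedSpace ℝ E]
  {H : Type*} [TopologicalSpace H] (I : ModelWithCorners ℝ E H)

instance boundaryless_pi [I.Boundaryless] :
    (ModelWithCorners.pi fun _ : ι => I).Boundaryless where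
  range_eq_univ := by
    rw [eq_univ_iff_forall]
    intro y
    choose z hz using fun i => I.range_eq_univ.symm ▸ mem_univ (y i)
    exact ⟨z, funext hz⟩

variable {M : Type*} [TopologicalSpace M] [ChartedSpace H M] [IsManifold I ∞ M]

/-- In the product charts the coordinate map is, near the point, a linear projection. -/
theorem hasMFDerivAt_apply [I.Boundaryless] (x : ι → M) (j : ι) :
    HasMFDerivAt (ModelWithCorners.pi fun _ : ι => I) I (fun x : ι → M => x j) x
      (ContinuousLinearMap.proj (R := ℝ) (φ := fun _ : ι => E) j) := by
  refine ⟨(continuous_apply j).continuousAt, HasFDerivAt.hasFDerivWithinAt ?_⟩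
  refine (ContinuousLinearMap.proj (R := ℝ) (φ := fun _ : ι => E) j).hasFDerivAt.congr_of_eventuallyEq
    ?_
  have h1 : (extChartAt I (x j)).target ∈ 𝓝 (extChartAt I (x j) (x j)) :=
    extChartAt_target_mem_nhds (x j)
  have h2 : ContinuousAt (fun y : ι → E => y j)
      (extChartAt (ModelWithCorners.pi fun _ : ι => I) x x) := (continuous_apply j).continuousAt
  filter_upwards [h2 h1] with y hy
  exact (extChartAt I (x j)).right_inv hy

/-- Differentiate `pr_j ∘ (product chart)⁻¹ = (j-th chart)⁻¹ ∘ pr_j`. Thus the trivialization of the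
tangent bundle of the product can be read factor by factor. -/
theorem symmL_pi_apply [I.Boundaryless] (x₀ x : ι → M)
    (hx : ∀ i, x i ∈ (chartAt H (x₀ i)).source) (v : ι → E) (j : ι) :
    ((trivializationAt (ι → E) (TangentSpace (ModelWithCorners.pi fun _ : ι => I)) x₀).symmL ℝ x v :
      ι → E) j = (trivializationAt E (TangentSpace I) (x₀ j)).symmL ℝ (x j) (v j) := by
  have hx' : x ∈ (chartAt (ModelPi fun _ : ι => H) x₀).source := fun i _ => hx i
  rw [TangentBundle.symmL_trivializationAt hx', TangentBundle.symmL_trivializationAt (hx j)]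
  let J := ModelWithCorners.pi fun _ : ι => I
  have h1 : MDifferentiableAt 𝓘(ℝ, ι → E) J (extChartAt J x₀).symm (extChartAt J x₀ x) := by
    rw [← mdifferentiableWithinAt_univ, ← J.range_eq_univ]
    exact mdifferentiableWithinAt_extChartAt_symm
      ((extChartAt J x₀).map_source (by rwa [extChartAt_source]))
  have h2 : MDifferentiableAt 𝓘(ℝ, E) I (extChartAt I (x₀ j)).symm
      (extChartAt I (x₀ j) (x j)) := by
    rw [← mdifferentiableWithinAt_univ, ← I.range_eq_univ]
    exact mdifferentiableWithinAt_extChartAt_symm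
      ((extChartAt I (x₀ j)).map_source (by rw [extChartAt_source]; exact hx j))
  have h3 := (hasMFDerivAt_apply I ((extChartAt J x₀).symm (extChartAt J x₀ x)) j).comp _
    h1.hasMFDerivAt
  have h4 := HasMFDerivAt.comp (extChartAt J x₀ x) (f := fun y : ι → E => y j) h2.hasMFDerivAt
    (ContinuousLinearMap.proj (R := ℝ) (φ := fun _ : ι => E) j).hasMFDerivAt
  have h5 := DFunLike.congr_fun (hasMFDerivAt_unique h3 h4) v
  rw [I.range_eq_univ, J.range_eq_univ, mfderivWithin_univ, mfderivWithin_univ]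
  exact h5

end Pi

/-! ### Lorentzian bilinear forms -/

section LorentzForm

variable {V : Type*} [NormedAddCommGroup V] [NormedSpace ℝ V] {B : V →L[ℝ] V →L[ℝ] ℝ}

/-- Symmetric bilinear forms of signature `(-, +, …, +)`. -/
structure IsLorentzForm (B : V →L[ℝ] V →L[ℝ] ℝ) : Prop where
  symm : ∀ v w, B v w = B w v
  signature : ∃ v, B v v < 0 ∧ ∀ w, B v w = 0 → w ≠ 0 → 0 < B w w

/-- The covectors `B v` of the timelike vectors `v` in the same half of the light cone as `T`. -/
def timelikeCone (B : V →L[ℝ] V →L[ℝ] ℝ) (T : V) : Set (V →L[ℝ] ℝ) :=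
  {ξ | ∃ v, ξ = B v ∧ B v v < 0 ∧ B v T < 0}

namespace IsLorentzForm

theorem apply_combination (hB : IsLorentzForm B) (a b : ℝ) (v w : V) :
    B (a • v + b • w) (a • v + b • w) = a ^ 2 * B v v + 2 * a * b * B v w + b ^ 2 * B w w := by
  simp only [map_add, map_smul, add_apply, smul_apply, smul_eq_mul, hB.symm w v]
  ring

/-- The orthogonal complement of a timelike vector is spacelike. -/
theorem pos_of_orthogonal (hB : IsLorentzForm B) {T w : V} (hT : B T T < 0) (hw : B T w = 0)
    (h0 : w ≠ 0) : 0 < B w w := by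
  obtain ⟨v, hv, hpos⟩ := hB.signature
  by_contra! hle
  have hT0 : T ≠ 0 := fun h => by simp [h] at hT
  have hvT : B v T ≠ 0 := fun h => (hpos T h hT0).not_gt hT
  -- The combination of `T` and `w` orthogonal to the `v` of the signature. As `B` is nonpositive on
  -- the span of `T` and `w`, `x` would contradict the positivity on the complement of `v`.
  let x := B v w • T + (-B v T) • w
  have hx : B v x = 0 := by
    simp only [x, map_add, map_smul, smul_eq_mul]
    ring
  have hxx : B x x ≤ 0 := by
    rw [hB.apply_combination, hw]
    have h1 : B v w ^ 2 * B T T ≤ 0 := mul_nonpos_of_nonneg_of_nonpos (sq_nonneg _) hT.le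
    have h2 : (-B v T) ^ 2 * B w w ≤ 0 := mul_nonpos_of_nonneg_of_nonpos (sq_nonneg _) hle
    linarith
  have hx0 : x ≠ 0 := fun h => by
    have h1 : B T x = B v w * B T T := by
      simp only [x, map_add, map_smul, smul_eq_mul, hw]
      ring
    rw [h, map_zero] at h1
    have h2 : B v w = 0 := (mul_eq_zero.1 h1.symm).resolve_right hT.ne
    have h3 : (-B v T) • w = 0 := by simpa [x, h2] using h
    exact (smul_ne_zero (neg_ne_zero.2 hvT) h0) h3
  exact (hpos x hx hx0).not_ge hxx

/-- The reverse Cauchy–Schwarz inequality, in its qualitative form. -/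
theorem neg_of_timelike (hB : IsLorentzForm B) {T v w : V} (hT : B T T < 0) (hv : B v v < 0)
    (hw : B w w < 0) (hvT : B v T < 0) (hwT : B w T < 0) : B v w < 0 := by
  by_contra! hle
  -- Again `x` is orthogonal to `v`; if `B v w ≥ 0`, all terms of `B x x` are nonpositive and the
  -- last one is negative.
  let x := B v w • T + (-B v T) • w
  have hx : B v x = 0 := by
    simp only [x, map_add, map_smul, smul_eq_mul]
    ring
  have hxx : B x x < 0 := by
    rw [hB.apply_combination, hB.symm T w]
    have h1 : B v w ^ 2 * B T T ≤ 0 := mul_nonpos_of_nonneg_of_nonpos (sq_nonneg _) hT.le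
    have h2 : (-B v T) ^ 2 * B w w < 0 := mul_neg_of_pos_of_neg (by nlinarith) hw
    have h3 : 2 * B v w * -B v T * B w T ≤ 0 :=
      mul_nonpos_of_nonneg_of_nonpos (by nlinarith) hwT.le
    linarith
  have hx0 : x ≠ 0 := fun h => by simp [h] at hxx
  exact (hB.pos_of_orthogonal hv hx hx0).not_gt hxx

theorem injective (hB : IsLorentzForm B) : Function.Injective B := by
  rw [injective_iff_map_eq_zero]
  intro w hw
  obtain ⟨v, hv, hpos⟩ := hB.signature
  by_contra h0
  have h1 : B v w = 0 := by rw [hB.symm, hw]; rfl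
  have h2 : B w w = 0 := by rw [hw]; rfl
  exact (hpos w h1 h0).ne' h2

theorem surjective [FiniteDimensional ℝ V] (hB : IsLorentzForm B) : Function.Surjective B := by
  have h : Module.finrank ℝ V = Module.finrank ℝ (V →L[ℝ] ℝ) := by
    rw [← (LinearMap.toContinuousLinearMap (𝕜 := ℝ) (E := V) (F' := ℝ)).finrank_eq]
    exact Subspace.dual_finrank_eq.symm
  exact (LinearMap.injective_iff_surjective_of_finrank_eq_finrank (f := B.toLinearMap) h).1
    hB.injective

/-- A vector in the polar of the timelike cone is causal. -/
theorem nonpos_of_polar (hB : IsLorentzForm B) {T v : V} (hT : B T T < 0)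
    (hv : ∀ w, B w w < 0 → B w T < 0 → B v w ≤ 0) : B v v ≤ 0 := by
  have hvT : B v T ≤ 0 := hv T hT hT
  by_contra! hpos
  -- Decompose `v = a T + x` with `x` orthogonal to `T`. In the unit `-B T T`, the value `B x x` is
  -- `n` and `B v v` is `n - a²`.
  set a := B v T / B T T with ha
  have ha0 : 0 ≤ a := div_nonneg_of_nonpos hvT hT.le
  have haT : a * B T T = B v T := div_mul_cancel₀ _ hT.ne
  let x := v - a • T
  have hTx : B T x = 0 := by
    simp only [x, map_sub, map_smul, smul_eq_mul, hB.symm T v, haT, sub_self]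
  set n := B x x / (-B T T) with hn
  have hnT : B x x = n * (-B T T) := (div_mul_cancel₀ _ (by linarith)).symm
  have hvx : v = a • T + (1 : ℝ) • x := by simp [x]
  have hvv : B v v = (n - a ^ 2) * (-B T T) := by
    rw [hvx, hB.apply_combination, hTx, hnT]; ring
  have hna : 0 < n - a ^ 2 := by
    rw [hvv] at hpos
    exact (pos_iff_pos_of_mul_pos hpos).2 (by linarith)
  -- The test vector `s T + x` is timelike if `n < s²`, and `B v` is positive on it if `a s < n`.
  -- For `a > 0` the midpoint of `a` and `n / a` satisfies both, because `a² < n`.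
  obtain ⟨s, hs0, hs1, hs2⟩ : ∃ s : ℝ, 0 < s ∧ n < s ^ 2 ∧ a * s < n := by
    rcases ha0.eq_or_lt with h | h
    · refine ⟨n + 1, by nlinarith, by nlinarith, by rw [← h]; nlinarith⟩
    · refine ⟨(n + a ^ 2) / (2 * a), div_pos (by nlinarith) (by positivity), ?_, ?_⟩
      · rw [div_pow, lt_div_iff₀ (by positivity)]
        nlinarith [sq_pos_of_pos hna]
      · rw [mul_div_assoc', div_lt_iff₀ (by positivity)]
        nlinarith
  have hw := hv (s • T + (1 : ℝ) • x) (by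
    rw [hB.apply_combination, hTx, hnT]; nlinarith) (by
    rw [hB.symm, map_add, map_smul, map_smul, hTx, smul_eq_mul, smul_zero, add_zero]
    exact mul_neg_of_pos_of_neg hs0 hT)
  have hvw : B v (s • T + (1 : ℝ) • x) = (n - a * s) * (-B T T) := by
    have h1 : B v x = n * (-B T T) := by
      rw [hvx]
      simp only [map_add, map_smul, add_apply, smul_apply, smul_eq_mul, hTx, ← hnT]
      ring
    rw [map_add, map_smul, map_smul, h1, ← haT, smul_eq_mul, smul_eq_mul]
    ring
  rw [hvw] at hw
  nlinarith

/-- The reverse Cauchy–Schwarz inequality passes to limits in one direction. In the other, `ξ = B v`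
with `v` causal by `nonpos_of_polar`, and `v + ε T` is timelike for every `ε > 0`. The inequalities
on test vectors are what can be followed when the base point moves. -/
theorem mem_closure_timelikeCone [FiniteDimensional ℝ V] (hB : IsLorentzForm B) {T : V}
    (hT : B T T < 0) {ξ : V →L[ℝ] ℝ} :
    ξ ∈ closure (timelikeCone B T) ↔ ∀ w, B w w < 0 → B w T < 0 → ξ w ≤ 0 := by
  constructor
  · intro hξ w hw hwT
    have hc : IsClosed {ξ : V →L[ℝ] ℝ | ξ w ≤ 0} :=
      isClosed_le (ContinuousLinearMap.apply ℝ ℝ w).continuous continuous_const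
    refine closure_minimal ?_ hc hξ
    rintro _ ⟨v, rfl, hv, hvT⟩
    exact (hB.neg_of_timelike hT hv hw hvT hwT).le
  · intro h
    obtain ⟨v, rfl⟩ := hB.surjective ξ
    have hvv := hB.nonpos_of_polar hT h
    have hvT := h T hT hT
    have hlim : Tendsto (fun ε : ℝ => B (v + ε • T)) (𝓝[>] 0) (𝓝 (B v)) := by
      have : Continuous fun ε : ℝ => B (v + ε • T) := by fun_prop
      simpa using (this.tendsto 0).mono_left nhdsWithin_le_nhds
    refine mem_closure_of_tendsto hlim ?_
    filter_upwards [self_mem_nhdsWithin] with ε hε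
    have hε' : 0 < ε := hε
    refine ⟨_, rfl, ?_, ?_⟩
    · have h1 := hB.apply_combination 1 ε v T
      rw [one_smul] at h1
      rw [h1]
      have h2 : ε ^ 2 * B T T < 0 := mul_neg_of_pos_of_neg (by positivity) hT
      have h3 : 2 * 1 * ε * B v T ≤ 0 := mul_nonpos_of_nonneg_of_nonpos (by positivity) hvT
      linarith
    · have h4 : ε * B T T < 0 := mul_neg_of_pos_of_neg hε' hT
      simp only [map_add, map_smul, add_apply, smul_apply, smul_eq_mul]
      linarith

end IsLorentzForm

end LorentzForm

/-! ### The microcausal cone -/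

section Microcausal

variable {d : ℕ} {M : Type*} [TopologicalSpace M] [ChartedSpace (EuclideanSpace ℝ (Fin d)) M]
  [IsManifold (𝓡 d) ∞ M]

theorem LorentzMetric.isLorentzForm (g : LorentzMetric d M) (x : M) :
    IsLorentzForm (V := EuclideanSpace ℝ (Fin d)) (g.form x) :=
  ⟨g.symm x, g.signature x⟩

theorem LorentzMetric.mem_closure_timelikeCone (g : LorentzMetric d M) {x : M}
    {T : TangentSpace (𝓡 d) x} (hT : g.form x T T < 0) {ξ : EuclideanSpace ℝ (Fin d) →L[ℝ] ℝ} :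
    ξ ∈ closure (timelikeCone (V := EuclideanSpace ℝ (Fin d)) (g.form x) T) ↔
      ∀ w : TangentSpace (𝓡 d) x, g.form x w w < 0 → g.form x w T < 0 → ξ w ≤ 0 :=
  (g.isLorentzForm x).mem_closure_timelikeCone hT

/-- The values of the metric on continuous vector fields are continuous. -/
theorem LorentzMetric.continuousAt_form (g : LorentzMetric d M) {v w : ∀ x : M, TangentSpace (𝓡 d) x}
    {x : M} (hv : ContinuousAt (fun x => (⟨x, v x⟩ : TangentBundle (𝓡 d) M)) x)
    (hw : ContinuousAt (fun x => (⟨x, w x⟩ : TangentBundle (𝓡 d) M)) x) :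
    ContinuousAt (fun x => g.form x (v x) (w x)) x := by
  have h : ContinuousAt
      (fun x => Bundle.TotalSpace.mk' ℝ (E := Bundle.Trivial M ℝ) x (g.form x (v x) (w x))) x :=
    g.contMDiff.continuous.continuousAt.clm_bundle_apply₂ (F₁ := EuclideanSpace ℝ (Fin d))
      (F₂ := EuclideanSpace ℝ (Fin d)) hv hw
  exact ((FiberBundle.continuousAt_totalSpace _ _).1 h).2

/-- The constant extension of a tangent vector in a local trivialization. -/
theorem exists_continuousAt_extension (x : M) (w : TangentSpace (𝓡 d) x) :
    ∃ v : EuclideanSpace ℝ (Fin d),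
      (trivializationAt (EuclideanSpace ℝ (Fin d)) (TangentSpace (𝓡 d)) x).symmL ℝ x v = w ∧
      ContinuousAt (fun y => (⟨y, (trivializationAt (EuclideanSpace ℝ (Fin d))
        (TangentSpace (𝓡 d)) x).symmL ℝ y v⟩ : TangentBundle (𝓡 d) M)) x := by
  let e := trivializationAt (EuclideanSpace ℝ (Fin d)) (TangentSpace (𝓡 d) : M → Type _) x
  have hx : x ∈ e.baseSet := FiberBundle.mem_baseSet_trivializationAt' x
  refine ⟨e.continuousLinearMapAt ℝ x w, e.symmL_continuousLinearMapAt hx w, ?_⟩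
  rw [FiberBundle.continuousAt_totalSpace]
  refine ⟨continuousAt_id, ContinuousAt.congr (f := fun _ => e.continuousLinearMapAt ℝ x w)
    continuousAt_const ?_⟩
  filter_upwards [e.open_baseSet.mem_nhds hx] with y hy
  have h1 := e.continuousLinearMapAt_symmL (R := ℝ) hy (e.continuousLinearMapAt ℝ x w)
  have h2 := e.linearMapAt_apply (R := ℝ) (b := y)
    (e.symmL ℝ y (e.continuousLinearMapAt ℝ x w))
  rw [if_pos hy] at h2
  exact h1.symm.trans h2

variable {k : ℕ}

/-- The `j`-th component of a covector of the product manifold. -/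
noncomputable def covectorComponent (z : CotangentBundle (powerModel d k) (Fin k → M)) (j : Fin k) :
    EuclideanSpace ℝ (Fin d) →L[ℝ] ℝ :=
  ContinuousLinearMap.comp (M₂ := Fin k → EuclideanSpace ℝ (Fin d)) z.2
    (ContinuousLinearMap.single ℝ (fun _ : Fin k => EuclideanSpace ℝ (Fin d)) j)

theorem covectorComponent_apply (z : CotangentBundle (powerModel d k) (Fin k → M)) (j : Fin k)
    (v : EuclideanSpace ℝ (Fin d)) :
    covectorComponent z j v = z.2 (Pi.single j v : Fin k → EuclideanSpace ℝ (Fin d)) := rfl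

/-- The differentials of the coordinate maps are the projections, so the `ξ j` in a decomposition
are forced to be the restrictions to the factors. -/
theorem mem_productCone {V : ∀ x : M, Set (TangentSpace (𝓡 d) x →L[ℝ] ℝ)}
    {z : CotangentBundle (powerModel d k) (Fin k → M)} :
    z ∈ productCone k V ↔ ∀ j, covectorComponent z j ∈ V (z.1 j) := by
  have hproj : ∀ j, mfderiv (powerModel d k) (𝓡 d) (fun x : Fin k → M => x j) z.1 =
      ContinuousLinearMap.proj (R := ℝ) (φ := fun _ : Fin k => EuclideanSpace ℝ (Fin d)) j :=
    fun j => (hasMFDerivAt_apply (𝓡 d) z.1 j).mfderiv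
  constructor
  · rintro ⟨ξ, hξ, hz⟩ j
    have : covectorComponent z j = ξ j := by
      ext1 v
      rw [covectorComponent_apply, hz]
      have h1 : (∑ i, (ξ i).comp (mfderiv (powerModel d k) (𝓡 d) (fun x : Fin k → M => x i) z.1))
          (Pi.single j v : Fin k → EuclideanSpace ℝ (Fin d)) =
          ∑ i, ξ i ((Pi.single j v : Fin k → EuclideanSpace ℝ (Fin d)) i) := by
        refine (sum_apply _ _ _).trans (Finset.sum_congr rfl fun i _ => ?_)
        exact congrArg (ξ i) (DFunLike.congr_fun (hproj i) _)
      rw [h1, Finset.sum_eq_single j, Pi.single_eq_same]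
      · rfl
      · intro i _ hij
        rw [Pi.single_eq_of_ne hij]
        exact map_zero (ξ i)
      · exact fun h => (h (Finset.mem_univ j)).elim
    rw [this]
    exact hξ j
  · intro h
    refine ⟨fun j => covectorComponent z j, h, ?_⟩
    refine ContinuousLinearMap.ext fun (v : Fin k → EuclideanSpace ℝ (Fin d)) => ?_
    have h1 : (∑ i, ContinuousLinearMap.comp (M₂ := TangentSpace (𝓡 d) (z.1 i))
        (covectorComponent z i)
        (mfderiv (powerModel d k) (𝓡 d) (fun x : Fin k → M => x i) z.1)) v =
        ∑ i, z.2 (Pi.single i (v i) : Fin k → EuclideanSpace ℝ (Fin d)) := by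
      refine (sum_apply _ _ _).trans (Finset.sum_congr rfl fun i _ => ?_)
      exact congrArg (covectorComponent z i) (DFunLike.congr_fun (hproj i) v)
    exact ((congrArg z.2 (Finset.univ_sum_single v).symm).trans (map_sum z.2 _ _)).trans h1.symm

variable (g : LorentzMetric d M) {X : ∀ x : M, TangentSpace (𝓡 d) x}

/-- A covector outside is detected by one factor `j` and one timelike `w`, in the half of `X`, on
which its `j`-th component is positive. Extended continuously, `w` keeps these strict inequalities
at all nearby covectors. -/
theorem isClosed_productCone (hX : ∀ x, g.form x (X x) (X x) < 0)
    (hXc : Continuous fun x => (⟨x, X x⟩ : TangentBundle (𝓡 d) M)) :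
    IsClosed (productCone k fun x =>
      closure (timelikeCone (V := EuclideanSpace ℝ (Fin d)) (g.form x) (X x))) := by
  rw [← isOpen_compl_iff, isOpen_iff_mem_nhds]
  intro z hz
  rw [mem_compl_iff, mem_productCone] at hz
  push Not at hz
  obtain ⟨j, hj⟩ := hz
  have hj' := (g.mem_closure_timelikeCone (hX (z.1 j))).not.1 hj
  push Not at hj'
  obtain ⟨w, hw, hwX, hpos⟩ := hj'
  obtain ⟨v, rfl, hv⟩ := exists_continuousAt_extension (z.1 j) w
  let W : ∀ y : M, TangentSpace (𝓡 d) y := fun y =>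
    (trivializationAt (EuclideanSpace ℝ (Fin d)) (TangentSpace (𝓡 d)) (z.1 j)).symmL ℝ y v
  have hproj : Continuous (Bundle.TotalSpace.proj :
      CotangentBundle (powerModel d k) (Fin k → M) → (Fin k → M)) := FiberBundle.continuous_proj _ _
  have hprojj : Continuous fun z : CotangentBundle (powerModel d k) (Fin k → M) => z.1 j :=
    (continuous_apply j).comp hproj
  have h1 : ∀ᶠ y in 𝓝 (z.1 j), g.form y (W y) (W y) < 0 :=
    (g.continuousAt_form hv hv).eventually (gt_mem_nhds hw)
  have h2 : ∀ᶠ y in 𝓝 (z.1 j), g.form y (W y) (X y) < 0 :=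
    (g.continuousAt_form hv hXc.continuousAt).eventually (gt_mem_nhds hwX)
  have h3 : ∀ᶠ y : Fin k → M in 𝓝 z.1, ∀ i,
      y i ∈ (chartAt (EuclideanSpace ℝ (Fin d)) (z.1 i)).source :=
    eventually_all.2 fun i => (continuous_apply i).continuousAt.eventually
      (chart_source_mem_nhds _ (z.1 i))
  -- The vector that is constant in the trivialization of the product is the extension `W` in the
  -- `j`-th factor and zero in the others.
  have hsymm : ∀ y : Fin k → M,
      (∀ i, y i ∈ (chartAt (EuclideanSpace ℝ (Fin d)) (z.1 i)).source) →
      ((trivializationAt (Fin k → EuclideanSpace ℝ (Fin d))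
        (TangentSpace (powerModel d k)) z.1).symmL ℝ y
          (Pi.single j v : Fin k → EuclideanSpace ℝ (Fin d)) : Fin k → EuclideanSpace ℝ (Fin d)) =
        Pi.single j (W (y j)) := fun y hy => by
    funext i
    rw [symmL_pi_apply (𝓡 d) z.1 y hy]
    rcases eq_or_ne i j with rfl | hij
    · rw [Pi.single_eq_same]
      exact (Pi.single_eq_same (M := fun _ : Fin k => EuclideanSpace ℝ (Fin d)) i (W (y i))).symm
    · rw [Pi.single_eq_of_ne hij]
      exact (map_zero _).trans
        (Pi.single_eq_of_ne (M := fun _ : Fin k => EuclideanSpace ℝ (Fin d)) hij (W (y j))).symm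
  have h4 : ContinuousAt (fun y : CotangentBundle (powerModel d k) (Fin k → M) =>
      y.2 ((trivializationAt (Fin k → EuclideanSpace ℝ (Fin d))
        (TangentSpace (powerModel d k)) z.1).symmL ℝ y.1
          (Pi.single j v : Fin k → EuclideanSpace ℝ (Fin d)))) z :=
    ((continuousAt_cotangentBundle (f := id) (t₀ := z)).1 continuousAt_id).2.clm_apply
      continuousAt_const
  have h5 : 0 < z.2 ((trivializationAt (Fin k → EuclideanSpace ℝ (Fin d))
        (TangentSpace (powerModel d k)) z.1).symmL ℝ z.1
          (Pi.single j v : Fin k → EuclideanSpace ℝ (Fin d))) :=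
    hpos.trans_eq (congrArg z.2 (hsymm z.1 fun i => mem_chart_source _ _).symm)
  filter_upwards [hprojj.continuousAt.eventually h1, hprojj.continuousAt.eventually h2,
    hproj.continuousAt.eventually h3, h4.eventually (lt_mem_nhds h5)] with y hy1 hy2 hy3 hy4 hy
  have h6 := (g.mem_closure_timelikeCone (hX (y.1 j))).1 (mem_productCone.1 hy j)
    (W (y.1 j)) hy1 hy2
  refine h6.not_gt (hy4.trans_eq (congrArg y.2 (hsymm y.1 hy3)))

theorem isConicSet_compl_productCone (hX : ∀ x, g.form x (X x) (X x) < 0) :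
    IsConicSet (productCone k fun x =>
      closure (timelikeCone (V := EuclideanSpace ℝ (Fin d)) (g.form x) (X x)))ᶜ := by
  intro z hz t ht hzt
  refine hz (mem_productCone.2 fun j => ?_)
  refine (g.mem_closure_timelikeCone (hX (z.1 j))).2 fun w hw hwX => ?_
  have h := (g.mem_closure_timelikeCone (hX (z.1 j))).1 (mem_productCone.1 hzt j) w hw hwX
  have h' : t * covectorComponent z j w ≤ 0 := h
  exact nonpos_of_mul_nonpos_right h' ht

/-- Reversing the time orientation reduces the past cones to the future ones. -/
theorem pastCone_eq (T : TimeOrientation g) (x : M) :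
    pastCone g T x = timelikeCone (V := EuclideanSpace ℝ (Fin d)) (g.form x) (-T.field x) := by
  ext ξ
  refine exists_congr fun v => and_congr Iff.rfl (and_congr Iff.rfl ?_)
  have h : g.form x v (-T.field x) = -g.form x v (T.field x) := map_neg (g.form x v) _
  exact neg_lt_zero.symm.trans (iff_of_eq (congrArg (· < 0) h.symm))

theorem TimeOrientation.continuous_neg {g : LorentzMetric d M} (T : TimeOrientation g) :
    Continuous fun x => (⟨x, -T.field x⟩ : TangentBundle (𝓡 d) M) := by
  rw [continuous_iff_continuousAt]
  intro x
  let e := trivializationAt (EuclideanSpace ℝ (Fin d)) (TangentSpace (𝓡 d) : M → Type _) x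
  have h := (FiberBundle.continuousAt_totalSpace _ _).1 (T.continuous.continuousAt (x := x))
  refine (FiberBundle.continuousAt_totalSpace _ _).2 ⟨h.1, h.2.neg.congr ?_⟩
  filter_upwards [e.open_baseSet.mem_nhds (FiberBundle.mem_baseSet_trivializationAt' x)] with y hy
  exact ((e.linear ℝ hy).map_neg (T.field y)).symm

theorem microcausalCone_eq (T : TimeOrientation g) :
    microcausalCone g T k = puncturedCotangent (powerModel d k) (Fin k → M) ∩
      ((productCone k fun x =>
        closure (timelikeCone (V := EuclideanSpace ℝ (Fin d)) (g.form x) (T.field x)))ᶜ ∩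
      (productCone k fun x =>
        closure (timelikeCone (V := EuclideanSpace ℝ (Fin d)) (g.form x) (-T.field x)))ᶜ) := by
  rw [← compl_union]
  simp only [← pastCone_eq]
  rfl

theorem TimeOrientation.timelike_neg {g : LorentzMetric d M} (T : TimeOrientation g) (x : M) :
    g.form x (-T.field x) (-T.field x) < 0 := by
  have := T.timelike x
  simpa using this

theorem isOpen_microcausalCone (T : TimeOrientation g) : IsOpen (microcausalCone g T k) := by
  rw [microcausalCone_eq]
  exact isOpen_puncturedCotangent.inter
    ((isClosed_productCone g T.timelike T.continuous).isOpen_compl.inter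
      (isClosed_productCone g T.timelike_neg T.continuous_neg).isOpen_compl)

theorem isConicSet_microcausalCone (T : TimeOrientation g) :
    IsConicSet (microcausalCone g T k) := by
  rw [microcausalCone_eq]
  exact fun z hz t ht => ⟨isConicSet_puncturedCotangent z hz.1 t ht,
    isConicSet_compl_productCone g T.timelike z hz.2.1 t ht,
    isConicSet_compl_productCone g T.timelike_neg z hz.2.2 t ht⟩

end Microcausal

theorem mainTheorem10 (d : ℕ) (M : Type*) [TopologicalSpace M]
    [ChartedSpace (EuclideanSpace ℝ (Fin d)) M] [IsManifold (𝓡 d) ∞ M]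
    [T2Space M] [SecondCountableTopology M]
    (g : LorentzMetric d M) (T : TimeOrientation g) (k : ℕ) (hk : 1 ≤ k) :
    (∃ Γ : ℕ → Set (CotangentBundle (powerModel d k) (Fin k → M)),
      IsConeExhaustion (microcausalCone g T k) Γ) ∧
    ∀ (Γ : ℕ → Set (CotangentBundle (powerModel d k) (Fin k → M)))
      (hΓ : IsConeExhaustion (microcausalCone g T k) Γ),
      IsLocallyConvexInductiveLimit (fun m => hormanderTopology (Γ m)) hΓ.distributionsWF_le
        (inductiveLimitTopology (fun m => hormanderTopology (Γ m)) hΓ.distributionsWF_le) ∧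
      IsNuclearTopology
        (inductiveLimitTopology (fun m => hormanderTopology (Γ m)) hΓ.distributionsWF_le) := by
  have : LocallyCompactSpace M := Manifold.locallyCompact_of_finiteDimensional (𝓡 d)
  have : LocallyCompactSpace (Fin k → M) := inferInstance
  exact ⟨exists_isConeExhaustion (isOpen_microcausalCone g T) (isConicSet_microcausalCone g T)
    fun z hz => hz.1, fun Γ hΓ => ⟨hΓ.isLocallyConvexInductiveLimit, hΓ.isNuclearTopology⟩⟩
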